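/- Let $X$ be a (connected) projective manifold, let $Y$ be a connected complex manifold of dimension $m\ge 1$, and let $p:X\to Y$ be a holomorphic submersion, with fibres $X_y:=p^{-1}(y)$ of dimension $n$. Let $(L,h_L)$ be a holomorphic line bundle on $X$ with a smooth Hermitian metric, such that $H^0(X_y,K_{X_y}\otimes L|_{X_y})\neq\{0\}$ for some $y\in Y$. For a holomorphic line bundle $E$ on $X$ with a smooth Hermitian metric $h_E$, the direct image $p_*(K_{X/Y}\otimes L\otimes E)$ is regarded as the family of vector spaces $\mathcal E_y:=H^0(X_y,K_{X_y}\otimes L|_{X_y}\otimes E|_{X_y})$, $y\in Y$, with the $L^2$ norm $\|u\|^2:=\int_{X_y}|u|^2_{h_L\otimes h_E}$; explicitly, $|u|^2_{h_L\otimes h_E}=|v|^2\,|f|^2_{h_L\otimes h_E}\,d\lambda(z)$ if $u=v\,dz_1\wedge\dots\wedge dz_n\otimes f$ in local coordinates $z$ of $X_y$ and a local holomorphic frame $f$ of $L\otimes E$, where $\lambda$ is Lebesgue measure. A section $y\mapsto u_y\in\mathcal E_y$ over an open set $W\subset Y$ is called holomorphic if it is holomorphic as a section of $K_{X/Y}\otimes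 L\otimes E$ over $p^{-1}(W)$. A section $y\mapsto\xi_y\in\mathcal E_y^*$ over an open set $V\subset Y$ is called holomorphic if, for every open $W\subset V$ and every holomorphic section $u$ over $W$, the function $y\mapsto\xi_y(u_y)$ is holomorphic on $W$. The direct image is called Griffiths semi-positive (in the singular sense) if, for every open $V\subset Y$ and every holomorphic section $\xi$ of $\mathcal E^*$ over $V$, the function $y\mapsto\log\|\xi_y\|$ is plurisubharmonic on $V$, where $\|\xi_y\|$ is the dual norm; here the value $-\infty$ is allowed, also identically. A Hermitian line bundle is called semi-positive if its Chern curvature is semi-positive, that is, $i\partial\bar\partial\varphi\ge0$ for every local weight $\varphi=-\log|f|^2$, where $f$ is a local holomorphic frame. Suppose that $p_*(K_{X/Y}\otimes L\otimes E)$ is Griffiths semi-positive for every semi-positive Hermitian holomorphic line bundle $(E,h_E)$ on $X$. Then the curvature of $(L,h_L)$ is semi-positive. -/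

import Mathlib

open scoped Manifold ContDiff Topology TensorProduct ComplexConjugate InnerProductSpace LinearAlgebra.Projectivization
open Bundle MeasureTheory

noncomputable section

namespace DirectImage

/-! ### Plurisubharmonic functions -/

/-- Mean value of `f` over the circle `{a + e^{iθ} b}`, for `f` with values in `[-∞, ∞]`: the mean
of the positive part minus the mean of the negative part.  The first is finite whenever `f` is upper
semicontinuous and `< ∞` on the circle. -/
def circleMean {k : ℕ} (f : (Fin k → ℂ) → EReal) (a b : Fin k → ℂ) : EReal :=
  ((⨍⁻ θ : ℝ, (f (a + Complex.exp (θ * Complex.I) • b)).toENNReal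
      ∂(volume.restrict (Set.Ioc 0 (2 * Real.pi))) : ENNReal) : EReal) -
  ((⨍⁻ θ : ℝ, (-f (a + Complex.exp (θ * Complex.I) • b)).toENNReal
      ∂(volume.restrict (Set.Ioc 0 (2 * Real.pi))) : ENNReal) : EReal)

/-- Plurisubharmonic functions `Ω → [-∞, ∞)` on an open set of `ℂ^k`: upper semicontinuous, with the
sub-mean value property on every closed affine disc in `Ω`.  The constant `-∞` is allowed. -/
def PshOn {k : ℕ} (f : (Fin k → ℂ) → EReal) (Ω : Set (Fin k → ℂ)) : Prop :=
  UpperSemicontinuousOn f Ω ∧ (∀ a ∈ Ω, f a < ⊤) ∧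
    ∀ a b : Fin k → ℂ, (∀ ζ : ℂ, ‖ζ‖ ≤ 1 → a + ζ • b ∈ Ω) → f a ≤ circleMean f a b

/-- Plurisubharmonic functions on an open subset `W` of a complex manifold. -/
def MPshOn (k : ℕ) {Y : Type*} [TopologicalSpace Y] [ChartedSpace (Fin k → ℂ) Y]
    (f : Y → EReal) (W : Set Y) : Prop :=
  ∀ c ∈ IsManifold.maximalAtlas 𝓘(ℂ, Fin k → ℂ) ω Y,
    PshOn (fun z => f (c.symm z)) (c.target ∩ c.symm ⁻¹' W)

/-! ### Projective manifolds -/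

/-- A compact complex manifold is projective if it has a holomorphic embedding into a complex
projective space.  Holomorphy and injectivity of the differential are expressed in local homogeneous
coordinates `f = [F]`: the tangent space of `ℙ(V)` at `[F]` is `V / ℂ F` (up to a twist). -/
def IsProjective (d : ℕ) (X : Type*) [TopologicalSpace X] [ChartedSpace (Fin d → ℂ) X] : Prop :=
  CompactSpace X ∧ ∃ (N : ℕ) (f : X → ℙ ℂ (Fin (N + 1) → ℂ)), Function.Injective f ∧
    ∀ x : X, ∃ (U : Set X) (F : X → Fin (N + 1) → ℂ), IsOpen U ∧ x ∈ U ∧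
      ContMDiffOn 𝓘(ℂ, Fin d → ℂ) 𝓘(ℂ, Fin (N + 1) → ℂ) ω F U ∧
      (∀ x' ∈ U, ∃ h : F x' ≠ 0, f x' = Projectivization.mk ℂ (F x') h) ∧
      ∀ v : TangentSpace 𝓘(ℂ, Fin d → ℂ) x,
        (mfderiv 𝓘(ℂ, Fin d → ℂ) 𝓘(ℂ, Fin (N + 1) → ℂ) F x v : Fin (N + 1) → ℂ) ∈
          Submodule.span ℂ {F x} → v = 0

/-! ### Hermitian holomorphic line bundles -/

section LineBundle

variable (d : ℕ) {X : Type*} [TopologicalSpace X] [ChartedSpace (Fin d → ℂ) X]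
  (L : X → Type*) [TopologicalSpace (TotalSpace ℂ L)] [∀ x, AddCommGroup (L x)]
  [∀ x, Module ℂ (L x)] [∀ x, TopologicalSpace (L x)] [FiberBundle ℂ L]

/-- `s` is a holomorphic frame (a nowhere vanishing holomorphic section) of `L` on the open
set `U`. -/
def IsHolFrame (U : Set X) (s : ∀ x, L x) : Prop :=
  IsOpen U ∧ (∀ x ∈ U, s x ≠ 0) ∧
    ContMDiffOn 𝓘(ℂ, Fin d → ℂ) (𝓘(ℂ, Fin d → ℂ).prod 𝓘(ℂ, ℂ)) ω
      (fun x => TotalSpace.mk' ℂ x (s x)) U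

/-- A smooth Hermitian metric on the holomorphic line bundle `L`. -/
structure HermitianMetric where
  /-- the Hermitian form on each fibre -/
  form : ∀ x, L x →ₗ⋆[ℂ] L x →ₗ[ℂ] ℂ
  conj_form : ∀ x (a b : L x), conj (form x a b) = form x b a
  form_pos : ∀ x (a : L x), a ≠ 0 → 0 < (form x a a).re
  smooth : ∀ (U : Set X) (s : ∀ x, L x), IsHolFrame d L U s →
    ContMDiffOn 𝓘(ℝ, Fin d → ℂ) 𝓘(ℝ, ℝ) ∞ (fun x => (form x (s x) (s x)).re) U

variable {d L}

/-- The squared length `|a|²_h`. -/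
def HermitianMetric.normSq (h : HermitianMetric d L) (x : X) (a : L x) : ℝ := (h.form x a a).re

/-- The Levi form `∑ φ_{j k̄} a_j ā_k` of `φ` at `z` in the direction `a`, which is a quarter of the
Laplacian at `0` of `w ↦ φ (z + w a)`. -/
def leviForm {k : ℕ} (φ : (Fin k → ℂ) → ℝ) (z a : Fin k → ℂ) : ℝ :=
  4⁻¹ * Laplacian.laplacian (fun w : ℂ => φ (z + w • a)) 0

/-- The Chern curvature of `(L, h)` is semi-positive: `i∂∂̄φ ≥ 0` in every holomorphic coordinate
chart, for every local weight `φ = - log |s|²_h`, where `s` is a local holomorphic frame. -/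
def HermitianMetric.SemiPositive (h : HermitianMetric d L) : Prop :=
  ∀ (U : Set X) (s : ∀ x, L x), IsHolFrame d L U s →
    ∀ c ∈ IsManifold.maximalAtlas 𝓘(ℂ, Fin d → ℂ) ω X,
      ∀ z ∈ c.target, c.symm z ∈ U → ∀ a : Fin d → ℂ,
        0 ≤ leviForm (fun z' => - Real.log (h.normSq (c.symm z') (s (c.symm z')))) z a

/-- The local holomorphic frames `s` (on open sets `U`) of a line bundle with fibres `M x`, together
with their squared lengths `w = |s|²`. -/
abbrev MetrizedFrames (M : X → Type*) := Set X → (∀ x, M x) → (X → ℝ) → Prop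

/-- Local holomorphic frames of a Hermitian line bundle `(L, h)`. -/
def lineFrames (h : HermitianMetric d L) : MetrizedFrames L := fun U s w =>
  IsHolFrame d L U s ∧ ∀ x ∈ U, w x = h.normSq x (s x)

/-- Local holomorphic frames `s₁ ⊗ s₂` of the tensor product `L ⊗ E` of two Hermitian line bundles,
with `|s₁ ⊗ s₂|² = |s₁|² |s₂|²`. -/
def tensorFrames {E : X → Type*} [TopologicalSpace (TotalSpace ℂ E)] [∀ x, AddCommGroup (E x)]
    [∀ x, Module ℂ (E x)] [∀ x, TopologicalSpace (E x)] [FiberBundle ℂ E]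
    (h : HermitianMetric d L) (k : HermitianMetric d E) :
    MetrizedFrames (fun x => L x ⊗[ℂ] E x) := fun U s w =>
  ∃ s₁ w₁ s₂ w₂, lineFrames h U s₁ w₁ ∧ lineFrames k U s₂ w₂ ∧
    ∀ x ∈ U, s x = s₁ x ⊗ₜ[ℂ] s₂ x ∧ w x = w₁ x * w₂ x

end LineBundle

/-! ### Direct images -/

section Fibration

variable (m n : ℕ) {X Y : Type*} [TopologicalSpace X] [ChartedSpace (Fin (m + n) → ℂ) X]
  [TopologicalSpace Y] [ChartedSpace (Fin m → ℂ) Y] (p : X → Y)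

/-- The tangent space at `x` of the fibre of `p` through `x`. -/
abbrev VertSpace (x : X) : Submodule ℂ (TangentSpace 𝓘(ℂ, Fin (m + n) → ℂ) x) :=
  LinearMap.ker (mfderiv 𝓘(ℂ, Fin (m + n) → ℂ) 𝓘(ℂ, Fin m → ℂ) p x).toLinearMap

/-- The fibre at `x` of `K_{X/Y} ⊗ M`, that is of `K_{X_y} ⊗ M` with `y = p x`: alternating
`n`-forms on the vertical tangent space with values in `M x`. -/
abbrev RelForm (M : X → Type*) [∀ x, AddCommGroup (M x)] [∀ x, Module ℂ (M x)] (x : X) :=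
  VertSpace m n p x [⋀^Fin n]→ₗ[ℂ] M x

/-- Holomorphic coordinates `(t, z)` on an open subset of `X` and `t` on an open subset of `Y` in
which `p` is the projection `(t, z) ↦ t`. -/
structure AdaptedChart where
  /-- the coordinates `(t, z)` -/
  chart : OpenPartialHomeomorph X ((Fin m → ℂ) × (Fin n → ℂ))
  /-- the coordinates `t` -/
  base : OpenPartialHomeomorph Y (Fin m → ℂ)
  holo : ContMDiffOn 𝓘(ℂ, Fin (m + n) → ℂ) 𝓘(ℂ, (Fin m → ℂ) × (Fin n → ℂ)) ω chart chart.source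
  holo_symm :
    ContMDiffOn 𝓘(ℂ, (Fin m → ℂ) × (Fin n → ℂ)) 𝓘(ℂ, Fin (m + n) → ℂ) ω chart.symm chart.target
  base_mem : base ∈ IsManifold.maximalAtlas 𝓘(ℂ, Fin m → ℂ) ω Y
  fibred : ∀ x ∈ chart.source, p x ∈ base.source ∧ (chart x).1 = base (p x)

variable {m n p}

/-- The relative form `dz₁ ∧ ⋯ ∧ dzₙ` at `x`. -/
def AdaptedChart.dz (Φ : AdaptedChart m n p) (x : X) : VertSpace m n p x [⋀^Fin n]→ₗ[ℂ] ℂ :=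
  (Matrix.detRowAlternating (R := ℂ) (n := Fin n)).compLinearMap
    ((LinearMap.snd ℂ (Fin m → ℂ) (Fin n → ℂ)).comp
      ((mfderiv 𝓘(ℂ, Fin (m + n) → ℂ) 𝓘(ℂ, (Fin m → ℂ) × (Fin n → ℂ)) Φ.chart x).toLinearMap.comp
        (VertSpace m n p x).subtype))

variable {M : X → Type*} [∀ x, AddCommGroup (M x)] [∀ x, Module ℂ (M x)]

/-- `dz₁ ∧ ⋯ ∧ dzₙ ⊗ s` at `x`. -/
def AdaptedChart.dzTensor (Φ : AdaptedChart m n p) (x : X) (s : M x) : RelForm m n p M x :=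
  (LinearMap.toSpanSingleton ℂ (M x) s).compAlternatingMap (Φ.dz x)

/-- The points of `X_y ∩ A`, in the fibre coordinate `z`. -/
def AdaptedChart.slice (Φ : AdaptedChart m n p) (y : Y) (A : Set X) : Set (Fin n → ℂ) :=
  {z | (Φ.base y, z) ∈ Φ.chart.target ∧ p (Φ.chart.symm (Φ.base y, z)) = y ∧
    Φ.chart.symm (Φ.base y, z) ∈ A}

/-- On `X_y`, over the domain of `Φ` and over `U`, the section `u` is `v(z) dz ⊗ s`. -/
def Represents (Φ : AdaptedChart m n p) (U : Set X) (s : ∀ x, M x) (y : Y)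
    (u : ∀ x : p ⁻¹' {y}, RelForm m n p M x) (v : (Fin n → ℂ) → ℂ) : Prop :=
  ∀ x : p ⁻¹' {y}, (x : X) ∈ Φ.chart.source → (x : X) ∈ U →
    u x = v (Φ.chart x).2 • Φ.dzTensor (x : X) (s x)

variable (p) in
/-- The space `H⁰(X_y, K_{X_y} ⊗ M|_{X_y})` of holomorphic sections. -/
def fibreSections (𝓕 : MetrizedFrames M) (y : Y) :
    Submodule ℂ (∀ x : p ⁻¹' {y}, RelForm m n p M x) where
  carrier := {u | ∀ (Φ : AdaptedChart m n p) (U : Set X) (s : ∀ x, M x) (w : X → ℝ), 𝓕 U s w →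
    ∃ v : (Fin n → ℂ) → ℂ, ContDiffOn ℂ ω v (Φ.slice y U) ∧ Represents Φ U s y u v}
  add_mem' := by
    intro u₁ u₂ h₁ h₂ Φ U s w hf
    obtain ⟨v₁, hv₁, e₁⟩ := h₁ Φ U s w hf
    obtain ⟨v₂, hv₂, e₂⟩ := h₂ Φ U s w hf
    refine ⟨fun z => v₁ z + v₂ z, hv₁.add hv₂, fun x hx hU => ?_⟩
    rw [Pi.add_apply, e₁ x hx hU, e₂ x hx hU, add_smul]
  zero_mem' := by
    intro Φ U s w hf
    exact ⟨fun _ => 0, contDiffOn_const, fun x hx hU => by simp⟩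
  smul_mem' := by
    intro c u h Φ U s w hf
    obtain ⟨v, hv, e⟩ := h Φ U s w hf
    refine ⟨fun z => c * v z, contDiffOn_const.mul hv, fun x hx hU => ?_⟩
    rw [Pi.smul_apply, e x hx hU, mul_smul]

/-- A Borel subset of `X` over which a section `u` on `X_y` is written as `v(z) dz ⊗ s` in adapted
coordinates, where `w = |s|²`. -/
structure LocalPiece (𝓕 : MetrizedFrames M) (y : Y) (u : ∀ x : p ⁻¹' {y}, RelForm m n p M x) where
  /-- adapted coordinates -/
  Φ : AdaptedChart m n p
  /-- domain of the frame -/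
  U : Set X
  /-- the frame -/
  s : ∀ x, M x
  /-- its squared length -/
  w : X → ℝ
  /-- the coefficient of the section -/
  v : (Fin n → ℂ) → ℂ
  /-- the Borel set -/
  A : Set X
  frame : 𝓕 U s w
  represents : Represents Φ U s y u v
  borel : MeasurableSet[borel X] A
  subset : A ⊆ Φ.chart.source ∩ U

/-- The integral of `|u|²` over `X_y ∩ A`: in coordinates, `|u|² = |v|² |s|² dλ(z)`. -/
def LocalPiece.mass {𝓕 : MetrizedFrames M} {y : Y} {u : ∀ x : p ⁻¹' {y}, RelForm m n p M x}
    (P : LocalPiece 𝓕 y u) : ENNReal :=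
  ∫⁻ z in P.Φ.slice y P.A,
    ENNReal.ofReal (‖P.v z‖ ^ 2 * P.w (P.Φ.chart.symm (P.Φ.base y, z)))

/-- The squared `L²` norm `‖u‖² = ∫_{X_y} |u|²`: the total mass of the measure on `X_y` given locally
by `|v|² |s|² dλ(z)`, i.e. the supremum of the sums of masses of finitely many disjoint local
pieces (attained by any finite decomposition of the compact fibre into such pieces). -/
def l2NormSq (𝓕 : MetrizedFrames M) (y : Y) (u : ∀ x : p ⁻¹' {y}, RelForm m n p M x) : ENNReal :=
  ⨆ (k : ℕ) (P : Fin k → LocalPiece 𝓕 y u)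
    (_ : Pairwise fun i j => Disjoint (P i).A (P j).A), ∑ i, (P i).mass

/-- The norm on `(H⁰(X_y, K_{X_y} ⊗ M|_{X_y}))^*` dual to the `L²` norm. -/
def dualNorm {𝓕 : MetrizedFrames M} {y : Y}
    (ξ : Module.Dual ℂ (fibreSections (m := m) (n := n) p 𝓕 y)) : ENNReal :=
  ⨆ (u : fibreSections (m := m) (n := n) p 𝓕 y) (_ : l2NormSq 𝓕 y u.1 ≤ 1), ‖ξ u‖ₑ

/-- The local section `y ↦ u_y` of `p_*(K_{X/Y} ⊗ M)` is holomorphic on `W`: it is holomorphic as a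
section of `K_{X/Y} ⊗ M` over `p⁻¹(W)`. -/
def HolSection {𝓕 : MetrizedFrames M} (u : ∀ y, fibreSections (m := m) (n := n) p 𝓕 y)
    (W : Set Y) : Prop :=
  ∀ (Φ : AdaptedChart m n p) (U : Set X) (s : ∀ x, M x) (w : X → ℝ), 𝓕 U s w →
    ∃ v : X → ℂ,
      ContMDiffOn 𝓘(ℂ, Fin (m + n) → ℂ) 𝓘(ℂ, ℂ) ω v (Φ.chart.source ∩ U ∩ p ⁻¹' W) ∧
      ∀ x ∈ Φ.chart.source ∩ U ∩ p ⁻¹' W,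
        (u (p x)).1 ⟨x, rfl⟩ = v x • Φ.dzTensor x (s x)

/-- The local section `y ↦ ξ_y` of the dual of `p_*(K_{X/Y} ⊗ M)` is holomorphic on `V`: `ξ_y(u_y)` is
holomorphic for every local holomorphic section `u`. -/
def HolDualSection {𝓕 : MetrizedFrames M}
    (ξ : ∀ y, Module.Dual ℂ (fibreSections (m := m) (n := n) p 𝓕 y)) (V : Set Y) : Prop :=
  ∀ W : Set Y, IsOpen W → W ⊆ V →
    ∀ u : ∀ y, fibreSections (m := m) (n := n) p 𝓕 y, HolSection u W →
      ContMDiffOn 𝓘(ℂ, Fin m → ℂ) 𝓘(ℂ, ℂ) ω (fun y => ξ y (u y)) W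

variable (m n p) in
/-- `p_*(K_{X/Y} ⊗ M)` with its `L²` metric is Griffiths semi-positive in the singular sense:
`log ‖ξ‖` is plurisubharmonic for every local holomorphic section `ξ` of its dual. -/
def GriffithsSemiPositive (𝓕 : MetrizedFrames M) : Prop :=
  ∀ V : Set Y, IsOpen V → ∀ ξ : ∀ y, Module.Dual ℂ (fibreSections (m := m) (n := n) p 𝓕 y),
    HolDualSection ξ V → MPshOn m (fun y => ENNReal.log (dualNorm (ξ y))) V

end Fibration

end DirectImage

end

set_option linter.unusedSectionVars false

open scoped Manifold ContDiff Topology TensorProduct ComplexConjugate InnerProductSpace LinearAlgebra.Projectivization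
open Bundle MeasureTheory

noncomputable section

namespace DirectImage


/-! ### Second-order expansions and the Levi form -/

section Taylor

variable {E : Type*} [NormedAddCommGroup E] [NormedSpace ℝ E]

/-! The Hessian of a local weight of `L` is continuous, so it suffices to prove non-negativity at a
dense set of points `x₀` and, at each of them, for a dense set of directions `a`. The points are
those where some section of `K_{X_y} ⊗ L` on the fibre through `x₀` does not vanish. The directions
are the non-vertical ones, which are dense because `m ≥ 1`.

Fix such `x₀` and `a`. The projective embedding gives coordinates `(t, w)` near `x₀` in which `p` is
`(t, w) ↦ t`, `w = q(v) / l(v)` is a ratio of linear forms in the homogeneous coordinates `v`, and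
`{w = 0}` is tangent to `a` (`AdaptedChart.exists_projective_coordinates`). Hence it suffices that
`ψ(t) = φ(t, 0)`, where `φ` is the weight of `L`, satisfies `ψ(t₀) ≤ mean of ψ(t₀ + ζ a_Y) over |ζ|
= r` up to `O(r³)`: `hessTrace_nonneg_of_submean` then gives the sign of the Hessian, since its
contribution has order `r²`.

For the sub-mean value inequality, take for `E` a power of `𝒪(1)` with a metric obtained from
finitely many homogeneous polynomials without common zeros; it is semi-positive because `log ∑
|f_j|²` is subharmonic on discs. The polynomials are chosen so that the section `σ = l^((k+1)(n+1))`
satisfies, near `x₀`, `|σ|² = (|w|² + R + ε)^{-(n+1)}`, where `R ≥ 0` is of order `2(k+1)` at `x₀`.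
Away from `x₀`, `|σ|²` is bounded independently of `ε`. For small `ε` the mass of `σ` on a fibre
over `t` near `t₀` concentrates at `w = 0`.

Let `ξ_t` be the functional taking a section on the fibre over `t` to its coefficient at `w = 0`. It
is a holomorphic section of the dual, so `log ‖ξ_t‖` is plurisubharmonic. On the circle, the mean
value property on the ball `|w| < ρ` bounds the norm of every section from below, whence `2 log
‖ξ_t‖ ≤ ψ(t) - log J + O(ρ)`, where `J` is the mass of the peak. At the centre, `u ⊗ σ` with `u` a
section not vanishing at `x₀` gives the opposite inequality. Thus no section has to be extended from
a fibre to its neighbours. With `ρ = r³`, `ε = r^{2(3n+5)}` and `k = 3n + 6` all errors are `O(r³)`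
(`exists_le_circleAverage_add`).

Density of the good points uses the same functionals with the trivial bundle `E = 𝒪(0)`. If all
fibrewise sections vanish on an open set, then `log ‖ξ_t‖ = -∞` on an open set. The sub-mean value
inequality propagates this, so the interior of the bad set is closed, and by connectedness of `X` it
is empty (`dense_compl_fibreBaseLocus`). -/

theorem isLittleO_taylor_two {φ : E → ℝ} {z : E} (h : ContDiffAt ℝ 2 φ z) :
    (fun v => φ (z + v) - φ z - fderiv ℝ φ z v - 2⁻¹ * fderiv ℝ (fderiv ℝ φ) z v v)
      =o[𝓝 0] fun v => ‖v‖ ^ 2 := by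
  have hsymm : ∀ v w, fderiv ℝ (fderiv ℝ φ) z v w = fderiv ℝ (fderiv ℝ φ) z w v :=
    fun v w => (h.isSymmSndFDerivAt (by simp)) v w
  set Q := fderiv ℝ (fderiv ℝ φ) z with hQ
  have hd : ∀ᶠ x in 𝓝 z, DifferentiableAt ℝ φ x :=
    (h.eventually (by simp)).mono fun x hx => hx.differentiableAt (by simp)
  have h1 : HasFDerivAt (fderiv ℝ φ) Q z :=
    ((h.fderiv_right (m := 1) (by norm_num)).differentiableAt (by simp)).hasFDerivAt
  rw [hasFDerivAt_iff_isLittleO_nhds_zero] at h1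
  rw [Asymptotics.isLittleO_iff]
  intro c hc
  have h2 := (Asymptotics.isLittleO_iff.1 h1) hc
  have h3 : ∀ᶠ v in 𝓝 (0 : E), DifferentiableAt ℝ φ (z + v) := by
    have : Filter.Tendsto (fun v : E => z + v) (𝓝 0) (𝓝 z) := by
      have hc : Continuous fun v : E => z + v := by fun_prop
      simpa using hc.tendsto 0
    exact this.eventually hd
  obtain ⟨ε, hε, hball⟩ := Metric.eventually_nhds_iff_ball.1 (h2.and h3)
  filter_upwards [Metric.ball_mem_nhds (0 : E) hε] with v hv
  let g : E → ℝ := fun v => φ (z + v) - φ z - fderiv ℝ φ z v - 2⁻¹ * Q v v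
  have hg : ∀ w ∈ Metric.closedBall (0 : E) ‖v‖,
      HasFDerivWithinAt g (fderiv ℝ φ (z + w) - fderiv ℝ φ z - Q w)
        (Metric.closedBall (0 : E) ‖v‖) w := by
    intro w hw
    have hwb : w ∈ Metric.ball (0 : E) ε := by
      simp only [Metric.mem_closedBall, dist_zero_right, Metric.mem_ball] at hw hv ⊢
      exact hw.trans_lt hv
    have e1 : HasFDerivAt (fun w => φ (z + w)) (fderiv ℝ φ (z + w)) w := by
      have := (hball w hwb).2.hasFDerivAt.comp w ((hasFDerivAt_id w).const_add z)
      simpa using! this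
    have e2 : HasFDerivAt (fun w => Q w w) (Q w + Q.flip w) w := by
      have := (Q.hasFDerivAt (x := w)).clm_apply (hasFDerivAt_id w)
      simpa using! this
    have e3 := ((e1.sub_const (φ z)).sub (fderiv ℝ φ z).hasFDerivAt).sub (e2.const_mul 2⁻¹)
    refine (HasFDerivAt.congr_fderiv e3 ?_).hasFDerivWithinAt
    ext u
    simp [hsymm u w]
    ring
  have hb : ∀ w ∈ Metric.closedBall (0 : E) ‖v‖,
      ‖fderiv ℝ φ (z + w) - fderiv ℝ φ z - Q w‖ ≤ c * ‖v‖ := by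
    intro w hw
    have hwb : w ∈ Metric.ball (0 : E) ε := by
      simp only [Metric.mem_closedBall, dist_zero_right, Metric.mem_ball] at hw hv ⊢
      exact hw.trans_lt hv
    refine (hball w hwb).1.trans ?_
    gcongr
    simpa using hw
  have := (convex_closedBall (0 : E) ‖v‖).norm_image_sub_le_of_norm_hasFDerivWithin_le hg hb
    (Metric.mem_closedBall_self (norm_nonneg _)) (y := v) (by simp)
  have hg0 : g 0 = 0 := by simp [g]
  rw [hg0, sub_zero, sub_zero] at this
  refine this.trans (le_of_eq ?_)
  rw [norm_pow, norm_norm]; ring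

end Taylor

/-! ### The Hessian trace over a complex line and the sub-mean value criterion. -/

section Levi

variable {E : Type*} [NormedAddCommGroup E] [NormedSpace ℂ E]

/-- The trace of the real Hessian over the complex line spanned by `a`. -/
def hessTrace (φ : E → ℝ) (z a : E) : ℝ :=
  fderiv ℝ (fderiv ℝ φ) z a a +
    fderiv ℝ (fderiv ℝ φ) z (Complex.I • a) (Complex.I • a)

/-- The second derivative pulls back along the real-linear map `w ↦ w • a`, and the Laplacian on `ℂ`
is the trace over `1, I`. This replaces the Laplacian in `leviForm` by an expression that is jointly
continuous in the point and the direction. -/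
theorem laplacian_line {φ : E → ℝ} {z : E} (a : E) (h : ContDiffAt ℝ 2 φ z) :
    Laplacian.laplacian (fun w : ℂ => φ (z + w • a)) 0 = hessTrace φ z a := by
  let ℓ : ℂ →L[ℝ] E := (ContinuousLinearMap.toSpanSingleton ℂ a).restrictScalars ℝ
  have hℓ : ∀ w : ℂ, ℓ w = w • a := fun w => rfl
  have key : ∀ u v : ℂ, fderiv ℝ (fderiv ℝ fun w : ℂ => φ (z + w • a)) 0 u v =
      fderiv ℝ (fderiv ℝ φ) z (u • a) (v • a) := by
    intro u v
    have hd : ∀ᶠ x in 𝓝 z, DifferentiableAt ℝ φ x :=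
      (h.eventually (by simp)).mono fun x hx => hx.differentiableAt (by simp)
    have ht : Filter.Tendsto (fun w : ℂ => z + w • a) (𝓝 0) (𝓝 z) := by
      have : Continuous fun w : ℂ => z + w • a := by fun_prop
      simpa using this.tendsto 0
    have e1 : (fderiv ℝ fun w : ℂ => φ (z + w • a)) =ᶠ[𝓝 0]
        fun w => (fderiv ℝ φ (z + w • a)).comp ℓ := by
      filter_upwards [ht.eventually hd] with w hw
      have := hw.hasFDerivAt.comp w ((ℓ.hasFDerivAt (x := w)).const_add z)
      exact this.fderiv
    rw [e1.fderiv_eq]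
    have h1 : DifferentiableAt ℝ (fderiv ℝ φ) (z + ((0 : ℂ) • a)) := by
      simpa using (h.fderiv_right (m := 1) (by norm_num)).differentiableAt (by simp)
    have e2 : HasFDerivAt (fun w : ℂ => fderiv ℝ φ (z + w • a))
        ((fderiv ℝ (fderiv ℝ φ) (z + (0 : ℂ) • a)).comp ℓ) 0 :=
      h1.hasFDerivAt.comp (0 : ℂ) ((ℓ.hasFDerivAt (x := 0)).const_add z)
    have e3 := e2.clm_comp (hasFDerivAt_const ℓ (0 : ℂ))
    rw [e3.fderiv]
    simp [hℓ]
  rw [InnerProductSpace.laplacian_eq_iteratedFDeriv_complexPlane]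
  simp only [iteratedFDeriv_two_apply, key]
  simp [hessTrace]

/-- Averaging commutes with real-linear maps, and `ζ ↦ (ζ, ζ²)` is holomorphic and vanishes at `0`.
All first-order terms and the harmonic second-order terms of a Taylor expansion have this form. -/
theorem circleAverage_of_holomorphic_vanishing (Λ : ℂ × ℂ →L[ℝ] ℝ) (r : ℝ) :
    Real.circleAverage (fun ζ : ℂ => Λ (ζ, ζ ^ 2)) 0 r = 0 := by
  have hd : Differentiable ℂ fun ζ : ℂ => (ζ, ζ ^ 2) := by fun_prop
  have h := Λ.circleAverage_comp_comm (f := fun ζ : ℂ => (ζ, ζ ^ 2)) (c := 0) (R := r)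
    (hd.continuous.continuousOn.circleIntegrable')
  have h2 : Real.circleAverage (fun ζ : ℂ => (ζ, ζ ^ 2)) 0 r = ((0 : ℂ), (0 : ℂ)) := by
    have := DiffContOnCl.circleAverage (f := fun ζ : ℂ => (ζ, ζ ^ 2)) (c := 0) (R := r)
      hd.diffContOnCl
    simpa using this
  rw [h2, Prod.mk_zero_zero, map_zero] at h
  exact h

/-- If `φ` satisfies, up to an error `O(r³)`, the sub-mean value inequality along a curve `γ` with
second-order jet `z + ζ a + ζ² b`, then its Levi form is nonnegative in the direction `a`. -/
theorem hessTrace_nonneg_of_submean {φ : E → ℝ} {z a b : E} (h : ContDiffAt ℝ 2 φ z)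
    {γ : ℂ → E} (hγ : (fun ζ => γ ζ - (z + ζ • a + ζ ^ 2 • b)) =o[𝓝 0] fun ζ => ‖ζ‖ ^ 2)
    {C : ℝ} (hsub : ∀ᶠ r in 𝓝[>] (0 : ℝ),
      CircleIntegrable (fun ζ => φ (γ ζ)) 0 r ∧
      φ z ≤ Real.circleAverage (fun ζ => φ (γ ζ)) 0 r + C * r ^ 3) :
    0 ≤ hessTrace φ z a := by
  set Q := fderiv ℝ (fderiv ℝ φ) z with hQ
  have hsymm : ∀ v w, Q v w = Q w v := fun v w => (h.isSymmSndFDerivAt (by simp)) v w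
  have hγO : (fun ζ => γ ζ - z) =O[𝓝 0] fun ζ : ℂ => ‖ζ‖ := by
    have e : (fun ζ => γ ζ - z) = fun ζ => (γ ζ - (z + ζ • a + ζ ^ 2 • b)) + (ζ • a + ζ ^ 2 • b) := by
      ext ζ; abel
    have hsq : (fun ζ : ℂ => ‖ζ‖ ^ 2) =O[𝓝 0] fun ζ : ℂ => ‖ζ‖ := by
      have : (fun ζ : ℂ => ‖ζ‖ ^ 2) =o[𝓝 0] fun ζ : ℂ => ‖ζ‖ ^ 1 :=
        Asymptotics.IsLittleO.comp_tendsto (Asymptotics.isLittleO_pow_pow (𝕜 := ℝ) one_lt_two)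
          tendsto_norm_zero
      simpa using this.isBigO
    rw [e]
    refine (hγ.isBigO.trans hsq).add (Asymptotics.IsBigO.add ?_ ?_)
    · exact Asymptotics.IsBigO.of_bound ‖a‖ (.of_forall fun ζ => by
        rw [norm_smul, norm_norm, mul_comm])
    · refine Asymptotics.IsBigO.trans ?_ hsq
      exact Asymptotics.IsBigO.of_bound ‖b‖ (.of_forall fun ζ => by
        rw [norm_smul, norm_pow, norm_pow, norm_norm, mul_comm])
  have hγ0 : Filter.Tendsto (fun ζ => γ ζ - z) (𝓝 0) (𝓝 0) :=
    hγO.trans_tendsto tendsto_norm_zero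
  -- the quadratic term
  have hquad : (fun ζ : ℂ => Q (γ ζ - z) (γ ζ - z) - Q (ζ • a) (ζ • a)) =o[𝓝 0] fun ζ => ‖ζ‖ ^ 2 := by
    have hlin : (fun ζ : ℂ => γ ζ - z - ζ • a) =o[𝓝 0] fun ζ : ℂ => ‖ζ‖ := by
      have e : (fun ζ : ℂ => γ ζ - z - ζ • a) =
          fun ζ => (γ ζ - (z + ζ • a + ζ ^ 2 • b)) + ζ ^ 2 • b := by
        ext ζ; abel
      have hsq : (fun ζ : ℂ => ‖ζ‖ ^ 2) =o[𝓝 0] fun ζ : ℂ => ‖ζ‖ := by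
        have : (fun ζ : ℂ => ‖ζ‖ ^ 2) =o[𝓝 0] fun ζ : ℂ => ‖ζ‖ ^ 1 :=
          Asymptotics.IsLittleO.comp_tendsto (Asymptotics.isLittleO_pow_pow (𝕜 := ℝ) one_lt_two)
            tendsto_norm_zero
        simpa using this
      rw [e]
      refine (hγ.trans hsq).add (Asymptotics.IsBigO.trans_isLittleO ?_ hsq)
      exact Asymptotics.IsBigO.of_bound ‖b‖ (.of_forall fun ζ => by
        rw [norm_smul, norm_pow, norm_pow, norm_norm, mul_comm])
    have hlinO : (fun ζ : ℂ => ζ • a) =O[𝓝 0] fun ζ : ℂ => ‖ζ‖ :=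
      Asymptotics.IsBigO.of_bound ‖a‖ (.of_forall fun ζ => by
        rw [norm_smul, norm_norm, mul_comm])
    have e : (fun ζ : ℂ => Q (γ ζ - z) (γ ζ - z) - Q (ζ • a) (ζ • a)) =
        fun ζ => Q (γ ζ - z - ζ • a) (γ ζ - z) + Q (ζ • a) (γ ζ - z - ζ • a) := by
      ext ζ; simp only [map_sub, sub_apply]; ring
    have hbil : ∀ f g : ℂ → E, (fun ζ => Q (f ζ) (g ζ)) =O[𝓝 0] fun ζ => ‖f ζ‖ * ‖g ζ‖ :=
      fun f g => Asymptotics.IsBigO.of_bound ‖Q‖ (.of_forall fun ζ => by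
        rw [norm_mul, norm_norm, norm_norm, ← mul_assoc]; exact Q.le_opNorm₂ _ _)
    rw [e]
    refine Asymptotics.IsLittleO.add ?_ ?_
    · refine (hbil _ _).trans_isLittleO ?_
      simp_rw [pow_two]
      exact hlin.norm_left.mul_isBigO hγO.norm_left
    · refine (hbil _ _).trans_isLittleO ?_
      simp_rw [pow_two]
      exact hlinO.norm_left.mul_isLittleO hlin.norm_left
  -- total expansion
  have hexp : (fun ζ : ℂ => φ (γ ζ) - φ z - fderiv ℝ φ z (ζ • a + ζ ^ 2 • b) -
      2⁻¹ * Q (ζ • a) (ζ • a)) =o[𝓝 0] fun ζ => ‖ζ‖ ^ 2 := by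
    have h1 := (isLittleO_taylor_two h).comp_tendsto hγ0
    have h1' : ((fun v => φ (z + v) - φ z - fderiv ℝ φ z v - 2⁻¹ * Q v v) ∘ fun ζ => γ ζ - z)
        =o[𝓝 0] fun ζ : ℂ => ‖ζ‖ ^ 2 := h1.trans_isBigO (hγO.norm_left.pow 2)
    have h2 : (fun ζ => fderiv ℝ φ z (γ ζ - (z + ζ • a + ζ ^ 2 • b))) =o[𝓝 0]
        fun ζ : ℂ => ‖ζ‖ ^ 2 := ((fderiv ℝ φ z).isBigO_comp _ _).trans_isLittleO hγ
    refine ((h1'.add h2).add (hquad.const_mul_left 2⁻¹)).congr_left fun ζ => ?_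
    simp only [Function.comp, map_sub, map_add, add_sub_cancel]
    ring
  by_contra hneg
  push Not at hneg
  set T := hessTrace φ z a with hT
  rw [Asymptotics.isLittleO_iff] at hexp
  -- The main term of the average is `r² T / 4`; the Taylor remainder and `C r³` are each allowed
  -- half of its size.
  have hc : 0 < -T / 8 := by linarith
  obtain ⟨ε, hε, hball⟩ := Metric.eventually_nhds_iff_ball.1 (hexp hc)
  have hr1 : ∀ᶠ r in 𝓝[>] (0 : ℝ), r < ε := nhdsWithin_le_nhds (eventually_lt_nhds hε)
  have hr2 : ∀ᶠ r in 𝓝[>] (0 : ℝ), C * r < -T / 8 := by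
    have : Filter.Tendsto (fun r : ℝ => C * r) (𝓝[>] 0) (𝓝 0) := by
      have : Continuous fun r : ℝ => C * r := by fun_prop
      simpa using (this.tendsto 0).mono_left nhdsWithin_le_nhds
    exact this.eventually (eventually_lt_nhds hc)
  obtain ⟨r, ⟨⟨⟨hint, hle⟩, hrε⟩, hrC⟩, hr0⟩ :=
    (((hsub.and hr1).and hr2).and self_mem_nhdsWithin).exists
  have hr0 : 0 < r := hr0
  -- For `|ζ| = r`, the term `2⁻¹ Q(ζa, ζa)` is `r² T / 4` plus a combination of `Re ζ²` and `Im
  -- ζ²`. `Λ` collects this combination and the first-order terms; it averages to zero, which is why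
  -- the second-order coefficient `b` of the curve plays no role.
  let Λ : ℂ × ℂ →L[ℝ] ℝ :=
    (fderiv ℝ φ z).comp ((((ContinuousLinearMap.toSpanSingleton ℂ a).restrictScalars ℝ).comp
        (ContinuousLinearMap.fst ℝ ℂ ℂ)) +
      (((ContinuousLinearMap.toSpanSingleton ℂ b).restrictScalars ℝ).comp
        (ContinuousLinearMap.snd ℝ ℂ ℂ))) +
    (4⁻¹ * (Q a a - Q (Complex.I • a) (Complex.I • a))) •
      (Complex.reCLM.comp (ContinuousLinearMap.snd ℝ ℂ ℂ)) +
    (2⁻¹ * Q a (Complex.I • a)) • (Complex.imCLM.comp (ContinuousLinearMap.snd ℝ ℂ ℂ))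
  have hΛ : ∀ ζ : ℂ, ‖ζ‖ = r → fderiv ℝ φ z (ζ • a + ζ ^ 2 • b) + 2⁻¹ * Q (ζ • a) (ζ • a) =
      Λ (ζ, ζ ^ 2) + 4⁻¹ * r ^ 2 * T := by
    intro ζ hζ
    have hd : ζ • a = (ζ.re : ℝ) • a + (ζ.im : ℝ) • (Complex.I • a) := by
      conv_lhs => rw [← Complex.re_add_im ζ]
      rw [add_smul, mul_smul, Complex.coe_smul, Complex.coe_smul]
    have hn : ζ.re ^ 2 + ζ.im ^ 2 = r ^ 2 := by
      rw [← hζ, Complex.sq_norm, Complex.normSq_apply]; ring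
    have hq : Q (ζ • a) (ζ • a) = ζ.re ^ 2 * Q a a + 2 * (ζ.re * ζ.im) * Q a (Complex.I • a) +
        ζ.im ^ 2 * Q (Complex.I • a) (Complex.I • a) := by
      rw [hd]
      simp only [map_add, map_smul, add_apply, smul_apply, smul_eq_mul]
      rw [hsymm (Complex.I • a) a]; ring
    have h2re : (ζ ^ 2).re = ζ.re ^ 2 - ζ.im ^ 2 := by simp [pow_two]
    have h2im : (ζ ^ 2).im = 2 * (ζ.re * ζ.im) := by simp [pow_two]; ring
    have hΛe : Λ (ζ, ζ ^ 2) = fderiv ℝ φ z (ζ • a + ζ ^ 2 • b) +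
      4⁻¹ * (Q a a - Q (Complex.I • a) (Complex.I • a)) * (ζ ^ 2).re +
      2⁻¹ * Q a (Complex.I • a) * (ζ ^ 2).im := rfl
    rw [hq, hΛe, h2re, h2im, ← hn, hT, hessTrace, ← hQ]
    ring
  have hpt : ∀ ζ ∈ Metric.sphere (0 : ℂ) |r|, φ (γ ζ) ≤
      Λ (ζ, ζ ^ 2) + (φ z + 4⁻¹ * r ^ 2 * T + -T / 8 * r ^ 2) := by
    intro ζ hζ
    have hζr : ‖ζ‖ = r := by simpa [abs_of_pos hr0] using hζ
    have := hball ζ (by simpa [hζr] using hrε)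
    rw [norm_pow, norm_norm, hζr, Real.norm_eq_abs, abs_le] at this
    have := hΛ ζ hζr
    linarith
  have hcont : Continuous fun ζ : ℂ => Λ (ζ, ζ ^ 2) := by fun_prop
  have hmono := Real.circleAverage_mono hint
    ((hcont.add continuous_const).continuousOn.circleIntegrable') hpt
  have hav : Real.circleAverage (fun ζ : ℂ => Λ (ζ, ζ ^ 2) +
      (φ z + 4⁻¹ * r ^ 2 * T + -T / 8 * r ^ 2)) 0 r = φ z + 4⁻¹ * r ^ 2 * T + -T / 8 * r ^ 2 := by
    rw [Real.circleAverage_fun_add hcont.continuousOn.circleIntegrable'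
      continuous_const.continuousOn.circleIntegrable', circleAverage_of_holomorphic_vanishing,
      Real.circleAverage_const, zero_add]
  have h3 : Real.circleAverage (fun ζ => φ (γ ζ)) 0 r ≤
      φ z + 4⁻¹ * r ^ 2 * T + -T / 8 * r ^ 2 := hmono.trans hav.le
  have h4 : C * r ^ 3 < -T / 8 * r ^ 2 := by
    have : C * r ^ 3 = (C * r) * r ^ 2 := by ring
    rw [this]; gcongr
  nlinarith [sq_nonneg r]

/-- At a local minimum the sub-mean value inequality holds along the straight line with no error
term. -/
theorem hessTrace_nonneg_of_isLocalMin {φ : ℂ → ℝ} {z : ℂ} (h : ContDiffAt ℝ 2 φ z)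
    (hmin : IsLocalMin φ z) : 0 ≤ hessTrace φ z 1 := by
  refine hessTrace_nonneg_of_submean (γ := fun ζ => z + ζ) (b := 0) (C := 0) h ?_ ?_
  · simp
  · obtain ⟨ε, hε, hball⟩ := Metric.eventually_nhds_iff_ball.1
      ((show ∀ᶠ x in 𝓝 z, φ z ≤ φ x from hmin).and
        ((h.eventually (by simp)).mono fun x hx => hx.continuousAt))
    filter_upwards [nhdsWithin_le_nhds (eventually_lt_nhds hε), self_mem_nhdsWithin] with r hr hr0
    have hr0 : 0 < r := hr0
    have hmem : ∀ ζ ∈ Metric.sphere (0 : ℂ) |r|, z + ζ ∈ Metric.ball z ε := by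
      intro ζ hζ
      simp only [mem_sphere_iff_norm, sub_zero, abs_of_pos hr0] at hζ
      simpa [hζ] using hr
    have hint : CircleIntegrable (fun ζ => φ (z + ζ)) 0 r := by
      refine ContinuousOn.circleIntegrable' fun ζ hζ => ContinuousAt.continuousWithinAt ?_
      exact ContinuousAt.comp (f := fun ζ => z + ζ) (g := φ) (hball _ (hmem ζ hζ)).2 (by fun_prop)
    refine ⟨hint, ?_⟩
    have := Real.circleAverage_mono (f₁ := fun _ => φ z) (c := 0) (R := r)
      continuous_const.continuousOn.circleIntegrable' hint fun ζ hζ => (hball _ (hmem ζ hζ)).1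
    simpa [Real.circleAverage_const] using this

end Levi

theorem leviForm_eq_hessTrace {k : ℕ} {φ : (Fin k → ℂ) → ℝ} {z : Fin k → ℂ} (a : Fin k → ℂ)
    (h : ContDiffAt ℝ 2 φ z) : leviForm φ z a = 4⁻¹ * hessTrace φ z a := by
  rw [leviForm, laplacian_line a h]


/-! ### Circle means and plurisubharmonic functions -/

section CircleMean

variable {k : ℕ}

/-- The positive part of `f` is at most that of `g`, and its negative part is at least that of `g`;
both parts of `g` have finite integral, so their difference is the real average. Only monotonicity
of the integral is applied to `f`, hence it need not be measurable. -/
theorem circleMean_le_circleAverage {f : (Fin k → ℂ) → EReal} {a b : Fin k → ℂ} {g : ℂ → ℝ} {r : ℝ}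
    (hg : CircleIntegrable g 0 r)
    (h : ∀ θ : ℝ, f (a + Complex.exp (θ * Complex.I) • b) ≤
      ((g (r * Complex.exp (θ * Complex.I)) : ℝ) : EReal)) :
    circleMean f a b ≤ ((Real.circleAverage g 0 r : ℝ) : EReal) := by
  set μ : Measure ℝ := volume.restrict (Set.Ioc 0 (2 * Real.pi)) with hμ
  have hpi : (0 : ℝ) < 2 * Real.pi := by positivity
  have hμu : μ Set.univ = ENNReal.ofReal (2 * Real.pi) := by simp [hμ]
  let G : ℝ → ℝ := fun θ => g (circleMap 0 r θ)
  have hGe : ∀ θ : ℝ, G θ = g (r * Complex.exp (θ * Complex.I)) := fun θ => by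
    simp [G, circleMap]
  have hGi : Integrable G μ := by
    have := hg
    rw [CircleIntegrable, intervalIntegrable_iff_integrableOn_Ioc_of_le hpi.le] at this
    exact this
  have hav : Real.circleAverage g 0 r = (2 * Real.pi)⁻¹ * ∫ θ, G θ ∂μ := by
    rw [Real.circleAverage_def, intervalIntegral.integral_of_le hpi.le, smul_eq_mul]
  have e1 : (⨍⁻ θ, (f (a + Complex.exp (θ * Complex.I) • b)).toENNReal ∂μ) ≤
      ⨍⁻ θ, ENNReal.ofReal (G θ) ∂μ := by
    refine laverage_mono_ae (.of_forall fun θ => ?_)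
    have := EReal.toENNReal_le_toENNReal (h θ)
    rwa [EReal.toENNReal_of_ne_top (EReal.coe_ne_top _), EReal.toReal_coe, ← hGe] at this
  have e2 : (⨍⁻ θ, ENNReal.ofReal (-G θ) ∂μ) ≤
      ⨍⁻ θ, (-f (a + Complex.exp (θ * Complex.I) • b)).toENNReal ∂μ := by
    refine laverage_mono_ae (.of_forall fun θ => ?_)
    have := EReal.toENNReal_le_toENNReal (EReal.neg_le_neg_iff.2 (h θ))
    rwa [← EReal.coe_neg, EReal.toENNReal_of_ne_top (EReal.coe_ne_top _), EReal.toReal_coe,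
      ← hGe] at this
  refine (EReal.sub_le_sub (EReal.coe_ennreal_le_coe_ennreal_iff.2 e1)
    (EReal.coe_ennreal_le_coe_ennreal_iff.2 e2)).trans (le_of_eq ?_)
  have hf1 : (∫⁻ θ, ENNReal.ofReal (G θ) ∂μ) ≠ ⊤ := hGi.lintegral_lt_top.ne
  have hf2 : (∫⁻ θ, ENNReal.ofReal (-G θ) ∂μ) ≠ ⊤ := hGi.neg.lintegral_lt_top.ne
  rw [laverage_eq, laverage_eq, hμu, hav,
    integral_eq_lintegral_pos_part_sub_lintegral_neg_part hGi]
  have h2 : ENNReal.ofReal (2 * Real.pi) ≠ 0 := by simpa using Real.pi_pos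
  have key : ∀ x : ENNReal, x ≠ ⊤ →
      ((x / ENNReal.ofReal (2 * Real.pi) : ENNReal) : EReal) =
        (((2 * Real.pi)⁻¹ * x.toReal : ℝ) : EReal) := by
    intro x hx
    have hfin : x / ENNReal.ofReal (2 * Real.pi) ≠ ⊤ := ENNReal.div_ne_top hx h2
    rw [← EReal.coe_toReal (x := ((x / ENNReal.ofReal (2 * Real.pi) : ENNReal) : EReal))
      (by simpa using hfin) (by simp)]
    simp only [EReal.toReal_coe_ennreal, ENNReal.toReal_div, ENNReal.toReal_ofReal hpi.le]
    rw [div_eq_inv_mul]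
  rw [key _ hf1, key _ hf2, ← EReal.coe_sub, mul_sub]

/-- If `f` is `-∞` near the point `a + b` of the circle, its mean value is `-∞`. -/
theorem circleMean_eq_bot {f : (Fin k → ℂ) → EReal} {a b : Fin k → ℂ} {Ω : Set (Fin k → ℂ)}
    (husc : UpperSemicontinuousOn f Ω) (hlt : ∀ z ∈ Ω, f z < ⊤)
    (hΩ : ∀ θ : ℝ, a + Complex.exp (θ * Complex.I) • b ∈ Ω)
    (hbot : ∀ᶠ z in 𝓝 (a + b), f z = ⊥) : circleMean f a b = ⊥ := by
  set c : ℝ → Fin k → ℂ := fun θ => a + Complex.exp (θ * Complex.I) • b with hc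
  have hcc : Continuous c := by fun_prop
  set μ : Measure ℝ := volume.restrict (Set.Ioc 0 (2 * Real.pi)) with hμ
  have hpi : (0 : ℝ) < 2 * Real.pi := by positivity
  have hc2 : c (2 * Real.pi) = a + b := by simp [hc]
  have hneg : (⨍⁻ θ, (-f (c θ)).toENNReal ∂μ) = ⊤ := by
    have hev : ∀ᶠ θ in 𝓝 (2 * Real.pi), f (c θ) = ⊥ :=
      (hcc.tendsto' _ _ hc2).eventually hbot
    obtain ⟨δ, hδ, hball⟩ := Metric.eventually_nhds_iff_ball.1 hev
    have hδ' : 0 < min δ (2 * Real.pi) := lt_min hδ hpi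
    -- The point `a + b` sits at `θ = 2π`, the endpoint contained in `Ioc 0 (2π)`. A one-sided
    -- interval ending there already has positive length and makes the negative part infinite.
    set S : Set ℝ := Set.Ioo (2 * Real.pi - min δ (2 * Real.pi)) (2 * Real.pi) with hS
    have hSsub : S ⊆ Set.Ioc 0 (2 * Real.pi) := fun θ hθ =>
      ⟨by have := min_le_right δ (2 * Real.pi); linarith [hθ.1], hθ.2.le⟩
    have hSf : ∀ θ ∈ S, (-f (c θ)).toENNReal = ⊤ := by
      intro θ hθ
      have : f (c θ) = ⊥ := hball θ (by
        rw [Metric.mem_ball, Real.dist_eq, abs_lt]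
        have := min_le_left δ (2 * Real.pi)
        constructor <;> linarith [hθ.1, hθ.2])
      simp [this]
    have hint : (∫⁻ θ, (-f (c θ)).toENNReal ∂μ) = ⊤ := by
      rw [eq_top_iff]
      calc (⊤ : ENNReal) = ∫⁻ θ in S, ⊤ := by
            simp only [lintegral_const, Measure.restrict_apply_univ, hS, Real.volume_Ioo]
            rw [ENNReal.top_mul]
            simpa using hδ'
        _ = ∫⁻ θ in S, (-f (c θ)).toENNReal :=
            (setLIntegral_congr_fun measurableSet_Ioo fun θ hθ => (hSf θ hθ)).symm
        _ ≤ _ := lintegral_mono_set hSsub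
    rw [laverage_eq, hint, hμ, Measure.restrict_apply_univ, Real.volume_Ioc]
    exact ENNReal.top_div_of_ne_top ENNReal.ofReal_ne_top
  have hpos : (⨍⁻ θ, (f (c θ)).toENNReal ∂μ) < ⊤ := by
    have husc' : UpperSemicontinuousOn (fun θ => f (c θ)) (Set.Icc 0 (2 * Real.pi)) := by
      intro θ _ y hy
      have h1 := husc (c θ) (hΩ θ) y hy
      have h2 : Filter.Tendsto c (𝓝[Set.Icc 0 (2 * Real.pi)] θ) (𝓝[Ω] c θ) :=
        tendsto_nhdsWithin_iff.2 ⟨hcc.continuousWithinAt, .of_forall fun θ => hΩ θ⟩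
      exact h2.eventually h1
    obtain ⟨θ₀, -, hmax⟩ := husc'.exists_isMaxOn ⟨0, by simp [Real.pi_pos.le]⟩ isCompact_Icc
    have hM : (f (c θ₀)).toENNReal ≠ ⊤ := by
      rw [Ne, EReal.toENNReal_eq_top_iff]
      exact (hlt _ (hΩ _)).ne
    refine laverage_lt_top (ne_of_lt ?_)
    calc ∫⁻ θ, (f (c θ)).toENNReal ∂μ ≤ ∫⁻ θ, (f (c θ₀)).toENNReal ∂μ := by
          refine setLIntegral_mono measurable_const fun θ hθ => ?_
          exact EReal.toENNReal_le_toENNReal (hmax (Set.Ioc_subset_Icc_self hθ))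
      _ < ⊤ := by
          rw [lintegral_const, hμ, Measure.restrict_apply_univ, Real.volume_Ioc]
          exact ENNReal.mul_lt_top hM.lt_top ENNReal.ofReal_lt_top
  rw [circleMean]
  change ((⨍⁻ θ, (f (c θ)).toENNReal ∂μ : ENNReal) : EReal) -
    ((⨍⁻ θ, (-f (c θ)).toENNReal ∂μ : ENNReal) : EReal) = ⊥
  rw [hneg]
  simp

theorem norm_exp_mul_I_smul (θ : ℝ) {F : Type*} [NormedAddCommGroup F] [NormedSpace ℂ F] (b : F) :
    ‖Complex.exp (θ * Complex.I) • b‖ = ‖b‖ := by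
  rw [norm_smul, Complex.norm_exp_ofReal_mul_I, one_mul]

/-- A plurisubharmonic function on a ball which is `-∞` near a point of the concentric ball of a
third of the radius is `-∞` on that ball. -/
theorem PshOn.eq_bot_of_eventually_eq_bot {f : (Fin k → ℂ) → EReal} {t₀ b c : Fin k → ℂ} {r : ℝ}
    (hf : PshOn f (Metric.ball t₀ (3 * r))) (hb : b ∈ Metric.ball t₀ r) (hc : c ∈ Metric.ball t₀ r)
    (hbot : ∀ᶠ z in 𝓝 b, f z = ⊥) : f c = ⊥ := by
  -- The disc is centred at `c` and its boundary passes through `b` at `ζ = 1`. Its points are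
  -- within `|c - t₀| + |b - t₀| + |c - t₀| < 3 r` of `t₀`.
  have hdisc : ∀ ζ : ℂ, ‖ζ‖ ≤ 1 → c + ζ • (b - c) ∈ Metric.ball t₀ (3 * r) := by
    intro ζ hζ
    rw [mem_ball_iff_norm] at hb hc ⊢
    have e : c + ζ • (b - c) - t₀ = (c - t₀) + ζ • ((b - t₀) - (c - t₀)) := by
      rw [sub_sub_sub_cancel_right]; abel
    have h1 : ‖ζ • ((b - t₀) - (c - t₀))‖ ≤ 1 * (‖b - t₀‖ + ‖c - t₀‖) := by
      rw [norm_smul]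
      exact mul_le_mul hζ (norm_sub_le _ _) (norm_nonneg _) zero_le_one
    rw [e]
    linarith [norm_add_le (c - t₀) (ζ • ((b - t₀) - (c - t₀)))]
  have hcr : c ∈ Metric.ball t₀ (3 * r) := by simpa using hdisc 0 (by simp)
  have h1 := hf.2.2 c (b - c) hdisc
  rw [circleMean_eq_bot hf.1 hf.2.1
    (fun θ => hdisc _ (by rw [Complex.norm_exp_ofReal_mul_I])) (by simpa using hbot)] at h1
  exact le_bot_iff.1 h1

end CircleMean

/-! ### Weighted integrals over balls of `ℂⁿ` -/

section Ball

variable {n : ℕ}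

theorem measurePreserving_rotation (θ : ℝ) :
    MeasurePreserving (fun w : Fin n → ℂ => Complex.exp (θ * Complex.I) • w) := by
  have h : ∀ _ : Fin n, MeasurePreserving (fun z : ℂ => Complex.exp (θ * Complex.I) * z) := fun _ =>
    (rotation (Circle.exp θ)).measurePreserving
  exact volume_preserving_pi h

/-- Mean value property of the holomorphic function `ζ ↦ v(ζ w)²` on the unit disc, followed by the
triangle inequality. -/
theorem norm_sq_le_lintegral_circle {v : (Fin n → ℂ) → ℂ} {ρ : ℝ} {w : Fin n → ℂ}
    (hv : DifferentiableOn ℂ v (Metric.ball 0 ρ)) (hw : w ∈ Metric.ball 0 ρ) :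
    ENNReal.ofReal (‖v 0‖ ^ 2) * ENNReal.ofReal (2 * Real.pi) ≤
      ∫⁻ θ : ℝ in Set.Ioc 0 (2 * Real.pi),
        ENNReal.ofReal (‖v (Complex.exp (θ * Complex.I) • w)‖ ^ 2) := by
  have hpi : (0 : ℝ) < 2 * Real.pi := by positivity
  let g : ℂ → ℂ := fun ζ => v (ζ • w) ^ 2
  have hmem : ∀ ζ ∈ Metric.closedBall (0 : ℂ) 1, ζ • w ∈ Metric.ball (0 : Fin n → ℂ) ρ := by
    intro ζ hζ
    simp only [Metric.mem_closedBall, dist_zero_right, Metric.mem_ball] at *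
    rw [norm_smul]
    nlinarith [norm_nonneg w, norm_nonneg ζ]
  have hgd : ∀ ζ ∈ Metric.closedBall (0 : ℂ) 1, DifferentiableAt ℂ g ζ := by
    intro ζ hζ
    have h1 : DifferentiableAt ℂ v (ζ • w) := hv.differentiableAt (Metric.isOpen_ball.mem_nhds (hmem ζ hζ))
    exact (h1.comp ζ (f := fun ζ : ℂ => ζ • w) (by fun_prop)).pow 2
  have hgc : DiffContOnCl ℂ g (Metric.ball 0 |1|) := by
    rw [abs_one]
    refine DifferentiableOn.diffContOnCl ?_
    rw [closure_ball _ one_ne_zero]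
    exact fun ζ hζ => (hgd ζ hζ).differentiableWithinAt
  have hmean := hgc.circleAverage
  have hcont : Continuous fun θ : ℝ => g (circleMap 0 1 θ) := by
    rw [continuous_iff_continuousAt]
    intro θ
    exact ContinuousAt.comp (g := g) (f := fun θ => circleMap 0 1 θ)
      (hgd _ (by simp)).continuousAt (by fun_prop)
  have hci : IntegrableOn (fun θ => ‖g (circleMap 0 1 θ)‖) (Set.Ioc 0 (2 * Real.pi)) :=
    (hcont.norm.integrableOn_Icc (a := 0) (b := 2 * Real.pi)).mono_set Set.Ioc_subset_Icc_self
  have e0 : g 0 = v 0 ^ 2 := by simp [g]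
  have h1 : ‖v 0‖ ^ 2 * (2 * Real.pi) ≤ ∫ θ in Set.Ioc 0 (2 * Real.pi), ‖g (circleMap 0 1 θ)‖ := by
    rw [Real.circleAverage_def, intervalIntegral.integral_of_le hpi.le, e0] at hmean
    have h2 := congrArg norm hmean
    rw [norm_smul, norm_pow, Real.norm_eq_abs, abs_of_pos (inv_pos.2 hpi)] at h2
    rw [← h2, mul_comm, ← mul_assoc, mul_inv_cancel₀ hpi.ne', one_mul]
    exact norm_integral_le_integral_norm _
  rw [← ENNReal.ofReal_mul (by positivity)]
  refine (ENNReal.ofReal_le_ofReal h1).trans (le_of_eq ?_)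
  rw [ofReal_integral_eq_lintegral_ofReal hci (.of_forall fun θ => norm_nonneg _)]
  refine lintegral_congr fun θ => ?_
  simp [g, circleMap]

/-- The sub-mean value inequality for `|v|²` on a ball, with respect to a weight invariant under
multiplication by unit complex numbers. -/
theorem norm_sq_mul_lintegral_le {v : (Fin n → ℂ) → ℂ} {ρ : ℝ}
    (hv : DifferentiableOn ℂ v (Metric.ball 0 ρ)) {κ : (Fin n → ℂ) → ENNReal} (hκ : Measurable κ)
    (hrot : ∀ (θ : ℝ) w, κ (Complex.exp (θ * Complex.I) • w) = κ w) :
    ENNReal.ofReal (‖v 0‖ ^ 2) * ∫⁻ w in Metric.ball 0 ρ, κ w ≤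
      ∫⁻ w in Metric.ball 0 ρ, ENNReal.ofReal (‖v w‖ ^ 2) * κ w := by
  have hpi : (0 : ℝ) < 2 * Real.pi := by positivity
  set B : Set (Fin n → ℂ) := Metric.ball 0 ρ with hB
  have hBm : MeasurableSet B := measurableSet_ball
  set V : (Fin n → ℂ) → ENNReal := B.indicator fun w => ENNReal.ofReal (‖v w‖ ^ 2) with hV
  have hVm : Measurable V := by
    have h1 : ContinuousOn (fun w => ENNReal.ofReal (‖v w‖ ^ 2)) B :=
      ENNReal.continuous_ofReal.comp_continuousOn (hv.continuousOn.norm.pow 2)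
    classical
    rw [hV, ← Set.piecewise_eq_indicator]
    exact h1.measurable_piecewise continuousOn_const hBm
  have hrotB : ∀ (θ : ℝ) w, Complex.exp (θ * Complex.I) • w ∈ B ↔ w ∈ B := by
    intro θ w
    simp only [hB, Metric.mem_ball, dist_zero_right, norm_exp_mul_I_smul]
  set I := ∫⁻ w in B, ENNReal.ofReal (‖v w‖ ^ 2) * κ w with hI
  have hIe : I = ∫⁻ w, V w * κ w := by
    rw [hI, ← lintegral_indicator hBm]
    refine lintegral_congr fun w => ?_
    by_cases hw : w ∈ B <;> simp [hV, hw]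
  -- The integral is unchanged when `v` is rotated, since the measure, the ball and `κ` are
  -- invariant. Averaging over `θ` and exchanging the integrals reduces the claim to one circle at a
  -- time.
  have hθ : ∀ θ : ℝ, I = ∫⁻ w in B, V (Complex.exp (θ * Complex.I) • w) * κ w := by
    intro θ
    have := (measurePreserving_rotation (n := n) θ).lintegral_comp (hVm.mul hκ)
    simp only [Pi.mul_apply] at this
    rw [hIe, ← this, ← lintegral_indicator hBm]
    refine lintegral_congr fun w => ?_
    by_cases hw : w ∈ B
    · simp [hw, hrot]
    · simp [hw, hV, hrotB]
  have hjoint : Measurable fun p : ℝ × (Fin n → ℂ) =>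
      V (Complex.exp (p.1 * Complex.I) • p.2) * κ p.2 := by
    have : Continuous fun p : ℝ × (Fin n → ℂ) => Complex.exp (p.1 * Complex.I) • p.2 := by fun_prop
    exact (hVm.comp this.measurable).mul (hκ.comp measurable_snd)
  have h1 : I * ENNReal.ofReal (2 * Real.pi) =
      ∫⁻ w in B, ∫⁻ θ : ℝ in Set.Ioc 0 (2 * Real.pi),
        V (Complex.exp (θ * Complex.I) • w) * κ w := by
    rw [← lintegral_lintegral_swap (μ := volume.restrict (Set.Ioc 0 (2 * Real.pi)))
      (f := fun (θ : ℝ) (w : Fin n → ℂ) => V (Complex.exp (θ * Complex.I) • w) * κ w)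
      hjoint.aemeasurable]
    simp_rw [← hθ]
    rw [lintegral_const, Measure.restrict_apply_univ, Real.volume_Ioc, sub_zero]
  have h2 : (ENNReal.ofReal (‖v 0‖ ^ 2) * ∫⁻ w in B, κ w) * ENNReal.ofReal (2 * Real.pi) ≤
      I * ENNReal.ofReal (2 * Real.pi) := by
    rw [h1, mul_right_comm, ← lintegral_const_mul _ hκ]
    refine setLIntegral_mono' hBm fun w hw => ?_
    have hm : Measurable fun θ : ℝ => V (Complex.exp (θ * Complex.I) • w) := by
      have : Continuous fun θ : ℝ => Complex.exp (θ * Complex.I) • w := by fun_prop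
      exact hVm.comp this.measurable
    rw [lintegral_mul_const _ hm]
    gcongr
    refine (norm_sq_le_lintegral_circle hv hw).trans (le_of_eq ?_)
    refine lintegral_congr fun θ => ?_
    simp [hV, hrotB, hw]
  exact (ENNReal.mul_le_mul_iff_left (by simpa using Real.pi_pos) ENNReal.ofReal_ne_top).1 h2

/-- The sum of the squares of the coordinates. -/
def sumSq (w : Fin n → ℂ) : ℝ := ∑ j, ‖w j‖ ^ 2

theorem sumSq_nonneg (w : Fin n → ℂ) : 0 ≤ sumSq w := Finset.sum_nonneg fun _ _ => by positivity

theorem continuous_sumSq : Continuous (sumSq (n := n)) := by unfold sumSq; fun_prop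

theorem sumSq_smul (c : ℂ) (w : Fin n → ℂ) : sumSq (c • w) = ‖c‖ ^ 2 * sumSq w := by
  simp [sumSq, Finset.mul_sum, mul_pow]

theorem norm_sq_le_sumSq (w : Fin n → ℂ) : ‖w‖ ^ 2 ≤ sumSq w := by
  have h : ∀ j, ‖w j‖ ≤ √(sumSq w) := fun j => by
    refine Real.le_sqrt_of_sq_le ?_
    exact Finset.single_le_sum (f := fun j => ‖w j‖ ^ 2) (fun _ _ => by positivity)
      (Finset.mem_univ j)
  have := (pi_norm_le_iff_of_nonneg (Real.sqrt_nonneg _)).2 h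
  calc ‖w‖ ^ 2 ≤ √(sumSq w) ^ 2 := by gcongr
    _ = sumSq w := Real.sq_sqrt (sumSq_nonneg w)

theorem sumSq_le (w : Fin n → ℂ) : sumSq w ≤ n * ‖w‖ ^ 2 := by
  calc sumSq w ≤ ∑ _j : Fin n, ‖w‖ ^ 2 :=
        Finset.sum_le_sum fun j _ => by gcongr; exact norm_le_pi_norm w j
    _ = n * ‖w‖ ^ 2 := by simp

/-- The integral of `(|w|² + ε)^{-(n+1)}` over the polydisc of radius `ρ`. -/
def peakMass (n : ℕ) (ε ρ : ℝ) : ENNReal :=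
  ∫⁻ w : Fin n → ℂ in Metric.ball 0 ρ, ENNReal.ofReal (((sumSq w + ε) ^ (n + 1))⁻¹)

/-- Pointwise, `(S + ε') / (S + ε) ≤ ε' / ε` for `S ≥ 0`. It compares the peak at the centre, of
width parameter `ε`, with the slightly wider one that serves on the whole circle. -/
theorem peakMass_le_ratio {ε ε' : ℝ} (hε : 0 < ε) (h : ε ≤ ε') (ρ : ℝ) :
    peakMass n ε ρ ≤ ENNReal.ofReal ((ε' / ε) ^ (n + 1)) * peakMass n ε' ρ := by
  rw [peakMass, peakMass, ← lintegral_const_mul' _ _ ENNReal.ofReal_ne_top]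
  refine lintegral_mono fun w => ?_
  rw [← ENNReal.ofReal_mul (by have := hε.trans_le h; positivity)]
  refine ENNReal.ofReal_le_ofReal ?_
  have hs := sumSq_nonneg w
  have h1 : 0 < sumSq w + ε := by linarith
  have h2 : 0 < sumSq w + ε' := by linarith
  rw [← div_eq_mul_inv, ← div_pow, ← one_div, ← one_div_pow]
  have h3 : 0 < ε' := hε.trans_le h
  have h4 : 1 / (sumSq w + ε) ≤ ε' / ε / (sumSq w + ε') := by
    rw [div_div, div_le_div_iff₀ h1 (by positivity)]
    nlinarith
  exact pow_le_pow_left₀ (by positivity) h4 _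

theorem peakMass_lt_top {ε : ℝ} (hε : 0 < ε) (ρ : ℝ) : peakMass n ε ρ < ⊤ := by
  calc peakMass n ε ρ ≤ ∫⁻ w : Fin n → ℂ in Metric.ball 0 ρ, ENNReal.ofReal ((ε ^ (n + 1))⁻¹) := by
        refine lintegral_mono fun w => ENNReal.ofReal_le_ofReal ?_
        have := sumSq_nonneg w
        gcongr
        linarith
    _ < ⊤ := by
        rw [lintegral_const, Measure.restrict_apply_univ]
        exact ENNReal.mul_lt_top ENNReal.ofReal_lt_top measure_ball_lt_top

/-- On the polydisc of radius `s` the integrand is at least `((n + c + 1) s²)^{-(n+1)}`, and the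
volume is a multiple of `s^{2n}`. The exponent `n + 1`, rather than `n`, makes the mass blow up like
`s⁻²`, so that the peak dominates everything else on the fibre. -/
theorem exists_le_peakMass (n : ℕ) (c : ℝ) (hc : 0 ≤ c) :
    ∃ κ : ℝ, 0 < κ ∧ ∀ s ρ ε : ℝ, 0 < s → s ≤ ρ → 0 < ε → ε ≤ c * s ^ 2 →
      ENNReal.ofReal (κ * (s ^ 2)⁻¹) ≤ peakMass n ε ρ := by
  set V := (volume (Metric.ball (0 : Fin n → ℂ) 1)) with hV
  have hV0 : 0 < V.toReal :=
    ENNReal.toReal_pos (Metric.measure_ball_pos volume _ one_pos).ne' measure_ball_lt_top.ne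
  refine ⟨((n + c + 1) ^ (n + 1))⁻¹ * V.toReal, by positivity, fun s ρ ε hs hsρ hε0 hε => ?_⟩
  have hvol : volume (Metric.ball (0 : Fin n → ℂ) s) = ENNReal.ofReal (s ^ (2 * n)) * V := by
    rw [Measure.addHaar_ball_of_pos _ _ hs]
    congr 3
    rw [← Module.finrank_mul_finrank ℝ ℂ (Fin n → ℂ)]
    simp
  calc ENNReal.ofReal (((n + c + 1) ^ (n + 1))⁻¹ * V.toReal * (s ^ 2)⁻¹)
      = ∫⁻ w : Fin n → ℂ in Metric.ball 0 s,
          ENNReal.ofReal ((((n + c + 1) * s ^ 2) ^ (n + 1))⁻¹) := by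
        rw [lintegral_const, Measure.restrict_apply_univ, hvol, ← mul_assoc,
          ← ENNReal.ofReal_mul (by positivity)]
        rw [← ENNReal.ofReal_toReal (a := V) measure_ball_lt_top.ne,
          ← ENNReal.ofReal_mul (by positivity), ENNReal.toReal_ofReal hV0.le]
        congr 1
        field_simp
        rw [mul_pow]
        ring
    _ ≤ ∫⁻ w : Fin n → ℂ in Metric.ball 0 s, ENNReal.ofReal (((sumSq w + ε) ^ (n + 1))⁻¹) := by
        refine setLIntegral_mono' measurableSet_ball fun w hw => ENNReal.ofReal_le_ofReal ?_
        have hw' : ‖w‖ ≤ s := by simpa using (Metric.mem_ball.1 hw).le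
        have h1 := sumSq_nonneg w
        have h2 : (n : ℝ) * ‖w‖ ^ 2 ≤ n * s ^ 2 := by gcongr
        have h3 := sumSq_le w
        gcongr
        nlinarith [sq_nonneg s]
    _ ≤ _ := lintegral_mono_set (Metric.ball_subset_ball hsρ)

end Ball


/-! ### Frames of Hermitian line bundles -/

section Frames

variable {d : ℕ} {X : Type*} [TopologicalSpace X] [ChartedSpace (Fin d → ℂ) X]
  {L : X → Type*} [TopologicalSpace (TotalSpace ℂ L)] [∀ x, AddCommGroup (L x)]
  [∀ x, Module ℂ (L x)] [∀ x, TopologicalSpace (L x)] [FiberBundle ℂ L]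

theorem HermitianMetric.normSq_smul (h : HermitianMetric d L) {x : X} (c : ℂ) (a : L x) :
    h.normSq x (c • a) = ‖c‖ ^ 2 * h.normSq x a := by
  have e : h.form x (c • a) (c • a) = ((‖c‖ ^ 2 : ℝ) : ℂ) * h.form x a a := by
    simp only [LinearMap.map_smulₛₗ, LinearMap.smul_apply, smul_eq_mul, RingHom.id_apply]
    push_cast
    rw [← Complex.mul_conj']
    ring
  rw [HermitianMetric.normSq, e, Complex.re_ofReal_mul, HermitianMetric.normSq]

theorem HermitianMetric.normSq_pos (h : HermitianMetric d L) {x : X} {a : L x} (ha : a ≠ 0) :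
    0 < h.normSq x a := h.form_pos x a ha

theorem IsHolFrame.mono {U V : Set X} {s : ∀ x, L x} (hs : IsHolFrame d L U s) (hV : IsOpen V)
    (hVU : V ⊆ U) : IsHolFrame d L V s :=
  ⟨hV, fun x hx => hs.2.1 x (hVU hx), hs.2.2.mono hVU⟩

theorem HermitianMetric.continuousOn_normSq (h : HermitianMetric d L) {U : Set X} {s : ∀ x, L x}
    (hs : IsHolFrame d L U s) : ContinuousOn (fun x => h.normSq x (s x)) U :=
  (h.smooth U s hs).continuousOn

variable [VectorBundle ℂ ℂ L]

theorem exists_smul_eq_of_ne_zero {x : X} {a : L x} (ha : a ≠ 0) (b : L x) : ∃ c : ℂ, b = c • a := by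
  let e := Trivialization.linearEquivAt ℂ (trivializationAt ℂ L x) x
    (FiberBundle.mem_baseSet_trivializationAt ℂ L x)
  have hea : e a ≠ 0 := by simpa using ha
  refine ⟨e b / e a, e.injective ?_⟩
  rw [map_smul, smul_eq_mul, div_mul_cancel₀ _ hea]

variable [ContMDiffVectorBundle ω ℂ L 𝓘(ℂ, Fin d → ℂ)]

theorem exists_isHolFrame (x : X) : ∃ (U : Set X) (s : ∀ x, L x), x ∈ U ∧ IsHolFrame d L U s := by
  let e := trivializationAt ℂ L x
  refine ⟨e.baseSet, fun x => e.symm x 1, FiberBundle.mem_baseSet_trivializationAt ℂ L x,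
    e.open_baseSet, fun x' hx' h0 => ?_, ?_⟩
  · have h1 : (e ⟨x', e.symm x' (1 : ℂ)⟩) = (x', (1 : ℂ)) := e.apply_mk_symm hx' 1
    have h2 : (e ⟨x', (0 : L x')⟩).2 = (0 : ℂ) := by
      exact (Trivialization.linearEquivAt ℂ e x' hx').map_zero
    have h0' : e.symm x' (1 : ℂ) = 0 := h0
    rw [h0'] at h1
    rw [h1] at h2
    exact one_ne_zero h2
  · rw [e.contMDiffOn_section_baseSet_iff]
    refine (contMDiffOn_const (c := (1 : ℂ))).congr fun x' hx' => ?_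
    rw [e.apply_mk_symm hx' 1]

/-- A holomorphic section is a holomorphic multiple of a holomorphic frame. -/
theorem IsHolFrame.exists_coeff {U : Set X} {s σ : ∀ x, L x} (hs : IsHolFrame d L U s)
    (hσ : ContMDiffOn 𝓘(ℂ, Fin d → ℂ) (𝓘(ℂ, Fin d → ℂ).prod 𝓘(ℂ, ℂ)) ω
      (fun x => TotalSpace.mk' ℂ x (σ x)) U) :
    ∃ g : X → ℂ, ContMDiffOn 𝓘(ℂ, Fin d → ℂ) 𝓘(ℂ, ℂ) ω g U ∧ ∀ x ∈ U, σ x = g x • s x := by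
  have h1 : ∀ x, ∃ c : ℂ, x ∈ U → σ x = c • s x := fun x => by
    by_cases hx : x ∈ U
    · obtain ⟨c, hc⟩ := exists_smul_eq_of_ne_zero (hs.2.1 x hx) (σ x)
      exact ⟨c, fun _ => hc⟩
    · exact ⟨0, fun h => absurd h hx⟩
  choose g hg using h1
  refine ⟨g, fun x hx => ?_, hg⟩
  let e := trivializationAt ℂ L x
  have hxe : x ∈ e.baseSet := FiberBundle.mem_baseSet_trivializationAt ℂ L x
  have hs' := (e.contMDiffAt_section_iff hxe).1 ((hs.2.2 x hx).contMDiffAt (hs.1.mem_nhds hx))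
  have hσ' := (e.contMDiffAt_section_iff hxe).1 ((hσ x hx).contMDiffAt (hs.1.mem_nhds hx))
  have hne : ∀ x' ∈ e.baseSet, x' ∈ U → (e ⟨x', s x'⟩).2 ≠ (0 : ℂ) := by
    intro x' hx' hxU h0
    have : (Trivialization.linearEquivAt ℂ e x' hx') (s x') = 0 := h0
    exact hs.2.1 x' hxU ((LinearEquiv.map_eq_zero_iff _).1 this)
  have hq : ContMDiffAt 𝓘(ℂ, Fin d → ℂ) 𝓘(ℂ, ℂ) ω
      (fun x => (e ⟨x, σ x⟩).2 / (e ⟨x, s x⟩).2) x := hσ'.div₀ hs' (hne x hxe hx)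
  refine (hq.congr_of_eventuallyEq ?_).contMDiffWithinAt
  filter_upwards [e.open_baseSet.mem_nhds hxe, hs.1.mem_nhds hx] with x' hx' hxU
  have h2 : (e ⟨x', σ x'⟩).2 = g x' * (e ⟨x', s x'⟩).2 := by
    have := congrArg (Trivialization.linearEquivAt ℂ e x' hx') (hg x' hxU)
    rwa [map_smul] at this
  rw [h2, mul_div_cancel_right₀ _ (hne x' hx' hxU)]

end Frames


/-! ### Adapted coordinates -/

section Adapted

variable {m n : ℕ} {X Y : Type*} [TopologicalSpace X] [ChartedSpace (Fin (m + n) → ℂ) X]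
  [TopologicalSpace Y] [ChartedSpace (Fin m → ℂ) Y] {p : X → Y}

namespace AdaptedChart

variable (Φ : AdaptedChart m n p)

theorem base_fst {q : (Fin m → ℂ) × (Fin n → ℂ)} (hq : q ∈ Φ.chart.target) :
    Φ.base (p (Φ.chart.symm q)) = q.1 := by
  rw [← (Φ.fibred _ (Φ.chart.map_target hq)).2, Φ.chart.right_inv hq]

theorem p_mem_source {q : (Fin m → ℂ) × (Fin n → ℂ)} (hq : q ∈ Φ.chart.target) :
    p (Φ.chart.symm q) ∈ Φ.base.source := (Φ.fibred _ (Φ.chart.map_target hq)).1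

theorem p_symm_eq {y : Y} (hy : y ∈ Φ.base.source) {z : Fin n → ℂ}
    (hz : (Φ.base y, z) ∈ Φ.chart.target) : p (Φ.chart.symm (Φ.base y, z)) = y :=
  Φ.base.injOn (Φ.p_mem_source hz) hy (Φ.base_fst hz)

theorem chart_eq {x : X} (hx : x ∈ Φ.chart.source) : Φ.chart x = (Φ.base (p x), (Φ.chart x).2) :=
  Prod.ext (Φ.fibred x hx).2 rfl

theorem symm_base_snd {x : X} (hx : x ∈ Φ.chart.source) :
    Φ.chart.symm (Φ.base (p x), (Φ.chart x).2) = x := by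
  rw [← Φ.chart_eq hx, Φ.chart.left_inv hx]

theorem mem_target_of_mem {x : X} (hx : x ∈ Φ.chart.source) :
    (Φ.base (p x), (Φ.chart x).2) ∈ Φ.chart.target := by
  rw [← Φ.chart_eq hx]; exact Φ.chart.map_source hx

theorem mem_slice_iff {y : Y} {A : Set X} {z : Fin n → ℂ} :
    z ∈ Φ.slice y A ↔ ∃ x ∈ A ∩ Φ.chart.source, p x = y ∧ (Φ.chart x).2 = z := by
  constructor
  · rintro ⟨h1, h2, h3⟩
    exact ⟨_, ⟨h3, Φ.chart.map_target h1⟩, h2, by rw [Φ.chart.right_inv h1]⟩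
  · rintro ⟨x, ⟨hA, hx⟩, rfl, rfl⟩
    refine ⟨Φ.mem_target_of_mem hx, ?_, ?_⟩ <;> rw [Φ.symm_base_snd hx]
    exact hA

theorem slice_mono (y : Y) {A B : Set X} (h : A ⊆ B) : Φ.slice y A ⊆ Φ.slice y B :=
  fun _ hz => ⟨hz.1, hz.2.1, h hz.2.2⟩

theorem slice_iUnion {ι : Type*} (y : Y) (A : ι → Set X) :
    Φ.slice y (⋃ i, A i) = ⋃ i, Φ.slice y (A i) := by
  ext z; simp only [slice, Set.mem_ofPred_eq, Set.mem_iUnion]; tauto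

theorem slice_disjoint (y : Y) {A B : Set X} (h : Disjoint A B) :
    Disjoint (Φ.slice y A) (Φ.slice y B) :=
  Set.disjoint_left.2 fun _ h1 h2 => Set.disjoint_left.1 h h1.2.2 h2.2.2

theorem slice_eq_empty {y : Y} (hy : y ∉ Φ.base.source) (A : Set X) : Φ.slice y A = ∅ := by
  ext z
  simp only [Set.mem_empty_iff_false, iff_false]
  rintro ⟨h1, h2, -⟩
  exact hy (h2 ▸ Φ.p_mem_source h1)

theorem slice_eq {y : Y} (hy : y ∈ Φ.base.source) (A : Set X) :
    Φ.slice y A = (fun z => (Φ.base y, z)) ⁻¹' (Φ.chart.target ∩ Φ.chart.symm ⁻¹' A) := by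
  ext z
  constructor
  · rintro ⟨h1, -, h3⟩; exact ⟨h1, h3⟩
  · rintro ⟨h1, h3⟩; exact ⟨h1, Φ.p_symm_eq hy h1, h3⟩

theorem isOpen_slice (y : Y) {A : Set X} (hA : IsOpen A) : IsOpen (Φ.slice y A) := by
  by_cases hy : y ∈ Φ.base.source
  · rw [Φ.slice_eq hy]
    exact (Φ.chart.symm.isOpen_inter_preimage hA).preimage (by fun_prop)
  · rw [Φ.slice_eq_empty hy]; exact isOpen_empty

theorem measurableSet_slice (y : Y) {A : Set X} (hA : MeasurableSet[borel X] A) :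
    MeasurableSet (Φ.slice y A) := by
  by_cases hy : y ∈ Φ.base.source
  · rw [Φ.slice_eq hy]
    let _ : MeasurableSpace X := borel X
    have _ : BorelSpace X := ⟨rfl⟩
    have hopen : IsOpen ((fun z : Fin n → ℂ => (Φ.base y, z)) ⁻¹' Φ.chart.target) :=
      Φ.chart.open_target.preimage (by fun_prop)
    have hc : ContinuousOn (fun z => Φ.chart.symm (Φ.base y, z))
        ((fun z : Fin n → ℂ => (Φ.base y, z)) ⁻¹' Φ.chart.target) :=
      Φ.chart.continuousOn_symm.comp (by fun_prop) fun z hz => hz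
    have := (continuousOn_iff_continuous_domRestrict.1 hc).measurable hA
    have h2 := (MeasurableEmbedding.subtype_coe hopen.measurableSet).measurableSet_image.2 this
    convert h2 using 1
    ext z
    simp [and_comm]
  · rw [Φ.slice_eq_empty hy]; exact MeasurableSet.empty

end AdaptedChart

/-! ### Differentials of adapted coordinates and transitions on fibres. -/

section Deriv

variable [IsManifold 𝓘(ℂ, Fin (m + n) → ℂ) ω X] [IsManifold 𝓘(ℂ, Fin m → ℂ) ω Y]

namespace AdaptedChart

variable (Φ : AdaptedChart m n p)

theorem mdifferentiableAt_chart {x : X} (hx : x ∈ Φ.chart.source) :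
    MDifferentiableAt 𝓘(ℂ, Fin (m + n) → ℂ) 𝓘(ℂ, (Fin m → ℂ) × (Fin n → ℂ)) Φ.chart x :=
  ((Φ.holo x hx).contMDiffAt (Φ.chart.open_source.mem_nhds hx)).mdifferentiableAt (by simp)

theorem mdifferentiableAt_symm {q : (Fin m → ℂ) × (Fin n → ℂ)} (hq : q ∈ Φ.chart.target) :
    MDifferentiableAt 𝓘(ℂ, (Fin m → ℂ) × (Fin n → ℂ)) 𝓘(ℂ, Fin (m + n) → ℂ) Φ.chart.symm q :=
  ((Φ.holo_symm q hq).contMDiffAt (Φ.chart.open_target.mem_nhds hq)).mdifferentiableAt (by simp)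

theorem contMDiffOn_p : ContMDiffOn 𝓘(ℂ, Fin (m + n) → ℂ) 𝓘(ℂ, Fin m → ℂ) ω p Φ.chart.source := by
  have h1 : ContMDiffOn 𝓘(ℂ, Fin (m + n) → ℂ) 𝓘(ℂ, Fin m → ℂ) ω (fun x => (Φ.chart x).1)
      Φ.chart.source :=
    (contDiff_fst (𝕜 := ℂ) (E := Fin m → ℂ) (F := Fin n → ℂ)).contMDiff.comp_contMDiffOn Φ.holo
  have h2 := contMDiffOn_symm_of_mem_maximalAtlas Φ.base_mem
  refine (h2.comp h1 fun x hx => ?_).congr fun x hx => ?_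
  · change (Φ.chart x).1 ∈ Φ.base.target
    rw [(Φ.fibred x hx).2]
    exact Φ.base.map_source (Φ.fibred x hx).1
  · change p x = Φ.base.symm ((Φ.chart x).1)
    rw [(Φ.fibred x hx).2, Φ.base.left_inv (Φ.fibred x hx).1]

/-- The differential of the fibre coordinates on the vertical tangent space. -/
def vert (x : X) : VertSpace m n p x →ₗ[ℂ] (Fin n → ℂ) :=
  (LinearMap.snd ℂ (Fin m → ℂ) (Fin n → ℂ)).comp
      ((mfderiv 𝓘(ℂ, Fin (m + n) → ℂ) 𝓘(ℂ, (Fin m → ℂ) × (Fin n → ℂ)) Φ.chart x).toLinearMap.comp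
        (VertSpace m n p x).subtype)

theorem dz_apply (x : X) (ξ : Fin n → VertSpace m n p x) :
    Φ.dz x ξ = Matrix.det (fun i => Φ.vert x (ξ i)) := rfl

theorem mfderiv_p {x : X} (hx : x ∈ Φ.chart.source) (ξ : TangentSpace 𝓘(ℂ, Fin (m + n) → ℂ) x) :
    mfderiv 𝓘(ℂ, Fin m → ℂ) 𝓘(ℂ, Fin m → ℂ) Φ.base (p x)
      (mfderiv 𝓘(ℂ, Fin (m + n) → ℂ) 𝓘(ℂ, Fin m → ℂ) p x ξ) =
      ((mfderiv 𝓘(ℂ, Fin (m + n) → ℂ) 𝓘(ℂ, (Fin m → ℂ) × (Fin n → ℂ)) Φ.chart x ξ :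
        (Fin m → ℂ) × (Fin n → ℂ))).1 := by
  have hb : MDifferentiableAt 𝓘(ℂ, Fin m → ℂ) 𝓘(ℂ, Fin m → ℂ) Φ.base (p x) :=
    ((contMDiffOn_of_mem_maximalAtlas Φ.base_mem _ (Φ.fibred x hx).1).contMDiffAt
      (Φ.base.open_source.mem_nhds (Φ.fibred x hx).1)).mdifferentiableAt (by simp)
  have hp : MDifferentiableAt 𝓘(ℂ, Fin (m + n) → ℂ) 𝓘(ℂ, Fin m → ℂ) p x :=
    ((Φ.contMDiffOn_p x hx).contMDiffAt (Φ.chart.open_source.mem_nhds hx)).mdifferentiableAt (by simp)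
  have h1 := mfderiv_comp x hb hp
  have hf : MDifferentiableAt 𝓘(ℂ, (Fin m → ℂ) × (Fin n → ℂ)) 𝓘(ℂ, Fin m → ℂ)
      (Prod.fst : (Fin m → ℂ) × (Fin n → ℂ) → _) (Φ.chart x) :=
    mdifferentiableAt_iff_differentiableAt.2 differentiableAt_fst
  have h2 := mfderiv_comp x hf (Φ.mdifferentiableAt_chart hx)
  have h3 : (Prod.fst ∘ Φ.chart) =ᶠ[𝓝 x] Φ.base ∘ p := by
    filter_upwards [Φ.chart.open_source.mem_nhds hx] with x' hx'
    exact (Φ.fibred x' hx').2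
  rw [h3.mfderiv_eq, h1] at h2
  have h4 := DFunLike.congr_fun h2 ξ
  rw [mfderiv_eq_fderiv, fderiv_fst] at h4
  exact h4

theorem mfderiv_chart_fst {x : X} (hx : x ∈ Φ.chart.source) (ξ : VertSpace m n p x) :
    ((mfderiv 𝓘(ℂ, Fin (m + n) → ℂ) 𝓘(ℂ, (Fin m → ℂ) × (Fin n → ℂ)) Φ.chart x ξ.1 :
        (Fin m → ℂ) × (Fin n → ℂ))).1 = 0 := by
  have h1 : mfderiv 𝓘(ℂ, Fin (m + n) → ℂ) 𝓘(ℂ, Fin m → ℂ) p x ξ.1 = 0 := ξ.2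
  rw [← Φ.mfderiv_p hx, h1, map_zero]
  rfl

theorem mfderiv_chart_symm {x : X} (hx : x ∈ Φ.chart.source) (q : (Fin m → ℂ) × (Fin n → ℂ)) :
    mfderiv 𝓘(ℂ, Fin (m + n) → ℂ) 𝓘(ℂ, (Fin m → ℂ) × (Fin n → ℂ)) Φ.chart x
      (mfderiv 𝓘(ℂ, (Fin m → ℂ) × (Fin n → ℂ)) 𝓘(ℂ, Fin (m + n) → ℂ) Φ.chart.symm (Φ.chart x) q) =
      q := by
  have hx' := Φ.chart.map_source hx
  have e : Φ.chart.symm (Φ.chart x) = x := Φ.chart.left_inv hx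
  have h0 : MDifferentiableAt 𝓘(ℂ, Fin (m + n) → ℂ) 𝓘(ℂ, (Fin m → ℂ) × (Fin n → ℂ)) Φ.chart
      (Φ.chart.symm (Φ.chart x)) := by rw [e]; exact Φ.mdifferentiableAt_chart hx
  have h1 := mfderiv_comp (Φ.chart x) h0 (Φ.mdifferentiableAt_symm hx')
  have h2 : (Φ.chart ∘ Φ.chart.symm) =ᶠ[𝓝 (Φ.chart x)] id := by
    filter_upwards [Φ.chart.open_target.mem_nhds hx'] with q hq
    exact Φ.chart.right_inv hq
  rw [h2.mfderiv_eq, mfderiv_id, e] at h1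
  exact (DFunLike.congr_fun h1 q).symm

theorem vert_surjective {x : X} (hx : x ∈ Φ.chart.source) : Function.Surjective (Φ.vert x) := by
  intro ζ
  set ξ : TangentSpace 𝓘(ℂ, Fin (m + n) → ℂ) x :=
    mfderiv 𝓘(ℂ, (Fin m → ℂ) × (Fin n → ℂ)) 𝓘(ℂ, Fin (m + n) → ℂ) Φ.chart.symm (Φ.chart x)
      ((0 : Fin m → ℂ), ζ) with hξ
  have h1 : mfderiv 𝓘(ℂ, Fin (m + n) → ℂ) 𝓘(ℂ, (Fin m → ℂ) × (Fin n → ℂ)) Φ.chart x ξ =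
    ((0 : Fin m → ℂ), ζ) := Φ.mfderiv_chart_symm hx _
  have hp : mfderiv 𝓘(ℂ, Fin (m + n) → ℂ) 𝓘(ℂ, Fin m → ℂ) p x ξ = 0 := by
    have h2 : p =ᶠ[𝓝 x] Φ.base.symm ∘ (fun x => (Φ.chart x).1) := by
      filter_upwards [Φ.chart.open_source.mem_nhds hx] with x' hx'
      change p x' = Φ.base.symm ((Φ.chart x').1)
      rw [(Φ.fibred x' hx').2, Φ.base.left_inv (Φ.fibred x' hx').1]
    have hf : MDifferentiableAt 𝓘(ℂ, (Fin m → ℂ) × (Fin n → ℂ)) 𝓘(ℂ, Fin m → ℂ)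
        (Prod.fst : (Fin m → ℂ) × (Fin n → ℂ) → _) (Φ.chart x) :=
      mdifferentiableAt_iff_differentiableAt.2 differentiableAt_fst
    have hfc := hf.comp x (Φ.mdifferentiableAt_chart hx)
    have h4 := mfderiv_comp x hf (Φ.mdifferentiableAt_chart hx)
    have hmem : (Φ.chart x).1 ∈ Φ.base.target := by
      rw [(Φ.fibred x hx).2]; exact Φ.base.map_source (Φ.fibred x hx).1
    have hb : MDifferentiableAt 𝓘(ℂ, Fin m → ℂ) 𝓘(ℂ, Fin m → ℂ) Φ.base.symm ((Φ.chart x).1) :=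
      ((contMDiffOn_symm_of_mem_maximalAtlas Φ.base_mem _ hmem).contMDiffAt
        (Φ.base.open_target.mem_nhds hmem)).mdifferentiableAt (by simp)
    have h3 := mfderiv_comp x (f := fun x => (Φ.chart x).1) hb hfc
    rw [h2.mfderiv_eq, h3]
    have h5 : mfderiv 𝓘(ℂ, Fin (m + n) → ℂ) 𝓘(ℂ, Fin m → ℂ) (fun x => (Φ.chart x).1) x ξ = 0 := by
      have := DFunLike.congr_fun h4 ξ
      rw [mfderiv_eq_fderiv, fderiv_fst] at this
      refine Eq.trans this ?_
      exact congrArg Prod.fst h1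
    exact (congrArg (mfderiv 𝓘(ℂ, Fin m → ℂ) 𝓘(ℂ, Fin m → ℂ) Φ.base.symm (Φ.chart x).1) h5).trans
      (map_zero _)
  exact ⟨⟨ξ, hp⟩, congrArg Prod.snd h1⟩

/-- The change of fibre coordinates from `Φ` to `Φ'` on `X_y`. -/
def fibreTransition (Φ' : AdaptedChart m n p) (y : Y) (z : Fin n → ℂ) : Fin n → ℂ :=
  (Φ'.chart (Φ.chart.symm (Φ.base y, z))).2

theorem fibreTransition_chart (Φ' : AdaptedChart m n p) {x : X} (hx : x ∈ Φ.chart.source) :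
    Φ.fibreTransition Φ' (p x) (Φ.chart x).2 = (Φ'.chart x).2 := by
  rw [fibreTransition, Φ.symm_base_snd hx]

theorem differentiableAt_transition (Φ' : AdaptedChart m n p) {x : X} (hx : x ∈ Φ.chart.source)
    (hx' : x ∈ Φ'.chart.source) :
    DifferentiableAt ℂ (Φ'.chart ∘ Φ.chart.symm) (Φ.chart x) := by
  have e : Φ.chart.symm (Φ.chart x) = x := Φ.chart.left_inv hx
  refine mdifferentiableAt_iff_differentiableAt.1 (MDifferentiableAt.comp (Φ.chart x) ?_
    (Φ.mdifferentiableAt_symm (Φ.chart.map_source hx)))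
  rw [e]; exact Φ'.mdifferentiableAt_chart hx'

theorem hasFDerivAt_fibreTransition (Φ' : AdaptedChart m n p) {x : X} (hx : x ∈ Φ.chart.source)
    (hx' : x ∈ Φ'.chart.source) :
    HasFDerivAt (Φ.fibreTransition Φ' (p x))
      ((ContinuousLinearMap.snd ℂ (Fin m → ℂ) (Fin n → ℂ)).comp
        ((fderiv ℂ (Φ'.chart ∘ Φ.chart.symm) (Φ.chart x)).comp
          (ContinuousLinearMap.inr ℂ (Fin m → ℂ) (Fin n → ℂ)))) (Φ.chart x).2 := by
  have h1 := (Φ.differentiableAt_transition Φ' hx hx').hasFDerivAt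
  have h2 : HasFDerivAt (fun z : Fin n → ℂ => (Φ.base (p x), z))
      (ContinuousLinearMap.inr ℂ (Fin m → ℂ) (Fin n → ℂ)) (Φ.chart x).2 :=
    hasFDerivAt_prodMk_right _ _
  rw [Φ.chart_eq hx] at h1
  have h3 := (hasFDerivAt_snd (𝕜 := ℂ)).comp _ (h1.comp (Φ.chart x).2 h2)
  rw [← Φ.chart_eq hx] at h3
  exact h3

/-- A vertical vector has zero `t`-component, so of the derivative of the full transition only the
block in the fibre variables acts on it. -/
theorem vert_transition (Φ' : AdaptedChart m n p) {x : X} (hx : x ∈ Φ.chart.source)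
    (hx' : x ∈ Φ'.chart.source) (ξ : VertSpace m n p x) :
    Φ'.vert x ξ = fderiv ℂ (Φ.fibreTransition Φ' (p x)) (Φ.chart x).2 (Φ.vert x ξ) := by
  rw [(Φ.hasFDerivAt_fibreTransition Φ' hx hx').fderiv]
  have hT : MDifferentiableAt 𝓘(ℂ, (Fin m → ℂ) × (Fin n → ℂ)) 𝓘(ℂ, (Fin m → ℂ) × (Fin n → ℂ))
      (Φ'.chart ∘ Φ.chart.symm) (Φ.chart x) :=
    mdifferentiableAt_iff_differentiableAt.2 (Φ.differentiableAt_transition Φ' hx hx')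
  have h1 := mfderiv_comp x hT (Φ.mdifferentiableAt_chart hx)
  have h2 : (Φ'.chart ∘ Φ.chart.symm) ∘ Φ.chart =ᶠ[𝓝 x] Φ'.chart := by
    filter_upwards [Φ.chart.open_source.mem_nhds hx] with x' hx'
    simp only [Function.comp, Φ.chart.left_inv hx']
  rw [h2.mfderiv_eq, mfderiv_eq_fderiv] at h1
  have h3 := congrArg Prod.snd (DFunLike.congr_fun h1 ξ.1)
  refine Eq.trans h3 ?_
  have h4 := Φ.mfderiv_chart_fst hx ξ
  have h5 : (mfderiv 𝓘(ℂ, Fin (m + n) → ℂ) 𝓘(ℂ, (Fin m → ℂ) × (Fin n → ℂ)) Φ.chart x ξ.1 :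
      (Fin m → ℂ) × (Fin n → ℂ)) = (0, Φ.vert x ξ) := Prod.ext h4 rfl
  exact congrArg (fun q => (fderiv ℂ (Φ'.chart ∘ Φ.chart.symm) (Φ.chart x) q).2) h5

theorem _root_.Matrix.det_linearMap_rows (A : (Fin n → ℂ) →ₗ[ℂ] (Fin n → ℂ))
    (Z : Fin n → Fin n → ℂ) :
    Matrix.det (fun i => A (Z i)) = LinearMap.det A * Matrix.det Z := by
  have : (fun i => A (Z i) : Matrix (Fin n) (Fin n) ℂ) =
      (Matrix.of Z) * (LinearMap.toMatrix' A).transpose := by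
    ext i j
    rw [← LinearMap.toMatrix'_mulVec A (Z i)]
    simp [Matrix.mul_apply, Matrix.mulVec, dotProduct, mul_comm]
  rw [this, Matrix.det_mul, Matrix.det_transpose, LinearMap.det_toMatrix', mul_comm]
  rfl

/-- A frame of the vertical tangent space dual to the fibre coordinates. -/
theorem exists_vert_frame {x : X} (hx : x ∈ Φ.chart.source) :
    ∃ ξ : Fin n → VertSpace m n p x, Φ.dz x ξ = 1 ∧
      ∀ Φ' : AdaptedChart m n p, x ∈ Φ'.chart.source → Φ'.dz x ξ =
        LinearMap.det (fderiv ℂ (Φ.fibreTransition Φ' (p x)) (Φ.chart x).2).toLinearMap := by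
  choose ξ hξ using fun i => Φ.vert_surjective hx (Pi.single i 1)
  have h1 : (Matrix.of fun i => Φ.vert x (ξ i)) = (1 : Matrix (Fin n) (Fin n) ℂ) := by
    ext i j
    simp [hξ, Matrix.one_apply, Pi.single_apply, eq_comm]
  refine ⟨ξ, ?_, fun Φ' hx' => ?_⟩
  · rw [dz_apply]
    exact (congrArg Matrix.det h1).trans Matrix.det_one
  · rw [dz_apply]
    simp_rw [Φ.vert_transition Φ' hx hx']
    have := Matrix.det_linearMap_rows
      (fderiv ℂ (Φ.fibreTransition Φ' (p x)) (Φ.chart x).2).toLinearMap (fun i => Φ.vert x (ξ i))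
    refine Eq.trans this ?_
    rw [show Matrix.det (fun i => Φ.vert x (ξ i)) = 1 from
      (congrArg Matrix.det h1).trans Matrix.det_one, mul_one]

end AdaptedChart

end Deriv

end Adapted


/-! ### Change of adapted coordinates -/

section ChangeOfVariables

variable {m n : ℕ} {X Y : Type*} [TopologicalSpace X] [ChartedSpace (Fin (m + n) → ℂ) X]
  [TopologicalSpace Y] [ChartedSpace (Fin m → ℂ) Y] {p : X → Y}

/-- The determinant of the underlying real map is the norm of the complex determinant. Hence `|v|²
dλ` does not depend on the fibre coordinates. -/
theorem abs_det_restrictScalars (A : (Fin n → ℂ) →L[ℂ] (Fin n → ℂ)) :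
    |(A.restrictScalars ℝ).det| = ‖LinearMap.det A.toLinearMap‖ ^ 2 := by
  have h : (A.restrictScalars ℝ).det = Algebra.norm ℝ (LinearMap.det A.toLinearMap) :=
    LinearMap.det_restrictScalars
  rw [h, Algebra.norm_complex_apply, Complex.normSq_eq_norm_sq, abs_of_nonneg (by positivity)]

/-- `s` and `s'` are proportional on the common part of their domains, with compatible squared
lengths `w` and `w'`. -/
def Compatible {M : X → Type*} [∀ x, AddCommGroup (M x)] [∀ x, Module ℂ (M x)]
    (U : Set X) (s : ∀ x, M x) (w : X → ℝ) (U' : Set X) (s' : ∀ x, M x) (w' : X → ℝ) : Prop :=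
  ∀ x ∈ U ∩ U', s' x ≠ 0 ∧ ∃ c : ℂ, s x = c • s' x ∧ w x = ‖c‖ ^ 2 * w' x

variable [IsManifold 𝓘(ℂ, Fin (m + n) → ℂ) ω X] [IsManifold 𝓘(ℂ, Fin m → ℂ) ω Y]

/-- The integral of `g |u|²` over `X_y ∩ A` in adapted coordinates. -/
def AdaptedChart.weightedMass (Φ : AdaptedChart m n p) (y : Y) (w : X → ℝ) (v : (Fin n → ℂ) → ℂ)
    (g : X → ENNReal) (A : Set X) : ENNReal :=
  ∫⁻ z in Φ.slice y A, ENNReal.ofReal (‖v z‖ ^ 2 * w (Φ.chart.symm (Φ.base y, z))) *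
    g (Φ.chart.symm (Φ.base y, z))

variable {M : X → Type*} [∀ x, AddCommGroup (M x)] [∀ x, Module ℂ (M x)]

/-- Change of variables along the fibre transition. The real Jacobian is the squared modulus of the
complex one, which is the factor by which `dz` changes; the change of frame contributes `|c|²` to
both the coefficient and the weight, and these cancel. -/
theorem AdaptedChart.weightedMass_eq (Φ Φ' : AdaptedChart m n p) {y : Y}
    {u : ∀ x : p ⁻¹' {y}, RelForm m n p M x} {U U' : Set X} {s s' : ∀ x, M x} {w w' : X → ℝ}
    {v v' : (Fin n → ℂ) → ℂ} (hcomp : Compatible U s w U' s' w')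
    (hv : Represents Φ U s y u v) (hv' : Represents Φ' U' s' y u v') (g : X → ENNReal) {A : Set X}
    (hA : MeasurableSet[borel X] A) (hAU : A ⊆ Φ.chart.source ∩ U)
    (hAU' : A ⊆ Φ'.chart.source ∩ U') :
    Φ.weightedMass y w v g A = Φ'.weightedMass y w' v' g A := by
  set τ := Φ.fibreTransition Φ' y with hτ
  have hpt : ∀ z ∈ Φ.slice y A, ∃ x ∈ A, p x = y ∧ (Φ.chart x).2 = z ∧
      Φ.chart.symm (Φ.base y, z) = x ∧ τ z = (Φ'.chart x).2 := by
    intro z hz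
    obtain ⟨x, ⟨hxA, hx⟩, rfl, rfl⟩ := Φ.mem_slice_iff.1 hz
    exact ⟨x, hxA, rfl, rfl, Φ.symm_base_snd hx, Φ.fibreTransition_chart Φ' hx⟩
  have himage : Φ'.slice y A = τ '' Φ.slice y A := by
    ext z'
    constructor
    · intro hz'
      obtain ⟨x, ⟨hxA, hx'⟩, rfl, rfl⟩ := Φ'.mem_slice_iff.1 hz'
      exact ⟨(Φ.chart x).2, Φ.mem_slice_iff.2 ⟨x, ⟨hxA, (hAU hxA).1⟩, rfl, rfl⟩,
        Φ.fibreTransition_chart Φ' (hAU hxA).1⟩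
    · rintro ⟨z, hz, rfl⟩
      obtain ⟨x, hxA, hy, -, -, h⟩ := hpt z hz
      rw [h]
      exact Φ'.mem_slice_iff.2 ⟨x, ⟨hxA, (hAU' hxA).1⟩, hy, rfl⟩
  have hinj : Set.InjOn τ (Φ.slice y A) := by
    intro z₁ hz₁ z₂ hz₂ h
    obtain ⟨x₁, hx₁A, hy₁, rfl, -, h₁⟩ := hpt z₁ hz₁
    obtain ⟨x₂, hx₂A, hy₂, rfl, -, h₂⟩ := hpt z₂ hz₂
    rw [h₁, h₂] at h
    have : x₁ = x₂ := by
      rw [← Φ'.symm_base_snd (hAU' hx₁A).1, ← Φ'.symm_base_snd (hAU' hx₂A).1, h, hy₁, hy₂]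
    rw [this]
  have hder : ∀ z ∈ Φ.slice y A, HasFDerivWithinAt τ ((fderiv ℂ τ z).restrictScalars ℝ)
      (Φ.slice y A) z := by
    intro z hz
    obtain ⟨x, hxA, rfl, rfl, -, -⟩ := hpt z hz
    have h := Φ.hasFDerivAt_fibreTransition Φ' (hAU hxA).1 (hAU' hxA).1
    rw [← h.fderiv] at h
    exact (h.restrictScalars ℝ).hasFDerivWithinAt
  rw [weightedMass, weightedMass, himage,
    lintegral_image_eq_lintegral_abs_det_fderiv_mul volume (Φ.measurableSet_slice y hA) hder hinj]
  refine setLIntegral_congr_fun (Φ.measurableSet_slice y hA) fun z hz => ?_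
  obtain ⟨x, hxA, rfl, rfl, hx, hx'⟩ := hpt z hz
  have hxs := (hAU hxA).1
  have hxs' := (hAU' hxA).1
  obtain ⟨hs', c, hc, hw⟩ := hcomp x ⟨(hAU hxA).2, (hAU' hxA).2⟩
  -- Evaluating both representations of `u` on a vertical frame dual to the coordinates of `Φ` gives
  -- `v c = v' det`.
  obtain ⟨ξ, hξ, hξ'⟩ := Φ.exists_vert_frame hxs
  have e1 := hv ⟨x, rfl⟩ hxs (hAU hxA).2
  have e2 := hv' ⟨x, rfl⟩ hxs' (hAU' hxA).2
  have e3 := DFunLike.congr_fun (e1.symm.trans e2) ξ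
  have e4 : v (Φ.chart x).2 • (Φ.dz x ξ) • s x = v' (Φ'.chart x).2 • (Φ'.dz x ξ) • s' x := e3
  rw [hξ, hξ' Φ' hxs', hc, one_smul, smul_smul, smul_smul] at e4
  have e5 := smul_left_injective ℂ hs' e4
  beta_reduce at e5
  rw [abs_det_restrictScalars, hx', hx, Φ'.symm_base_snd hxs', ← mul_assoc,
    ← ENNReal.ofReal_mul (by positivity), hw]
  congr 2
  have e6 := congrArg (fun a : ℂ => ‖a‖ ^ 2) e5
  simp only [norm_mul, mul_pow] at e6
  linear_combination (w' x) * e6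

end ChangeOfVariables

/-! ### Construction of adapted coordinates -/

section Existence

variable {m n : ℕ} {X Y : Type*} [TopologicalSpace X] [ChartedSpace (Fin (m + n) → ℂ) X]
  [TopologicalSpace Y] [ChartedSpace (Fin m → ℂ) Y] {p : X → Y}

/-- Change of the fibre coordinates. -/
def AdaptedChart.trans (Φ : AdaptedChart m n p)
    (T : OpenPartialHomeomorph ((Fin m → ℂ) × (Fin n → ℂ)) ((Fin m → ℂ) × (Fin n → ℂ)))
    (hT : ContDiffOn ℂ ω T T.source) (hT' : ContDiffOn ℂ ω T.symm T.target)
    (hfst : ∀ q ∈ T.source, (T q).1 = q.1) : AdaptedChart m n p where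
  chart := Φ.chart.trans T
  base := Φ.base
  holo := hT.contMDiffOn.comp (Φ.holo.mono (by intro x hx; simp at hx; exact hx.1))
    (by intro x hx; simp at hx; exact hx.2)
  holo_symm := Φ.holo_symm.comp (hT'.contMDiffOn.mono (by intro x hx; simp at hx; exact hx.1))
    (by intro x hx; simp at hx; exact hx.2)
  base_mem := Φ.base_mem
  fibred := by
    intro x hx
    simp only [OpenPartialHomeomorph.trans_source, Set.mem_inter_iff, Set.mem_preimage] at hx
    refine ⟨(Φ.fibred x hx.1).1, ?_⟩
    change (T (Φ.chart x)).1 = _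
    rw [hfst _ hx.2, (Φ.fibred x hx.1).2]

variable [IsManifold 𝓘(ℂ, Fin (m + n) → ℂ) ω X] [IsManifold 𝓘(ℂ, Fin m → ℂ) ω Y]

/-- The normal form of a submersion already writes `p` as a projection `ℂᵐ × F → ℂᵐ`. A dimension
count identifies the complement `F` with `ℂⁿ`. -/
theorem exists_adaptedChart
    (hp : Manifold.IsSubmersion 𝓘(ℂ, Fin (m + n) → ℂ) 𝓘(ℂ, Fin m → ℂ) ω p) (x : X) :
    ∃ Φ : AdaptedChart m n p, x ∈ Φ.chart.source := by
  obtain ⟨F, _, _, h⟩ := hp.isSubmersionAt x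
  have hfd : FiniteDimensional ℂ ((Fin m → ℂ) × F) :=
    LinearEquiv.finiteDimensional h.equiv.toLinearEquiv
  have hfF : FiniteDimensional ℂ F :=
    FiniteDimensional.of_surjective (LinearMap.snd ℂ (Fin m → ℂ) F) LinearMap.snd_surjective
  have hdim : Module.finrank ℂ F = Module.finrank ℂ (Fin n → ℂ) := by
    have := h.equiv.toLinearEquiv.finrank_eq
    simp at this ⊢
    omega
  let e : F ≃L[ℂ] (Fin n → ℂ) := ContinuousLinearEquiv.ofFinrankEq hdim
  let E : (Fin (m + n) → ℂ) ≃L[ℂ] (Fin m → ℂ) × (Fin n → ℂ) :=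
    h.equiv.trans ((ContinuousLinearEquiv.refl ℂ _).prodCongr e)
  refine ⟨{ chart := h.domChart.transHomeomorph E.toHomeomorph
            base := h.codChart
            holo := ?_
            holo_symm := ?_
            base_mem := h.codChart_mem_maximalAtlas
            fibred := ?_ }, h.mem_domChart_source⟩
  · exact E.contDiff.contMDiff.comp_contMDiffOn
      (contMDiffOn_of_mem_maximalAtlas h.domChart_mem_maximalAtlas)
  · exact (contMDiffOn_symm_of_mem_maximalAtlas h.domChart_mem_maximalAtlas).comp
      E.symm.contDiff.contMDiff.contMDiffOn (fun q hq => hq)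
  · intro x' hx'
    have hx'' : x' ∈ h.domChart.source := hx'
    refine ⟨h.source_subset_preimage_source hx'', ?_⟩
    have hm : h.domChart x' ∈ (h.domChart.extend 𝓘(ℂ, Fin (m + n) → ℂ)).target := by
      simpa using h.domChart.map_source hx''
    have := h.writtenInCharts hm
    simp only [OpenPartialHomeomorph.extend, Function.comp] at this
    change (h.equiv (h.domChart x')).1 = _
    refine this.symm.trans ?_
    simp [h.domChart.left_inv hx'']

end Existence


/-! ### `L²` norms of sections -/

section Mass

variable {m n : ℕ} {X Y : Type*} [TopologicalSpace X] [ChartedSpace (Fin (m + n) → ℂ) X]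
  [TopologicalSpace Y] [ChartedSpace (Fin m → ℂ) Y] {p : X → Y}
  {M : X → Type*} [∀ x, AddCommGroup (M x)] [∀ x, Module ℂ (M x)]

theorem AdaptedChart.weightedMass_mono (Φ : AdaptedChart m n p) (y : Y) (w : X → ℝ)
    (v : (Fin n → ℂ) → ℂ) (g : X → ENNReal) {A B : Set X} (h : A ⊆ B) :
    Φ.weightedMass y w v g A ≤ Φ.weightedMass y w v g B :=
  lintegral_mono_set (Φ.slice_mono y h)

theorem AdaptedChart.weightedMass_union_le (Φ : AdaptedChart m n p) (y : Y) (w : X → ℝ)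
    (v : (Fin n → ℂ) → ℂ) (g : X → ENNReal) (A B : Set X) :
    Φ.weightedMass y w v g (A ∪ B) ≤ Φ.weightedMass y w v g A + Φ.weightedMass y w v g B := by
  have : Φ.slice y (A ∪ B) = Φ.slice y A ∪ Φ.slice y B := by
    ext z; simp only [slice, Set.mem_ofPred_eq, Set.mem_union]; tauto
  rw [weightedMass, this]
  exact lintegral_union_le _ _ _

theorem AdaptedChart.weightedMass_iUnion_le {ι : Type*} [Fintype ι] (Φ : AdaptedChart m n p) (y : Y)
    (w : X → ℝ) (v : (Fin n → ℂ) → ℂ) (g : X → ENNReal) (A : ι → Set X) :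
    Φ.weightedMass y w v g (⋃ i, A i) ≤ ∑ i, Φ.weightedMass y w v g (A i) := by
  rw [weightedMass, Φ.slice_iUnion]
  exact (lintegral_iUnion_le _ _).trans_eq (tsum_fintype _)

theorem LocalPiece.mass_eq {𝓕 : MetrizedFrames M} {y : Y}
    {u : ∀ x : p ⁻¹' {y}, RelForm m n p M x} (P : LocalPiece 𝓕 y u) :
    P.mass = P.Φ.weightedMass y P.w P.v (fun _ => 1) P.A := by
  simp [LocalPiece.mass, AdaptedChart.weightedMass]

variable [IsManifold 𝓘(ℂ, Fin (m + n) → ℂ) ω X] [IsManifold 𝓘(ℂ, Fin m → ℂ) ω Y]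

/-- The sum of the masses of disjoint pieces inside `B` is at most the mass of `B`. -/
theorem AdaptedChart.sum_weightedMass_le {ι : Type*} [Fintype ι] (Φ' : AdaptedChart m n p) {y : Y}
    {u : ∀ x : p ⁻¹' {y}, RelForm m n p M x} {U' : Set X} {s' : ∀ x, M x} {w' : X → ℝ}
    {v' : (Fin n → ℂ) → ℂ} (hv' : Represents Φ' U' s' y u v')
    (Φ : ι → AdaptedChart m n p) (U : ι → Set X) (s : ι → ∀ x, M x) (w : ι → X → ℝ)
    (v : ι → (Fin n → ℂ) → ℂ) (A : ι → Set X)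
    (hcomp : ∀ i, Compatible (U i) (s i) (w i) U' s' w')
    (hv : ∀ i, Represents (Φ i) (U i) (s i) y u (v i))
    (hA : ∀ i, MeasurableSet[borel X] (A i)) (hAU : ∀ i, A i ⊆ (Φ i).chart.source ∩ U i)
    (hdisj : Pairwise fun i j => Disjoint (A i) (A j))
    (g : X → ENNReal) {B : Set X} (hB : MeasurableSet[borel X] B) (hBU : B ⊆ Φ'.chart.source ∩ U') :
    ∑ i, (Φ i).weightedMass y (w i) (v i) g (A i ∩ B) ≤ Φ'.weightedMass y w' v' g B := by
  have hAB : ∀ i, MeasurableSet[borel X] (A i ∩ B) := fun i =>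
    @MeasurableSet.inter X (borel X) _ _ (hA i) hB
  have h1 : ∀ i, (Φ i).weightedMass y (w i) (v i) g (A i ∩ B) =
      Φ'.weightedMass y w' v' g (A i ∩ B) := fun i =>
    (Φ i).weightedMass_eq Φ' (hcomp i) (hv i) hv' g (hAB i)
      (Set.inter_subset_left.trans (hAU i)) (Set.inter_subset_right.trans hBU)
  simp_rw [h1]
  have h2 : ∑ i, Φ'.weightedMass y w' v' g (A i ∩ B) =
      Φ'.weightedMass y w' v' g (⋃ i, A i ∩ B) := by
    rw [weightedMass, Φ'.slice_iUnion, lintegral_iUnion (fun i => Φ'.measurableSet_slice y (hAB i)),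
      tsum_fintype]
    · rfl
    · exact fun i j hij => Φ'.slice_disjoint y
        ((hdisj hij).mono Set.inter_subset_left Set.inter_subset_left)
  rw [h2]
  exact Φ'.weightedMass_mono y w' v' g (Set.iUnion_subset fun i => Set.inter_subset_right)

end Mass

/-! ### Finiteness of `L²` norms for a Hermitian line bundle. -/

section LineMass

variable {m n : ℕ} {X Y : Type*} [TopologicalSpace X] [ChartedSpace (Fin (m + n) → ℂ) X]
  [TopologicalSpace Y] [ChartedSpace (Fin m → ℂ) Y] {p : X → Y}
  {L : X → Type*} [TopologicalSpace (TotalSpace ℂ L)] [∀ x, AddCommGroup (L x)]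
  [∀ x, Module ℂ (L x)] [∀ x, TopologicalSpace (L x)] [FiberBundle ℂ L] [VectorBundle ℂ ℂ L]
  {hL : HermitianMetric (m + n) L}

theorem lineFrames.compatible {U U' : Set X} {s s' : ∀ x, L x} {w w' : X → ℝ}
    (h : lineFrames hL U s w) (h' : lineFrames hL U' s' w') : Compatible U s w U' s' w' := by
  intro x hx
  refine ⟨h'.1.2.1 x hx.2, ?_⟩
  obtain ⟨c, hc⟩ := exists_smul_eq_of_ne_zero (h'.1.2.1 x hx.2) (s x)
  exact ⟨c, hc, by rw [h.2 x hx.1, h'.2 x hx.2, hc, hL.normSq_smul]⟩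

theorem lineFrames.continuousOn {U : Set X} {s : ∀ x, L x} {w : X → ℝ}
    (h : lineFrames hL U s w) : ContinuousOn w U :=
  (hL.continuousOn_normSq h.1).congr h.2

theorem lineFrames.pos {U : Set X} {s : ∀ x, L x} {w : X → ℝ}
    (h : lineFrames hL U s w) {x : X} (hx : x ∈ U) : 0 < w x := by
  rw [h.2 x hx]; exact hL.normSq_pos (h.1.2.1 x hx)

theorem IsHolFrame.lineFrames {U : Set X} {s : ∀ x, L x} (hs : IsHolFrame (m + n) L U s) :
    lineFrames hL U s fun x => hL.normSq x (s x) := ⟨hs, fun _ _ => rfl⟩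

theorem AdaptedChart.continuousOn_symm_base (Φ : AdaptedChart m n p) (y : Y) (A : Set X) :
    ContinuousOn (fun z => Φ.chart.symm (Φ.base y, z)) (Φ.slice y A) :=
  Φ.chart.continuousOn_symm.comp (by fun_prop) fun _ hz => hz.1

/-- Around each point of `X_y`, a section has finite mass. -/
theorem exists_open_weightedMass_lt_top (Φ : AdaptedChart m n p) {y : Y} {U : Set X} {s : ∀ x, L x}
    {w : X → ℝ} {v : (Fin n → ℂ) → ℂ} (hf : lineFrames hL U s w)
    (hv : ContDiffOn ℂ ω v (Φ.slice y U)) {x : X} (hx : x ∈ Φ.chart.source) (hxU : x ∈ U)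
    (hxy : p x = y) :
    ∃ O : Set X, IsOpen O ∧ x ∈ O ∧ O ⊆ Φ.chart.source ∩ U ∧
      Φ.weightedMass y w v (fun _ => 1) O < ⊤ := by
  subst hxy
  set z₀ := (Φ.chart x).2 with hz₀
  have hz₀s : z₀ ∈ Φ.slice (p x) U := Φ.mem_slice_iff.2 ⟨x, ⟨hxU, hx⟩, rfl, rfl⟩
  have hopen := Φ.isOpen_slice (p x) hf.1.1
  set F : (Fin n → ℂ) → ℝ := fun z => ‖v z‖ ^ 2 * w (Φ.chart.symm (Φ.base (p x), z)) with hF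
  have hFc : ContinuousOn F (Φ.slice (p x) U) :=
    (hv.continuousOn.norm.pow 2).mul
      (hf.continuousOn.comp (Φ.continuousOn_symm_base (p x) U) fun z hz => hz.2.2)
  have hFat := hFc.continuousAt (hopen.mem_nhds hz₀s)
  obtain ⟨δ, hδ, hball⟩ := Metric.eventually_nhds_iff_ball.1
    (hFat.eventually (eventually_lt_nhds (lt_add_one (F z₀))))
  refine ⟨(Φ.chart.source ∩ Φ.chart ⁻¹' (Prod.snd ⁻¹' Metric.ball z₀ δ)) ∩ U, ?_, ?_, ?_, ?_⟩
  · exact (Φ.chart.isOpen_inter_preimage (Metric.isOpen_ball.preimage continuous_snd)).inter hf.1.1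
  · exact ⟨⟨hx, show (Φ.chart x).2 ∈ Metric.ball z₀ δ from Metric.mem_ball_self hδ⟩, hxU⟩
  · exact fun x' hx' => ⟨hx'.1.1, hx'.2⟩
  · have hsub : Φ.slice (p x) ((Φ.chart.source ∩ Φ.chart ⁻¹' (Prod.snd ⁻¹' Metric.ball z₀ δ)) ∩ U) ⊆
        Metric.ball z₀ δ := by
      intro z hz
      obtain ⟨x', ⟨hx', hx's⟩, -, rfl⟩ := Φ.mem_slice_iff.1 hz
      exact hx'.1.2
    calc Φ.weightedMass (p x) w v (fun _ => 1) _
        ≤ ∫⁻ z in Metric.ball z₀ δ, ENNReal.ofReal (F z) * 1 := lintegral_mono_set hsub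
      _ ≤ ∫⁻ z in Metric.ball z₀ δ, ENNReal.ofReal (F z₀ + 1) := by
          refine setLIntegral_mono' measurableSet_ball fun z hz => ?_
          rw [mul_one]
          exact ENNReal.ofReal_le_ofReal (hball z hz).le
      _ < ⊤ := by
          rw [lintegral_const, Measure.restrict_apply_univ]
          exact ENNReal.mul_lt_top ENNReal.ofReal_lt_top measure_ball_lt_top

variable [ContMDiffVectorBundle ω ℂ L 𝓘(ℂ, Fin (m + n) → ℂ)]
  [IsManifold 𝓘(ℂ, Fin (m + n) → ℂ) ω X] [IsManifold 𝓘(ℂ, Fin m → ℂ) ω Y]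

/-- The compact fibre is covered by finitely many open sets on which the section has finite mass.
Inside each of them, any family of disjoint pieces has total mass at most that of the open set, so
the sum of these masses bounds the supremum. -/
theorem l2NormSq_lineFrames_lt_top [CompactSpace X] [T2Space Y]
    (hp : Manifold.IsSubmersion 𝓘(ℂ, Fin (m + n) → ℂ) 𝓘(ℂ, Fin m → ℂ) ω p) {y : Y}
    {u : ∀ x : p ⁻¹' {y}, RelForm m n p L x}
    (hu : u ∈ fibreSections (m := m) (n := n) p (lineFrames hL) y) :
    l2NormSq (lineFrames hL) y u < ⊤ := by
  have hpc : Continuous p := hp.contMDiff.continuous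
  have hK : IsCompact (p ⁻¹' {y}) := (isClosed_singleton.preimage hpc).isCompact
  have hloc : ∀ x : p ⁻¹' {y}, ∃ (Φ : AdaptedChart m n p) (U : Set X) (s : ∀ x, L x) (w : X → ℝ)
      (v : (Fin n → ℂ) → ℂ) (O : Set X), lineFrames hL U s w ∧ Represents Φ U s y u v ∧ IsOpen O ∧
        (x : X) ∈ O ∧ O ⊆ Φ.chart.source ∩ U ∧ Φ.weightedMass y w v (fun _ => 1) O < ⊤ := by
    intro x
    obtain ⟨Φ, hΦ⟩ := exists_adaptedChart hp (x : X)
    obtain ⟨U, s, hxU, hs⟩ := exists_isHolFrame (d := m + n) (L := L) (x : X)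
    have hf : lineFrames hL U s fun x => hL.normSq x (s x) := hs.lineFrames
    obtain ⟨v, hv, hr⟩ := hu Φ U s _ hf
    obtain ⟨O, hO⟩ := exists_open_weightedMass_lt_top Φ hf hv hΦ hxU x.2
    exact ⟨Φ, U, s, _, v, O, hf, hr, hO⟩
  choose Φ U s w v O hf hr hOo hxO hOU hfin using hloc
  obtain ⟨t, ht⟩ := hK.elim_finite_subcover O hOo fun x hx => Set.mem_iUnion.2 ⟨⟨x, hx⟩, hxO _⟩
  have hOm : ∀ x, MeasurableSet[borel X] (O x) := fun x =>
    MeasurableSpace.measurableSet_generateFrom (hOo x)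
  refine lt_of_le_of_lt ?_ (ENNReal.sum_lt_top.2 fun (x : p ⁻¹' {y}) (_ : x ∈ t) => hfin x)
  refine iSup_le fun k => iSup_le fun P => iSup_le fun hP => ?_
  calc ∑ i, (P i).mass
      ≤ ∑ i, ∑ x ∈ t, (P i).Φ.weightedMass y (P i).w (P i).v (fun _ => 1) ((P i).A ∩ O x) := by
        refine Finset.sum_le_sum fun i _ => ?_
        rw [LocalPiece.mass_eq, ← Finset.sum_coe_sort t]
        refine le_trans ?_ ((P i).Φ.weightedMass_iUnion_le y _ _ _ fun x : t => (P i).A ∩ O x)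
        refine lintegral_mono_set ?_
        intro z hz
        obtain ⟨x, ⟨hxA, hxs⟩, hxy, rfl⟩ := (P i).Φ.mem_slice_iff.1 hz
        obtain ⟨x₁, hx₁, hx₁'⟩ := Set.mem_iUnion₂.1 (ht (show x ∈ p ⁻¹' {y} from hxy))
        exact (P i).Φ.mem_slice_iff.2
          ⟨x, ⟨Set.mem_iUnion.2 ⟨⟨x₁, hx₁⟩, hxA, hx₁'⟩, hxs⟩, hxy, rfl⟩
    _ = ∑ x ∈ t, ∑ i, (P i).Φ.weightedMass y (P i).w (P i).v (fun _ => 1) ((P i).A ∩ O x) :=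
        Finset.sum_comm
    _ ≤ _ := Finset.sum_le_sum fun x _ =>
        (Φ x).sum_weightedMass_le (hr x) _ _ _ _ _ _
          (fun i => (P i).frame.compatible (hf x)) (fun i => (P i).represents)
          (fun i => (P i).borel) (fun i => (P i).subset) hP _ (hOm x) (hOU x)

end LineMass


/-! ### Multiplication by a section of `E` -/

section Tensor

variable {m n : ℕ} {X Y : Type*} [TopologicalSpace X] [ChartedSpace (Fin (m + n) → ℂ) X]
  [TopologicalSpace Y] [ChartedSpace (Fin m → ℂ) Y] {p : X → Y}
  {L : X → Type*} [TopologicalSpace (TotalSpace ℂ L)] [∀ x, AddCommGroup (L x)]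
  [∀ x, Module ℂ (L x)] [∀ x, TopologicalSpace (L x)] [FiberBundle ℂ L] [VectorBundle ℂ ℂ L]
  {E : X → Type*} [TopologicalSpace (TotalSpace ℂ E)] [∀ x, AddCommGroup (E x)]
  [∀ x, Module ℂ (E x)] [∀ x, TopologicalSpace (E x)] [FiberBundle ℂ E] [VectorBundle ℂ ℂ E]
  {hL : HermitianMetric (m + n) L} {hE : HermitianMetric (m + n) E}

theorem tmul_ne_zero {V W : Type*} [AddCommGroup V] [Module ℂ V] [AddCommGroup W] [Module ℂ W]
    {a : V} {b : W} (ha : a ≠ 0) (hb : b ≠ 0) : a ⊗ₜ[ℂ] b ≠ 0 := by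
  obtain ⟨f, hf⟩ := Module.Projective.exists_dual_ne_zero ℂ ha
  obtain ⟨g, hg⟩ := Module.Projective.exists_dual_ne_zero ℂ hb
  intro h
  have := congrArg (LinearMap.mul' ℂ ℂ ∘ₗ TensorProduct.map f g) h
  simp at this
  tauto

/-- The product of an `L`-valued section on a fibre with a section of `E`. -/
def tensorSection {y : Y} (u : ∀ x : p ⁻¹' {y}, RelForm m n p L x) (σ : ∀ x, E x) :
    ∀ x : p ⁻¹' {y}, RelForm m n p (fun x => L x ⊗[ℂ] E x) x := fun x =>
  ((TensorProduct.mk ℂ (L x) (E x)).flip (σ x)).compAlternatingMap (u x)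

theorem Represents.tensorSection {Φ : AdaptedChart m n p} {U : Set X} {s₁ : ∀ x, L x}
    {s₂ σ : ∀ x, E x} {s : ∀ x, L x ⊗[ℂ] E x} {y : Y} {u : ∀ x : p ⁻¹' {y}, RelForm m n p L x}
    {v : (Fin n → ℂ) → ℂ} {c : X → ℂ} (hv : Represents Φ U s₁ y u v)
    (hc : ∀ x ∈ U, σ x = c x • s₂ x) (hs : ∀ x ∈ U, s x = s₁ x ⊗ₜ[ℂ] s₂ x) :
    Represents Φ U s y (tensorSection u σ)
      fun z => v z * c (Φ.chart.symm (Φ.base y, z)) := by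
  rintro ⟨x, rfl⟩ hx hxU
  have h1 := hv ⟨x, rfl⟩ hx hxU
  ext ξ
  have h2 : DirectImage.tensorSection u σ ⟨x, rfl⟩ ξ = (u ⟨x, rfl⟩ ξ) ⊗ₜ[ℂ] σ x := rfl
  rw [h2, h1]
  simp only
  rw [Φ.symm_base_snd hx, hc x hxU]
  change (v (Φ.chart x).2 • (Φ.dz x ξ) • s₁ x) ⊗ₜ[ℂ] (c x • s₂ x) =
    (v (Φ.chart x).2 * c x) • (Φ.dz x ξ) • s x
  rw [hs x hxU, TensorProduct.tmul_smul, TensorProduct.smul_tmul', TensorProduct.smul_tmul',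
    mul_smul, smul_comm (c x)]
  simp only [TensorProduct.smul_tmul']

variable [ContMDiffVectorBundle ω ℂ L 𝓘(ℂ, Fin (m + n) → ℂ)]
  [ContMDiffVectorBundle ω ℂ E 𝓘(ℂ, Fin (m + n) → ℂ)]
  [IsManifold 𝓘(ℂ, Fin (m + n) → ℂ) ω X] [IsManifold 𝓘(ℂ, Fin m → ℂ) ω Y]

/-- The section `σ` of `L` is holomorphic on `U`. -/
abbrev IsHolSectionOn (d : ℕ) {X : Type*} [TopologicalSpace X] [ChartedSpace (Fin d → ℂ) X]
    {E : X → Type*} [TopologicalSpace (TotalSpace ℂ E)] [∀ x, AddCommGroup (E x)]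
    [∀ x, Module ℂ (E x)] [∀ x, TopologicalSpace (E x)] [FiberBundle ℂ E]
    (σ : ∀ x, E x) (U : Set X) : Prop :=
  ContMDiffOn 𝓘(ℂ, Fin d → ℂ) (𝓘(ℂ, Fin d → ℂ).prod 𝓘(ℂ, ℂ)) ω
      (fun x => TotalSpace.mk' ℂ x (σ x)) U

theorem AdaptedChart.contDiffOn_comp_slice (Φ : AdaptedChart m n p) (y : Y) {U : Set X} {c : X → ℂ}
    (hc : ContMDiffOn 𝓘(ℂ, Fin (m + n) → ℂ) 𝓘(ℂ, ℂ) ω c U) :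
    ContDiffOn ℂ ω (fun z => c (Φ.chart.symm (Φ.base y, z))) (Φ.slice y U) := by
  rw [← contMDiffOn_iff_contDiffOn]
  have h1 : ContMDiffOn 𝓘(ℂ, Fin n → ℂ) 𝓘(ℂ, Fin (m + n) → ℂ) ω
      (fun z => Φ.chart.symm (Φ.base y, z)) (Φ.slice y U) := by
    refine Φ.holo_symm.comp (ContDiff.contMDiff ?_).contMDiffOn fun z hz => hz.1
    fun_prop
  exact hc.comp h1 fun z hz => hz.2.2

theorem tensorSection_mem {y : Y} {u : ∀ x : p ⁻¹' {y}, RelForm m n p L x}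
    (hu : u ∈ fibreSections (m := m) (n := n) p (lineFrames hL) y) {σ : ∀ x, E x}
    (hσ : IsHolSectionOn (m + n) σ Set.univ) :
    tensorSection u σ ∈ fibreSections (m := m) (n := n) p (tensorFrames hL hE) y := by
  rintro Φ U s w ⟨s₁, w₁, s₂, w₂, h₁, h₂, hs⟩
  obtain ⟨v, hv, hr⟩ := hu Φ U s₁ w₁ h₁
  obtain ⟨c, hc, hcs⟩ := h₂.1.exists_coeff (hσ.mono (Set.subset_univ _))
  exact ⟨_, hv.mul (Φ.contDiffOn_comp_slice y hc),
    hr.tensorSection hcs fun x hx => (hs x hx).1⟩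

/-- Division of a section with values in `L ⊗ E` by a nowhere vanishing section of `E`. -/
theorem exists_eq_tensorSection {y : Y}
    {u : ∀ x : p ⁻¹' {y}, RelForm m n p (fun x => L x ⊗[ℂ] E x) x}
    (hu : u ∈ fibreSections (m := m) (n := n) p (tensorFrames hL hE) y) {σ : ∀ x, E x}
    (hσ : IsHolSectionOn (m + n) σ Set.univ) (hne : ∀ x, σ x ≠ 0) :
    ∃ u₀ ∈ fibreSections (m := m) (n := n) p (lineFrames hL) y, u = tensorSection u₀ σ := by
  have hφ : ∀ x, ∃ φ : E x →ₗ[ℂ] ℂ, φ (σ x) = 1 := by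
    intro x
    obtain ⟨f, hf⟩ := Module.Projective.exists_dual_ne_zero ℂ (hne x)
    exact ⟨(f (σ x))⁻¹ • f, by simp [hf]⟩
  choose φ hφ using hφ
  -- Contraction of the `E` factor with a functional equal to `1` on `σ` is inverse to `⊗ σ`,
  -- because `E x` is a line. The functionals are chosen pointwise; holomorphy of the quotient is
  -- read off from the frames `s ⊗ σ`.
  let D : ∀ x, (L x ⊗[ℂ] E x) →ₗ[ℂ] L x := fun x =>
    (TensorProduct.rid ℂ (L x)).toLinearMap ∘ₗ TensorProduct.map LinearMap.id (φ x)
  have hD : ∀ x (a : L x), D x (a ⊗ₜ σ x) = a := fun x a => by simp [D, hφ]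
  have hD' : ∀ x (t : L x ⊗[ℂ] E x), (D x t) ⊗ₜ[ℂ] σ x = t := by
    intro x t
    induction t with
    | zero => simp
    | tmul a b =>
      obtain ⟨c, rfl⟩ := exists_smul_eq_of_ne_zero (hne x) b
      rw [TensorProduct.tmul_smul, map_smul, hD, TensorProduct.smul_tmul']
    | add a b ha hb => rw [map_add, TensorProduct.add_tmul, ha, hb]
  refine ⟨fun x => (D x).compAlternatingMap (u x), ?_, ?_⟩
  · intro Φ U s w hf
    have hσU : lineFrames hE U σ fun x => hE.normSq x (σ x) :=
      ⟨⟨hf.1.1, fun x _ => hne x, hσ.mono (Set.subset_univ _)⟩, fun _ _ => rfl⟩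
    obtain ⟨v, hv, hr⟩ := hu Φ U (fun x => s x ⊗ₜ σ x) (fun x => w x * hE.normSq x (σ x))
      ⟨s, w, σ, _, hf, hσU, fun x _ => ⟨rfl, rfl⟩⟩
    refine ⟨v, hv, fun x hx hxU => ?_⟩
    ext ξ
    have h1 := DFunLike.congr_fun (hr x hx hxU) ξ
    change u x ξ = v (Φ.chart x).2 • (Φ.dz x ξ) • (s x ⊗ₜ[ℂ] σ x) at h1
    change D x (u x ξ) = v (Φ.chart x).2 • (Φ.dz x ξ) • s x
    rw [h1, map_smul, map_smul, hD]
  · funext x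
    ext ξ
    exact (hD' x (u x ξ)).symm

/-- The `L²` norm of `u ⊗ σ`, split into the contribution of a set `B` inside one coordinate domain
and the rest, where `|σ|²` is bounded by `C`. -/
theorem l2NormSq_tensorSection_le {y : Y} {u : ∀ x : p ⁻¹' {y}, RelForm m n p L x}
    (hu : u ∈ fibreSections (m := m) (n := n) p (lineFrames hL) y) {σ : ∀ x, E x}
    (hσ : IsHolSectionOn (m + n) σ Set.univ) (Φ' : AdaptedChart m n p) {U' : Set X} {s' : ∀ x, L x}
    {w' : X → ℝ} {v' : (Fin n → ℂ) → ℂ} (hf' : lineFrames hL U' s' w')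
    (hv' : Represents Φ' U' s' y u v') {B : Set X} (hB : MeasurableSet[borel X] B)
    (hBU : B ⊆ Φ'.chart.source ∩ U') {C : ENNReal} (hC : C ≠ ⊤)
    (hσC : ∀ x ∉ B, ENNReal.ofReal (hE.normSq x (σ x)) ≤ C) :
    l2NormSq (tensorFrames hL hE) y (tensorSection u σ) ≤
      Φ'.weightedMass y w' v' (fun x => ENNReal.ofReal (hE.normSq x (σ x))) B +
        C * l2NormSq (lineFrames hL) y u := by
  set g : X → ENNReal := fun x => ENNReal.ofReal (hE.normSq x (σ x)) with hg
  refine iSup_le fun k => iSup_le fun P => iSup_le fun hP => ?_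
  have hBc : MeasurableSet[borel X] Bᶜ := @MeasurableSet.compl X _ (borel X) hB
  -- On each piece the frame splits as a tensor product. Comparing coefficients turns the mass of `u
  -- ⊗ σ` into the mass of `u` weighted by `|σ|²`.
  have hpiece : ∀ i, ∃ (s₁ : ∀ x, L x) (w₁ : X → ℝ) (v₁ : (Fin n → ℂ) → ℂ),
      lineFrames hL (P i).U s₁ w₁ ∧ Represents (P i).Φ (P i).U s₁ y u v₁ ∧
      (P i).mass = (P i).Φ.weightedMass y w₁ v₁ g (P i).A := by
    intro i
    obtain ⟨s₁, w₁, s₂, w₂, h₁, h₂, hs⟩ := (P i).frame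
    obtain ⟨v₁, -, hr⟩ := hu (P i).Φ (P i).U s₁ w₁ h₁
    obtain ⟨c, -, hcs⟩ := h₂.1.exists_coeff (hσ.mono (Set.subset_univ _))
    refine ⟨s₁, w₁, v₁, h₁, hr, ?_⟩
    rw [LocalPiece.mass_eq]
    refine setLIntegral_congr_fun ((P i).Φ.measurableSet_slice y (P i).borel) fun z hz => ?_
    obtain ⟨x, ⟨hxA, hxs⟩, rfl, rfl⟩ := (P i).Φ.mem_slice_iff.1 hz
    have hxU := ((P i).subset hxA).2
    have e1 := (P i).represents ⟨x, rfl⟩ hxs hxU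
    have e2 := hr.tensorSection hcs (fun x hx => (hs x hx).1) ⟨x, rfl⟩ hxs hxU
    obtain ⟨ξ, hξ, -⟩ := (P i).Φ.exists_vert_frame hxs
    have e3 := DFunLike.congr_fun (e1.symm.trans e2) ξ
    have e4 : (P i).v ((P i).Φ.chart x).2 • ((P i).Φ.dz x ξ) • (P i).s x =
      (v₁ ((P i).Φ.chart x).2 * c ((P i).Φ.chart.symm ((P i).Φ.base (p x), ((P i).Φ.chart x).2))) •
        ((P i).Φ.dz x ξ) • (P i).s x := e3
    have hs0 : (P i).s x ≠ 0 := by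
      rw [(hs x hxU).1]
      exact tmul_ne_zero (h₁.1.2.1 x hxU) (h₂.1.2.1 x hxU)
    rw [hξ, one_smul] at e4
    have e5 := smul_left_injective ℂ hs0 e4
    beta_reduce
    rw [(P i).Φ.symm_base_snd hxs] at e5 ⊢
    rw [mul_one, e5, hg, ← ENNReal.ofReal_mul (by have := (h₁.pos hxU).le; positivity),
      (hs x hxU).2, hcs x hxU, hE.normSq_smul, ← h₂.2 x hxU, norm_mul]
    congr 1
    ring
  choose s₁ w₁ v₁ hf hr hmass using hpiece
  have hsplit : ∀ i, (P i).mass ≤ (P i).Φ.weightedMass y (w₁ i) (v₁ i) g ((P i).A ∩ B) +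
      C * (P i).Φ.weightedMass y (w₁ i) (v₁ i) (fun _ => 1) ((P i).A ∩ Bᶜ) := by
    intro i
    rw [hmass i]
    conv_lhs => rw [← Set.inter_union_compl (P i).A B]
    refine ((P i).Φ.weightedMass_union_le y _ _ _ _ _).trans (add_le_add le_rfl ?_)
    rw [AdaptedChart.weightedMass, AdaptedChart.weightedMass, ← lintegral_const_mul' _ _ hC]
    refine setLIntegral_mono' ((P i).Φ.measurableSet_slice y
      (@MeasurableSet.inter X (borel X) _ _ (P i).borel hBc)) fun z hz => ?_
    rw [mul_one, mul_comm]
    gcongr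
    exact hσC _ hz.2.2.2
  -- The parts outside `B` are themselves disjoint pieces for `u`, so their total mass is bounded by
  -- the norm of `u`.
  let Q : Fin k → LocalPiece (lineFrames hL) y u := fun i =>
    { Φ := (P i).Φ, U := (P i).U, s := s₁ i, w := w₁ i, v := v₁ i, A := (P i).A ∩ Bᶜ
      frame := hf i
      represents := hr i
      borel := @MeasurableSet.inter X (borel X) _ _ (P i).borel hBc
      subset := Set.inter_subset_left.trans (P i).subset }
  have hQ : ∑ i, (Q i).mass ≤ l2NormSq (lineFrames hL) y u :=
    le_iSup_of_le k (le_iSup_of_le Q (le_iSup_of_le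
      (fun i j hij => (hP hij).mono Set.inter_subset_left Set.inter_subset_left) le_rfl))
  calc ∑ i, (P i).mass ≤ ∑ i, ((P i).Φ.weightedMass y (w₁ i) (v₁ i) g ((P i).A ∩ B) +
        C * (Q i).mass) := by
        refine Finset.sum_le_sum fun i _ => ?_
        rw [(Q i).mass_eq]
        exact hsplit i
    _ = ∑ i, (P i).Φ.weightedMass y (w₁ i) (v₁ i) g ((P i).A ∩ B) + C * ∑ i, (Q i).mass := by
        rw [Finset.sum_add_distrib, Finset.mul_sum]
    _ ≤ _ := by
        gcongr
        exact Φ'.sum_weightedMass_le hv' _ _ _ _ _ _ (fun i => (hf i).compatible hf') hr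
          (fun i => (P i).borel) (fun i => (P i).subset) hP g hB hBU

end Tensor


/-! ### Evaluation functionals -/

section Dual

variable {m n : ℕ} {X Y : Type*} [TopologicalSpace X] [ChartedSpace (Fin (m + n) → ℂ) X]
  [TopologicalSpace Y] [ChartedSpace (Fin m → ℂ) Y] {p : X → Y}
  {M : X → Type*} [∀ x, AddCommGroup (M x)] [∀ x, Module ℂ (M x)] {𝓕 : MetrizedFrames M}

theorem l2NormSq_smul_le {y : Y} (u : ∀ x : p ⁻¹' {y}, RelForm m n p M x) {c : ℂ} (hc : c ≠ 0) :
    l2NormSq 𝓕 y (c • u) ≤ ENNReal.ofReal (‖c‖ ^ 2) * l2NormSq 𝓕 y u := by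
  refine iSup_le fun k => iSup_le fun P => iSup_le fun hP => ?_
  let Q : Fin k → LocalPiece 𝓕 y u := fun i =>
    { Φ := (P i).Φ, U := (P i).U, s := (P i).s, w := (P i).w, v := fun z => c⁻¹ * (P i).v z
      A := (P i).A
      frame := (P i).frame
      represents := fun x hx hxU => by
        have h := (P i).represents x hx hxU
        rw [Pi.smul_apply] at h
        rw [mul_smul, ← h, inv_smul_smul₀ hc]
      borel := (P i).borel
      subset := (P i).subset }
  have hm : ∀ i, (P i).mass = ENNReal.ofReal (‖c‖ ^ 2) * (Q i).mass := by
    intro i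
    rw [LocalPiece.mass, LocalPiece.mass, ← lintegral_const_mul' _ _ ENNReal.ofReal_ne_top]
    refine lintegral_congr fun z => ?_
    rw [← ENNReal.ofReal_mul (by positivity)]
    congr 1
    have hc' : ‖c‖ ≠ 0 := norm_ne_zero_iff.2 hc
    simp only [Q, norm_mul, norm_inv]
    field_simp
  simp_rw [hm]
  rw [← Finset.mul_sum]
  gcongr
  exact le_iSup_of_le k (le_iSup_of_le Q (le_iSup_of_le hP le_rfl))

theorem log_dualNorm_le {y : Y} (ξ : Module.Dual ℂ (fibreSections (m := m) (n := n) p 𝓕 y)) {I : ℝ}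
    (hI : 0 < I) (h : ∀ u : fibreSections (m := m) (n := n) p 𝓕 y,
      ENNReal.ofReal (‖ξ u‖ ^ 2 * I) ≤ l2NormSq 𝓕 y u.1) :
    ENNReal.log (dualNorm ξ) ≤ ((-(2⁻¹ * Real.log I) : ℝ) : EReal) := by
  have h1 : dualNorm ξ ≤ ENNReal.ofReal (Real.exp (-(2⁻¹ * Real.log I))) := by
    refine iSup_le fun u => iSup_le fun hu => ?_
    have h2 := (h u).trans hu
    rw [← ENNReal.ofReal_one, ENNReal.ofReal_le_ofReal_iff zero_le_one] at h2
    rw [← ofReal_norm]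
    refine ENNReal.ofReal_le_ofReal ?_
    rw [show -(2⁻¹ * Real.log I) = Real.log ((√I)⁻¹) by
      rw [Real.log_inv, Real.log_sqrt hI.le]; ring, Real.exp_log (by positivity)]
    rw [← one_div, le_div_iff₀ (by positivity)]
    refine le_of_sq_le_sq ?_ zero_le_one
    rw [mul_pow, Real.sq_sqrt hI.le]
    simpa using h2
  refine (ENNReal.log_monotone h1).trans (le_of_eq ?_)
  rw [ENNReal.log_ofReal_of_pos (Real.exp_pos _), Real.log_exp]

/-- Test the dual norm on `u / √K`. As in `log_dualNorm_le`, the factor `1/2` comes from passing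
between squared norms and norms. -/
theorem le_log_dualNorm {y : Y} (ξ : Module.Dual ℂ (fibreSections (m := m) (n := n) p 𝓕 y))
    {u : fibreSections (m := m) (n := n) p 𝓕 y} {K : ℝ} (hK : 0 < K)
    (hu : l2NormSq 𝓕 y u.1 ≤ ENNReal.ofReal K) (hξ : ξ u ≠ 0) :
    ((Real.log ‖ξ u‖ - 2⁻¹ * Real.log K : ℝ) : EReal) ≤ ENNReal.log (dualNorm ξ) := by
  have hξ' : 0 < ‖ξ u‖ := norm_pos_iff.2 hξ
  set c : ℂ := (((√K)⁻¹ : ℝ) : ℂ) with hc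
  have hc0 : 0 < (√K)⁻¹ := by positivity
  have hcn : ‖c‖ = (√K)⁻¹ := by rw [hc, Complex.norm_real, Real.norm_of_nonneg hc0.le]
  have h1 : ENNReal.ofReal (‖ξ u‖ * (√K)⁻¹) ≤ dualNorm ξ := by
    refine le_iSup_of_le (c • u) (le_iSup_of_le ?_ ?_)
    · refine (l2NormSq_smul_le u.1 (c := c) (by rw [← norm_pos_iff, hcn]; exact hc0)).trans ?_
      refine (mul_le_mul_right hu _).trans ?_
      rw [← ENNReal.ofReal_mul (by positivity), hcn, inv_pow, Real.sq_sqrt hK.le,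
        inv_mul_cancel₀ hK.ne', ENNReal.ofReal_one]
    · rw [map_smul, ← ofReal_norm, norm_smul, hcn, mul_comm]
  refine le_trans (le_of_eq ?_) (ENNReal.log_monotone h1)
  rw [ENNReal.log_ofReal_of_pos (by positivity), Real.log_mul hξ'.ne' hc0.ne', Real.log_inv,
    Real.log_sqrt hK.le]
  congr 1
  ring

theorem dualNorm_eq_zero_of_forall {y : Y}
    (ξ : Module.Dual ℂ (fibreSections (m := m) (n := n) p 𝓕 y)) (h : ∀ u, ξ u = 0) :
    dualNorm ξ = 0 := by
  simp [dualNorm, h]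

theorem PshOn.mono {k : ℕ} {f : (Fin k → ℂ) → EReal} {Ω Ω' : Set (Fin k → ℂ)} (hf : PshOn f Ω)
    (h : Ω' ⊆ Ω) : PshOn f Ω' :=
  ⟨hf.1.mono h, fun a ha => hf.2.1 a (h ha), fun a b hab => hf.2.2 a b fun ζ hζ => h (hab ζ hζ)⟩

variable [IsManifold 𝓘(ℂ, Fin (m + n) → ℂ) ω X] [IsManifold 𝓘(ℂ, Fin m → ℂ) ω Y]

theorem AdaptedChart.exists_coefficient_functional (Φ : AdaptedChart m n p) {x : X}
    (hx : x ∈ Φ.chart.source) {a : M x} (ha : a ≠ 0) :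
    ∃ ℓ : RelForm m n p M x →ₗ[ℂ] ℂ, ∀ c : ℂ, ℓ (c • Φ.dzTensor x a) = c := by
  obtain ⟨ξ, hξ, -⟩ := Φ.exists_vert_frame hx
  have hne : Φ.dzTensor x a ≠ 0 := by
    intro h0
    have h1 : (Φ.dz x ξ) • a = 0 := DFunLike.congr_fun h0 ξ
    rw [hξ, one_smul] at h1
    exact ha h1
  obtain ⟨f, hf⟩ := Module.Projective.exists_dual_ne_zero ℂ hne
  exact ⟨(f (Φ.dzTensor x a))⁻¹ • f, fun c => by simp [hf]⟩

/-- Evaluation along the section `t ↦ (t, z₀)` is a holomorphic section of the dual of the direct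
image. -/
theorem exists_evaluation (Φ : AdaptedChart m n p) {U : Set X} {s : ∀ x, M x} {w : X → ℝ}
    (hf : 𝓕 U s w) (hs : ∀ x ∈ U, s x ≠ 0) {z₀ : Fin n → ℂ} {D : Set (Fin m → ℂ)}
    (hD : ∀ t ∈ D, (t, z₀) ∈ Φ.chart.target ∧ Φ.chart.symm (t, z₀) ∈ U) :
    ∃ ξ : ∀ y, Module.Dual ℂ (fibreSections (m := m) (n := n) p 𝓕 y),
      HolDualSection ξ (Φ.base.source ∩ Φ.base ⁻¹' D) ∧
      ∀ y ∈ Φ.base.source ∩ Φ.base ⁻¹' D, ∀ (u : fibreSections (m := m) (n := n) p 𝓕 y) v,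
        Represents Φ U s y u.1 v → ξ y u = v z₀ := by
  classical
  set V := Φ.base.source ∩ Φ.base ⁻¹' D with hV
  set σ : Y → X := fun y => Φ.chart.symm (Φ.base y, z₀) with hσ
  have hσp : ∀ y ∈ V, p (σ y) = y := fun y hy => Φ.p_symm_eq hy.1 (hD _ hy.2).1
  have hσs : ∀ y ∈ V, σ y ∈ Φ.chart.source := fun y hy => Φ.chart.map_target (hD _ hy.2).1
  have hσU : ∀ y ∈ V, σ y ∈ U := fun y hy => (hD _ hy.2).2
  -- The functionals `ℓ x` extracting the coefficient are chosen independently at each point.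
  -- Holomorphy of `ξ` follows because, on a holomorphic section, they return its holomorphic
  -- coefficient function.
  have hℓ : ∀ x, ∃ ℓ : RelForm m n p M x →ₗ[ℂ] ℂ, x ∈ Φ.chart.source ∩ U →
      ∀ c : ℂ, ℓ (c • Φ.dzTensor x (s x)) = c := by
    intro x
    by_cases hx : x ∈ Φ.chart.source ∩ U
    · obtain ⟨ℓ, h⟩ := Φ.exists_coefficient_functional hx.1 (hs x hx.2)
      exact ⟨ℓ, fun _ => h⟩
    · exact ⟨0, fun h => absurd h hx⟩
  choose ℓ hℓ using hℓ
  let ξ : ∀ y, Module.Dual ℂ (fibreSections (m := m) (n := n) p 𝓕 y) := fun y =>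
    if hy : y ∈ V then
      (ℓ (σ y)) ∘ₗ (LinearMap.proj (⟨σ y, hσp y hy⟩ : p ⁻¹' {y})) ∘ₗ
        (fibreSections (m := m) (n := n) p 𝓕 y).subtype
    else 0
  have hξ : ∀ y (hy : y ∈ V) u, ξ y u = ℓ (σ y) (u.1 ⟨σ y, hσp y hy⟩) := by
    intro y hy u
    simp only [ξ, dif_pos hy]
    rfl
  refine ⟨ξ, ?_, ?_⟩
  · intro W hW hWV u hu
    obtain ⟨v, hv, hr⟩ := hu Φ U s w hf
    have hσh : ContMDiffOn 𝓘(ℂ, Fin m → ℂ) 𝓘(ℂ, Fin (m + n) → ℂ) ω σ W := by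
      have h1 : ContMDiffOn 𝓘(ℂ, Fin m → ℂ) 𝓘(ℂ, (Fin m → ℂ) × (Fin n → ℂ)) ω
          (fun y => (Φ.base y, z₀)) W := by
        have h2 : ContDiff ℂ ω fun t : Fin m → ℂ => (t, z₀) := by fun_prop
        exact h2.contMDiff.comp_contMDiffOn
          ((contMDiffOn_of_mem_maximalAtlas Φ.base_mem).mono fun y hy => (hWV hy).1)
      exact Φ.holo_symm.comp h1 fun y hy => (hD _ (hWV hy).2).1
    have hmaps : Set.MapsTo σ W (Φ.chart.source ∩ U ∩ p ⁻¹' W) := fun y hy =>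
      ⟨⟨hσs y (hWV hy), hσU y (hWV hy)⟩, by
        change p (σ y) ∈ W
        rw [hσp y (hWV hy)]; exact hy⟩
    refine (hv.comp hσh hmaps).congr fun y hy => ?_
    have hcast : ∀ (x : X) (y : Y) (h : p x = y), (u y).1 ⟨x, h⟩ = (u (p x)).1 ⟨x, rfl⟩ := by
      rintro x y rfl; rfl
    rw [hξ y (hWV hy), hcast, hr _ (hmaps hy), hℓ _ (hmaps hy).1]
    rfl
  · intro y hy u v hv
    rw [hξ y hy, hv ⟨σ y, hσp y hy⟩ (hσs y hy) (hσU y hy), hℓ _ ⟨hσs y hy, hσU y hy⟩]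
    simp [hσ, Φ.chart.right_inv (hD _ hy.2).1]

theorem GriffithsSemiPositive.exists_psh_evaluation (hG : GriffithsSemiPositive m n p 𝓕)
    (Φ : AdaptedChart m n p) {U : Set X} {s : ∀ x, M x} {w : X → ℝ}
    (hf : 𝓕 U s w) (hs : ∀ x ∈ U, s x ≠ 0) {z₀ : Fin n → ℂ} {D : Set (Fin m → ℂ)} (hDo : IsOpen D)
    (hD : ∀ t ∈ D, (t, z₀) ∈ Φ.chart.target ∧ Φ.chart.symm (t, z₀) ∈ U) :
    ∃ ξ : ∀ y, Module.Dual ℂ (fibreSections (m := m) (n := n) p 𝓕 y),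
      PshOn (fun t => ENNReal.log (dualNorm (ξ (Φ.base.symm t)))) D ∧
      ∀ t ∈ D, ∀ (u : fibreSections (m := m) (n := n) p 𝓕 (Φ.base.symm t)) v,
        Represents Φ U s (Φ.base.symm t) u.1 v → ξ _ u = v z₀ := by
  obtain ⟨ξ, hξ, hev⟩ := exists_evaluation Φ hf hs hD
  have ht : ∀ t ∈ D, t ∈ Φ.base.target := fun t ht => by
    have := Φ.base.map_source (Φ.p_mem_source (hD t ht).1)
    rwa [Φ.base_fst (hD t ht).1] at this
  have hmem : ∀ t ∈ D, Φ.base.symm t ∈ Φ.base.source ∩ Φ.base ⁻¹' D := fun t h => by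
    refine ⟨Φ.base.map_target (ht t h), ?_⟩
    rw [Set.mem_preimage, Φ.base.right_inv (ht t h)]; exact h
  refine ⟨ξ, ?_, fun t h => hev _ (hmem t h)⟩
  exact (hG _ (Φ.base.isOpen_inter_preimage hDo) ξ hξ Φ.base Φ.base_mem).mono
    fun t h => ⟨ht t h, hmem t h⟩

end Dual


/-! ### Line bundles on projective manifolds -/

section RestrictScalars

theorem contMDiffAt_real {E F X Z : Type*} [NormedAddCommGroup E] [NormedSpace ℂ E]
    [NormedAddCommGroup F] [NormedSpace ℂ F] [TopologicalSpace X] [ChartedSpace E X]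
    [TopologicalSpace Z] [ChartedSpace F Z] {f : X → Z} {x : X}
    (h : ContMDiffAt 𝓘(ℂ, E) 𝓘(ℂ, F) ω f x) : ContMDiffAt 𝓘(ℝ, E) 𝓘(ℝ, F) ∞ f x := by
  rw [contMDiffAt_iff] at h ⊢
  exact ⟨h.1, (h.2.restrict_scalars ℝ).of_le (by simp)⟩

end RestrictScalars

/-! ### Subharmonicity of logarithms of sums of squares. -/

section LogSumSq

/-- `log (∑ |f_j|²)^N - log |g|²` is subharmonic. -/
theorem laplacian_neg_log_quotient_nonneg {ι : Type*} [Fintype ι] {f : ι → ℂ → ℂ} {g : ℂ → ℂ}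
    (hf : ∀ j, AnalyticAt ℂ (f j) 0) (hg : AnalyticAt ℂ g 0) (hg0 : g 0 ≠ 0)
    (hf0 : ∃ j, f j 0 ≠ 0) (N : ℕ) :
    0 ≤ Laplacian.laplacian
      (fun w => -Real.log (‖g w‖ ^ 2 / (∑ j, ‖f j w‖ ^ 2) ^ N)) 0 := by
  set S : ℂ → ℝ := fun w => ∑ j, ‖f j w‖ ^ 2 with hS
  have hS0 : 0 < S 0 := by
    obtain ⟨j, hj⟩ := hf0
    exact Finset.sum_pos' (fun _ _ => by positivity) ⟨j, Finset.mem_univ j, by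
      have := norm_pos_iff.2 hj; positivity⟩
  have hfr : ∀ j, ContDiffAt ℝ 2 (f j) 0 := fun j => (hf j).contDiffAt.restrict_scalars ℝ
  have hgr : ContDiffAt ℝ 2 g 0 := hg.contDiffAt.restrict_scalars ℝ
  have hSc : ContDiffAt ℝ 2 S 0 := ContDiffAt.sum fun j _ => (hfr j).norm_sq ℝ
  set φ : ℂ → ℝ := fun w => -Real.log (‖g w‖ ^ 2 / S w ^ N) with hφ
  have hφc : ContDiffAt ℝ 2 φ 0 :=
    (((hgr.norm_sq ℝ).div (hSc.pow N) (pow_pos hS0 N).ne').log (by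
      exact (div_pos (pow_pos (norm_pos_iff.2 hg0) 2) (pow_pos hS0 N)).ne')).neg
  -- By Cauchy–Schwarz, `|q(w)|² ≤ S(0) S(w)` with equality at `0`. Hence `ψ = N log |q|² - log |g|²
  -- - N log S(0)` is harmonic near `0`, lies below `φ` and touches it at `0`; the minimum of `φ -
  -- ψ` gives the sign of the Laplacian without computing the Hessian of `log S`.
  set q : ℂ → ℂ := fun w => ∑ j, conj (f j 0) * f j w with hq
  have hqa : AnalyticAt ℂ q 0 := by
    have : q = ∑ j, fun w => conj (f j 0) * f j w := by ext w; simp [hq]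
    rw [this]
    exact Finset.analyticAt_sum _ fun j _ => analyticAt_const.mul (hf j)
  have hq0 : q 0 = ((S 0 : ℝ) : ℂ) := by
    simp only [hq, hS, Complex.ofReal_sum]
    refine Finset.sum_congr rfl fun j _ => ?_
    rw [mul_comm, Complex.mul_conj']
    push_cast; rfl
  have hq0' : q 0 ≠ 0 := by rw [hq0]; exact_mod_cast hS0.ne'
  have hCS : ∀ w, ‖q w‖ ^ 2 ≤ S 0 * S w := by
    intro w
    have h1 : ‖q w‖ ≤ ∑ j, ‖f j 0‖ * ‖f j w‖ := by
      refine (norm_sum_le _ _).trans (le_of_eq (Finset.sum_congr rfl fun j _ => ?_))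
      rw [norm_mul, RCLike.norm_conj]
    calc ‖q w‖ ^ 2 ≤ (∑ j, ‖f j 0‖ * ‖f j w‖) ^ 2 := by gcongr
      _ ≤ S 0 * S w := Finset.sum_mul_sq_le_sq_mul_sq _ _ _
  set ψ : ℂ → ℝ := (2 * (N : ℝ)) • (fun w => Real.log ‖q w‖) + (-2 : ℝ) • (fun w => Real.log ‖g w‖)
    + (fun _ => -(N * Real.log (S 0))) with hψ
  have hψh : InnerProductSpace.HarmonicAt ψ 0 :=
    (((hqa.harmonicAt_log_norm hq0').const_smul).add
      ((hg.harmonicAt_log_norm hg0).const_smul)).add (InnerProductSpace.harmonicAt_const _)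
  have hψe : ∀ w, ψ w = 2 * N * Real.log ‖q w‖ - 2 * Real.log ‖g w‖ - N * Real.log (S 0) := by
    intro w; simp [hψ]; ring
  have hSnear : ∀ᶠ w in 𝓝 (0 : ℂ), 0 < S w := hSc.continuousAt.eventually (eventually_gt_nhds hS0)
  have hgnear : ∀ᶠ w in 𝓝 (0 : ℂ), g w ≠ 0 := hg.continuousAt.eventually_ne hg0
  have hqnear : ∀ᶠ w in 𝓝 (0 : ℂ), q w ≠ 0 := hqa.continuousAt.eventually_ne hq0'
  have hφe : ∀ w, 0 < S w → g w ≠ 0 → φ w = N * Real.log (S w) - 2 * Real.log ‖g w‖ := by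
    intro w h1 h2
    simp only [hφ]
    rw [Real.log_div (by positivity) (by positivity), Real.log_pow, Real.log_pow]
    push_cast; ring
  have hmin : IsLocalMin (φ - ψ) 0 := by
    have h0 : (φ - ψ) 0 = 0 := by
      rw [Pi.sub_apply, hφe 0 hS0 hg0, hψe, hq0, Complex.norm_real, Real.norm_of_nonneg hS0.le]
      ring
    filter_upwards [hSnear, hgnear, hqnear] with w h1 h2 h3
    rw [h0, Pi.sub_apply, hφe w h1 h2, hψe]
    have h4 := Real.log_le_log (by positivity) (hCS w)
    rw [Real.log_pow, Real.log_mul hS0.ne' h1.ne'] at h4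
    push_cast at h4
    have h5 : (0 : ℝ) ≤ N := by positivity
    nlinarith
  have h1 := hessTrace_nonneg_of_isLocalMin (hφc.sub hψh.1) hmin
  have h2 := laplacian_line (φ := φ - ψ) (z := (0 : ℂ)) 1 (hφc.sub hψh.1)
  simp only [zero_add, smul_eq_mul, mul_one] at h2
  have h3 : Laplacian.laplacian (φ - ψ) 0 = Laplacian.laplacian φ 0 - Laplacian.laplacian ψ 0 :=
    hφc.laplacian_sub hψh.1
  have h4 : Laplacian.laplacian ψ 0 = 0 := hψh.2.self_of_nhds
  have h5 : (fun w : ℂ => (φ - ψ) w) = φ - ψ := rfl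
  rw [h5, h3, h4, sub_zero] at h2
  rw [h2]
  exact h1

end LogSumSq

/-! ### The pull-back of `𝒪(k)` and metrics given by systems of homogeneous functions. -/

section PowerBundle

variable {d N : ℕ} {X : Type*} [TopologicalSpace X] [ChartedSpace (Fin d → ℂ) X]

/-- `v x` are homogeneous coordinates of a holomorphic map to projective space: locally, `v` is a
nowhere vanishing multiple of a nowhere vanishing holomorphic map. -/
def IsHomogeneousLift (d : ℕ) {X : Type*} [TopologicalSpace X] [ChartedSpace (Fin d → ℂ) X]
    (v : X → Fin (N + 1) → ℂ) : Prop :=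
  ∀ x, ∃ (U : Set X) (F : X → Fin (N + 1) → ℂ), IsOpen U ∧ x ∈ U ∧
    ContMDiffOn 𝓘(ℂ, Fin d → ℂ) 𝓘(ℂ, Fin (N + 1) → ℂ) ω F U ∧
    ∀ x' ∈ U, F x' ≠ 0 ∧ ∃ c : ℂ, c ≠ 0 ∧ v x' = c • F x'

variable {v : X → Fin (N + 1) → ℂ}

theorem IsHomogeneousLift.ne_zero (hv : IsHomogeneousLift d v) (x : X) : v x ≠ 0 := by
  obtain ⟨U, F, -, hx, -, h⟩ := hv x
  obtain ⟨hF, c, hc, e⟩ := h x hx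
  rw [e]
  exact smul_ne_zero hc hF

/-- Homogeneous functions of degree `0` of the homogeneous coordinates are holomorphic. -/
theorem IsHomogeneousLift.contMDiffAt (hv : IsHomogeneousLift d v) {G : Type*}
    [NormedAddCommGroup G] [NormedSpace ℂ G] {R : (Fin (N + 1) → ℂ) → G}
    (hR : ∀ (c : ℂ) a, c ≠ 0 → R (c • a) = R a) {x : X}
    (hx : ∀ c : ℂ, c ≠ 0 → ContDiffAt ℂ ω R (c • v x)) :
    ContMDiffAt 𝓘(ℂ, Fin d → ℂ) 𝓘(ℂ, G) ω (fun x => R (v x)) x := by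
  obtain ⟨U, F, hU, hxU, hF, h⟩ := hv x
  obtain ⟨-, c, hc, e⟩ := h x hxU
  have hFx : F x = c⁻¹ • v x := by rw [e, inv_smul_smul₀ hc]
  have h1 : ContDiffAt ℂ ω R (F x) := by rw [hFx]; exact hx _ (inv_ne_zero hc)
  have h2 : ContMDiffAt 𝓘(ℂ, Fin d → ℂ) 𝓘(ℂ, G) ω (fun x => R (F x)) x :=
    h1.contMDiffAt.comp x ((hF x hxU).contMDiffAt (hU.mem_nhds hxU))
  refine h2.congr_of_eventuallyEq ?_
  filter_upwards [hU.mem_nhds hxU] with x' hx'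
  obtain ⟨-, c', hc', e'⟩ := h x' hx'
  rw [e', hR _ _ hc']

theorem IsHomogeneousLift.isOpen_ne_zero (hv : IsHomogeneousLift d v) (i : Fin (N + 1)) :
    IsOpen {x | v x i ≠ 0} := by
  rw [isOpen_iff_mem_nhds]
  intro x hx
  obtain ⟨U, F, hU, hxU, hF, h⟩ := hv x
  have hiff : ∀ x' ∈ U, (v x' i ≠ 0 ↔ F x' i ≠ 0) := by
    intro x' hx'
    obtain ⟨-, c, hc, e⟩ := h x' hx'
    rw [e]; simp [hc]
  have hcont : ContinuousAt (fun x => F x i) x :=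
    (continuous_apply i).continuousAt.comp (hF.continuousOn.continuousAt (hU.mem_nhds hxU))
  filter_upwards [hU.mem_nhds hxU, hcont.eventually_ne ((hiff x hxU).1 hx)] with x' hx' hne
  exact (hiff x' hx').2 hne

theorem IsHomogeneousLift.contMDiffAt_ratio (hv : IsHomogeneousLift d v) (i j : Fin (N + 1)) {x : X}
    (hx : v x j ≠ 0) :
    ContMDiffAt 𝓘(ℂ, Fin d → ℂ) 𝓘(ℂ, ℂ) ω (fun x => v x i / v x j) x := by
  refine hv.contMDiffAt (R := fun a => a i / a j) (fun c a hc => ?_) fun c hc => ?_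
  · simp only [Pi.smul_apply, smul_eq_mul]; rw [mul_div_mul_left _ _ hc]
  · have h1 : (c • v x) j ≠ 0 := by simp [hc, hx]
    exact (contDiff_apply ℂ ℂ i).contDiffAt.div (contDiff_apply ℂ ℂ j).contDiffAt h1

open Classical in
/-- The line bundle whose holomorphic sections over an open set are the functions of the homogeneous
coordinates that are homogeneous of degree `k`, i.e. the pull-back of `𝒪(k)`. -/
def powerCore (hv : IsHomogeneousLift d v) (k : ℕ) : VectorBundleCore ℂ X ℂ (Fin (N + 1)) where
  baseSet i := {x | v x i ≠ 0}
  isOpen_baseSet := hv.isOpen_ne_zero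
  indexAt x := (Function.ne_iff.1 (hv.ne_zero x)).choose
  mem_baseSet_at x := (Function.ne_iff.1 (hv.ne_zero x)).choose_spec
  -- A homogeneous function `P` of degree `k` has coordinate `P / v_i^k` in the `i`-th
  -- trivialisation.
  coordChange i j x := ((v x i / v x j) ^ k) • ContinuousLinearMap.id ℂ ℂ
  coordChange_self i x hx a := by
    have hx : v x i ≠ 0 := hx
    simp [div_self hx]
  continuousOn_coordChange i j := by
    intro x hx
    exact (((hv.contMDiffAt_ratio i j hx.2).continuousAt.pow k).smul
      continuousAt_const).continuousWithinAt
  coordChange_comp i j l x hx a := by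
    have h1 : v x j ≠ 0 := hx.1.2
    simp only [_root_.smul_apply, ContinuousLinearMap.id_apply, smul_eq_mul]
    rw [← mul_assoc, ← mul_pow, mul_comm (v x j / v x l), div_mul_div_cancel₀ h1]

instance (hv : IsHomogeneousLift d v) (k : ℕ) :
    (powerCore hv k).IsContMDiff 𝓘(ℂ, Fin d → ℂ) ω where
  contMDiffOn_coordChange i j := by
    intro x hx
    have h := (hv.contMDiffAt_ratio i j hx.2).pow k
    exact (h.smul contMDiffAt_const).contMDiffWithinAt

/-- The pull-back of `𝒪(k)`. -/
abbrev PowerBundle (hv : IsHomogeneousLift d v) (k : ℕ) : X → Type := (powerCore hv k).Fiber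

/-- The section of `𝒪(k)` given by a homogeneous function `P` of degree `k`. -/
def powerSection (hv : IsHomogeneousLift d v) (k : ℕ) (P : (Fin (N + 1) → ℂ) → ℂ) (x : X) :
    PowerBundle hv k x :=
  (P (v x) / v x ((powerCore hv k).indexAt x) ^ k : ℂ)

theorem coordinate_indexAt_ne_zero (hv : IsHomogeneousLift d v) (k : ℕ) (x : X) :
    v x ((powerCore hv k).indexAt x) ≠ 0 := (powerCore hv k).mem_baseSet_at x

theorem localTriv_snd (hv : IsHomogeneousLift d v) (k : ℕ) (i : Fin (N + 1)) (x : X)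
    (a : PowerBundle hv k x) :
    (((powerCore hv k).localTriv i) ⟨x, a⟩).2 =
      (v x ((powerCore hv k).indexAt x) / v x i) ^ k * (show ℂ from a) := rfl

theorem isHolSectionOn_powerSection (hv : IsHomogeneousLift d v) {k : ℕ}
    {P : (Fin (N + 1) → ℂ) → ℂ} (hP : ContDiff ℂ ω P) (hPk : ∀ (c : ℂ) a, P (c • a) = c ^ k * P a) :
    IsHolSectionOn d (powerSection hv k P) Set.univ := by
  intro x _
  set i := (powerCore hv k).indexAt x with hi
  have hxi : v x i ≠ 0 := coordinate_indexAt_ne_zero hv k x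
  have hmem : x ∈ ((powerCore hv k).localTriv i).baseSet := hxi
  have : MemTrivializationAtlas ((powerCore hv k).localTriv i) := ⟨⟨i, rfl⟩⟩
  refine ((Trivialization.contMDiffAt_section_iff (IB := 𝓘(ℂ, Fin d → ℂ)) (n := ω)
    ((powerCore hv k).localTriv i) hmem).2 ?_).contMDiffWithinAt
  have h1 : ContMDiffAt 𝓘(ℂ, Fin d → ℂ) 𝓘(ℂ, ℂ) ω (fun x => P (v x) / v x i ^ k) x := by
    refine hv.contMDiffAt (R := fun a => P a / a i ^ k) (fun c a hc => ?_) fun c hc => ?_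
    · rw [hPk, Pi.smul_apply, smul_eq_mul, mul_pow, mul_div_mul_left _ _ (pow_ne_zero k hc)]
    · have h1 : (c • v x) i ^ k ≠ 0 := by simp [hc, hxi]
      exact hP.contDiffAt.div ((contDiff_apply ℂ ℂ i).pow k).contDiffAt h1
  refine h1.congr_of_eventuallyEq ?_
  filter_upwards with x'
  have h2 := coordinate_indexAt_ne_zero hv k x'
  rw [localTriv_snd]
  change _ * (P (v x') / _ ^ k) = _
  rw [div_pow]
  field_simp

variable {ι : Type*} [Fintype ι]

/-- A system of homogeneous functions of degree `K` without common zeros. -/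
structure BasePointFree (N K : ℕ) (h : ι → (Fin (N + 1) → ℂ) → ℂ) : Prop where
  contDiff : ∀ j, ContDiff ℂ ω (h j)
  homogeneous : ∀ j (c : ℂ) a, h j (c • a) = c ^ K * h j a
  exists_ne_zero : ∀ a, a ≠ 0 → ∃ j, h j a ≠ 0

variable {K : ℕ} {h : ι → (Fin (N + 1) → ℂ) → ℂ}

theorem BasePointFree.sum_pos (hh : BasePointFree N K h) {a : Fin (N + 1) → ℂ} (ha : a ≠ 0) :
    0 < ∑ j, ‖h j a‖ ^ 2 := by
  obtain ⟨j, hj⟩ := hh.exists_ne_zero a ha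
  exact Finset.sum_pos' (fun _ _ => by positivity) ⟨j, Finset.mem_univ j, by
    have := norm_pos_iff.2 hj; positivity⟩

theorem BasePointFree.sum_smul (hh : BasePointFree N K h) (c : ℂ) (a : Fin (N + 1) → ℂ) :
    ∑ j, ‖h j (c • a)‖ ^ 2 = (‖c‖ ^ K) ^ 2 * ∑ j, ‖h j a‖ ^ 2 := by
  rw [Finset.mul_sum]
  refine Finset.sum_congr rfl fun j _ => ?_
  rw [hh.homogeneous, norm_mul, norm_pow, mul_pow]

/-- The metric is defined through the preferred trivialisation at `x`, whose index may jump with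
`x`. Rewritten in a fixed trivialisation it is `|g|² / (∑ |f_j|²)^{N'}` with `f_j` holomorphic, and
`g` holomorphic for a holomorphic section: the form needed for smoothness and for curvature. -/
theorem powerBundle_normSq_local (hv : IsHomogeneousLift d v) (hh : BasePointFree N K h) (N' : ℕ)
    (i : Fin (N + 1)) {x : X} (hx : v x i ≠ 0) (a : PowerBundle hv (K * N') x) :
    ‖(show ℂ from a)‖ ^ 2 * ((‖v x ((powerCore hv (K * N')).indexAt x)‖ ^ (K * N')) ^ 2 /
        (∑ j, ‖h j (v x)‖ ^ 2) ^ N') =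
      ‖(((powerCore hv (K * N')).localTriv i) ⟨x, a⟩).2‖ ^ 2 /
        (∑ j, ‖h j ((v x i)⁻¹ • v x)‖ ^ 2) ^ N' := by
  have h0 := hh.sum_pos (hv.ne_zero x)
  have hx' : ‖v x i‖ ≠ 0 := norm_ne_zero_iff.2 hx
  rw [localTriv_snd, hh.sum_smul, norm_mul, norm_pow, norm_div, norm_inv]
  simp only [inv_pow, div_pow, mul_pow, ← pow_mul]
  field_simp
  ring_nf

/-- The Hermitian form `a, b ↦ r ā b` on `ℂ`. -/
def scalarForm (r : ℝ) : ℂ →ₗ⋆[ℂ] ℂ →ₗ[ℂ] ℂ :=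
  LinearMap.mk₂'ₛₗ (starRingEnd ℂ) (RingHom.id ℂ) (fun a b : ℂ => conj a * b * (r : ℂ))
    (fun a a' b => by simp only [map_add]; ring)
    (fun c a b => by simp only [smul_eq_mul, map_mul]; ring)
    (fun a b b' => by ring)
    (fun c a b => by simp only [smul_eq_mul, RingHom.id_apply]; ring)

theorem scalarForm_apply (r : ℝ) (a b : ℂ) : scalarForm r a b = conj a * b * (r : ℂ) := rfl

theorem scalarForm_self_re (r : ℝ) (a : ℂ) : (scalarForm r a a).re = ‖a‖ ^ 2 * r := by
  rw [scalarForm_apply, mul_comm (conj _), Complex.mul_conj', ← Complex.ofReal_pow,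
    ← Complex.ofReal_mul, Complex.ofReal_re]

/-- The density of the metric on `𝒪(K N')` in the trivialisation at `x`. -/
def powerDensity (hv : IsHomogeneousLift d v) (K : ℕ) (h : ι → (Fin (N + 1) → ℂ) → ℂ) (N' : ℕ)
    (x : X) : ℝ :=
  (‖v x ((powerCore hv (K * N')).indexAt x)‖ ^ (K * N')) ^ 2 / (∑ j, ‖h j (v x)‖ ^ 2) ^ N'

theorem contMDiffAt_localTriv_snd (hv : IsHomogeneousLift d v) (k : ℕ) {U : Set X}
    {s : ∀ x, PowerBundle hv k x} (hs : IsHolFrame d (PowerBundle hv k) U s) {i : Fin (N + 1)}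
    {x : X} (hx : x ∈ U) (hxi : v x i ≠ 0) :
    ContMDiffAt 𝓘(ℂ, Fin d → ℂ) 𝓘(ℂ, ℂ) ω
      (fun x => (((powerCore hv k).localTriv i) ⟨x, s x⟩).2) x := by
  have hmem : x ∈ ((powerCore hv k).localTriv i).baseSet := hxi
  have : MemTrivializationAtlas ((powerCore hv k).localTriv i) := ⟨⟨i, rfl⟩⟩
  exact (Trivialization.contMDiffAt_section_iff (IB := 𝓘(ℂ, Fin d → ℂ)) (n := ω)
    ((powerCore hv k).localTriv i) hmem).1 ((hs.2.2 x hx).contMDiffAt (hs.1.mem_nhds hx))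

theorem BasePointFree.contMDiffAt (hh : BasePointFree N K h) (hv : IsHomogeneousLift d v)
    (j : ι) {i : Fin (N + 1)} {x : X} (hxi : v x i ≠ 0) :
    ContMDiffAt 𝓘(ℂ, Fin d → ℂ) 𝓘(ℂ, ℂ) ω (fun x => h j ((v x i)⁻¹ • v x)) x := by
  refine hv.contMDiffAt (R := fun a => h j ((a i)⁻¹ • a)) (fun c a hc => ?_) fun c hc => ?_
  · congr 1
    rw [Pi.smul_apply, smul_eq_mul, smul_smul]
    congr 1
    field_simp
  · have h1 : (c • v x) i ≠ 0 := by simp [hc, hxi]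
    exact (hh.contDiff j).contDiffAt.comp (c • v x)
      (((contDiff_apply ℂ ℂ i).contDiffAt.inv h1).smul contDiffAt_id)

/-- The metric on `𝒪(K N')` for which `|P|² = |P(v)|² / (∑ |h_j(v)|²)^{N'}`. -/
def powerMetric [IsManifold 𝓘(ℂ, Fin d → ℂ) ω X]
    (hv : IsHomogeneousLift d v) (hh : BasePointFree N K h) (N' : ℕ) :
    HermitianMetric d (PowerBundle hv (K * N')) where
  form x := scalarForm (powerDensity hv K h N' x)
  conj_form x a b := by
    change conj (scalarForm _ (show ℂ from a) (show ℂ from b)) =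
      scalarForm _ (show ℂ from b) (show ℂ from a)
    have h1 : ∀ r (a b : ℂ), conj (scalarForm r a b) = scalarForm r b a := by
      intro r a b
      simp only [scalarForm_apply, map_mul, Complex.conj_conj, Complex.conj_ofReal]
      ring
    exact h1 _ _ _
  form_pos x a ha := by
    have h0 := hh.sum_pos (hv.ne_zero x)
    have h1 : 0 < ‖v x ((powerCore hv (K * N')).indexAt x)‖ :=
      norm_pos_iff.2 (coordinate_indexAt_ne_zero hv _ x)
    have h2 : 0 < ‖(show ℂ from a)‖ := norm_pos_iff.2 ha
    change 0 < (scalarForm _ (show ℂ from a) (show ℂ from a)).re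
    rw [scalarForm_self_re, powerDensity]
    positivity
  smooth U s hs x hx := by
    have hxi := coordinate_indexAt_ne_zero hv (K * N') x
    set i := (powerCore hv (K * N')).indexAt x with hi
    have hS : 0 < ∑ j, ‖h j ((v x i)⁻¹ • v x)‖ ^ 2 :=
      hh.sum_pos (smul_ne_zero (inv_ne_zero hxi) (hv.ne_zero x))
    have h1 := contMDiffAt_real (contMDiffAt_localTriv_snd hv (K * N') hs hx hxi)
    have hn : ContDiff ℝ ∞ (fun a : ℂ => ‖a‖ ^ 2) := contDiff_id.norm_sq ℝ
    have h2 : ContMDiffAt 𝓘(ℝ, Fin d → ℂ) 𝓘(ℝ, ℝ) ∞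
        (fun x => ∑ j, ‖h j ((v x i)⁻¹ • v x)‖ ^ 2) x :=
      ContMDiffAt.sum fun j _ => hn.contDiffAt.contMDiffAt.comp x
        (contMDiffAt_real (hh.contMDiffAt hv j hxi))
    have h3 := (hn.contDiffAt.contMDiffAt.comp x h1).div₀ (h2.pow N') (pow_pos hS N').ne'
    refine (h3.congr_of_eventuallyEq ?_).contMDiffWithinAt
    filter_upwards [(hv.isOpen_ne_zero i).mem_nhds hxi] with x' hx'
    change (scalarForm _ (show ℂ from s x') (show ℂ from s x')).re = _
    rw [scalarForm_self_re]
    exact powerBundle_normSq_local hv hh N' i hx' (s x')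

section Metric

variable [IsManifold 𝓘(ℂ, Fin d → ℂ) ω X] (hv : IsHomogeneousLift d v) (hh : BasePointFree N K h)
  (N' : ℕ)

theorem powerMetric_normSq {i : Fin (N + 1)} {x : X} (hx : v x i ≠ 0)
    (a : PowerBundle hv (K * N') x) :
    (powerMetric hv hh N').normSq x a = ‖(((powerCore hv (K * N')).localTriv i) ⟨x, a⟩).2‖ ^ 2 /
        (∑ j, ‖h j ((v x i)⁻¹ • v x)‖ ^ 2) ^ N' := by
  rw [← powerBundle_normSq_local hv hh N' i hx a]
  exact scalarForm_self_re _ _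

theorem powerMetric_normSq_powerSection (P : (Fin (N + 1) → ℂ) → ℂ) (x : X) :
    (powerMetric hv hh N').normSq x (powerSection hv (K * N') P x) =
      ‖P (v x)‖ ^ 2 / (∑ j, ‖h j (v x)‖ ^ 2) ^ N' := by
  have h1 : 0 < ‖v x ((powerCore hv (K * N')).indexAt x)‖ :=
    norm_pos_iff.2 (coordinate_indexAt_ne_zero hv _ x)
  refine (scalarForm_self_re _ _).trans ?_
  rw [powerSection, powerDensity, norm_div, norm_pow]
  field_simp

theorem powerMetric_semiPositive : (powerMetric hv hh N').SemiPositive := by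
  intro U s hs c hc z hz hzU a
  have hxi := coordinate_indexAt_ne_zero hv (K * N') (c.symm z)
  set x := c.symm z with hx
  set i := (powerCore hv (K * N')).indexAt x with hi
  have hcs : ContMDiffAt 𝓘(ℂ, Fin d → ℂ) 𝓘(ℂ, Fin d → ℂ) ω c.symm z :=
    contMDiffOn_symm_of_mem_maximalAtlas hc |>.contMDiffAt (c.open_target.mem_nhds hz)
  have hline : AnalyticAt ℂ (fun w : ℂ => z + w • a) 0 :=
    analyticAt_const.add (analyticAt_id.smul analyticAt_const)
  have hcomp : ∀ f : X → ℂ, ContMDiffAt 𝓘(ℂ, Fin d → ℂ) 𝓘(ℂ, ℂ) ω f x →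
      AnalyticAt ℂ (fun w : ℂ => f (c.symm (z + w • a))) 0 := by
    intro f hf
    have h1 : ContDiffAt ℂ ω (fun z => f (c.symm z)) z :=
      (ContMDiffAt.comp z hf hcs).contDiffAt
    have h2 : ContDiffAt ℂ ω (fun w : ℂ => z + w • a) 0 := hline.contDiffAt
    have h3 : ContDiffAt ℂ ω (fun z => f (c.symm z)) ((fun w : ℂ => z + w • a) 0) := by
      simpa using h1
    exact (h3.comp (0 : ℂ) h2).analyticAt
  have hS : ∃ j, h j ((v x i)⁻¹ • v x) ≠ 0 :=
    hh.exists_ne_zero _ (smul_ne_zero (inv_ne_zero hxi) (hv.ne_zero x))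
  have hg0 : (((powerCore hv (K * N')).localTriv i) ⟨x, s x⟩).2 ≠ 0 := by
    rw [localTriv_snd]
    exact mul_ne_zero (pow_ne_zero _ (div_ne_zero hxi hxi)) (hs.2.1 x hzU)
  have hz0 : z + (0 : ℂ) • a = z := by simp
  have key := laplacian_neg_log_quotient_nonneg
    (f := fun j w => h j ((v (c.symm (z + w • a)) i)⁻¹ • v (c.symm (z + w • a))))
    (g := fun w => (((powerCore hv (K * N')).localTriv i)
      ⟨c.symm (z + w • a), s (c.symm (z + w • a))⟩).2)
    (fun j => hcomp _ (hh.contMDiffAt hv j hxi))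
    (hcomp _ (contMDiffAt_localTriv_snd hv (K * N') hs hzU hxi))
    (by rw [hz0]; exact hg0) (by rw [hz0]; exact hS) N'
  have hcont : ContinuousAt (fun w : ℂ => c.symm (z + w • a)) 0 := by
    have h1 : ContinuousAt c.symm ((fun w : ℂ => z + w • a) 0) := by
      simpa using hcs.continuousAt
    exact ContinuousAt.comp (f := fun w : ℂ => z + w • a) h1 hline.continuousAt
  have hnear : ∀ᶠ w in 𝓝 (0 : ℂ), v (c.symm (z + w • a)) i ≠ 0 :=
    hcont.eventually_mem ((hv.isOpen_ne_zero i).mem_nhds (by simpa using hxi))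
  have hEq : (fun w : ℂ => -Real.log ((powerMetric hv hh N').normSq (c.symm (z + w • a))
      (s (c.symm (z + w • a))))) =ᶠ[𝓝 0] fun w =>
      -Real.log (‖(((powerCore hv (K * N')).localTriv i)
      ⟨c.symm (z + w • a), s (c.symm (z + w • a))⟩).2‖ ^ 2 /
      (∑ j, ‖h j ((v (c.symm (z + w • a)) i)⁻¹ • v (c.symm (z + w • a)))‖ ^ 2) ^ N') := by
    filter_upwards [hnear] with w hw
    rw [powerMetric_normSq hv hh N' hw]
  have hlap := (InnerProductSpace.laplacian_congr_nhds hEq).self_of_nhds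
  rw [leviForm]
  refine mul_nonneg (by norm_num) ?_
  rw [hlap]
  exact key

end Metric

end PowerBundle

/-! ### Homogeneous coordinates of a projective embedding. -/

section Projective

variable {d : ℕ} {X : Type*} [TopologicalSpace X] [ChartedSpace (Fin d → ℂ) X]

/-- The system of degree `0` that yields the trivial line bundle with its flat metric. -/
theorem basePointFree_one (N : ℕ) : BasePointFree N 0 (fun (_ : Unit) _ => (1 : ℂ)) where
  contDiff _ := contDiff_const
  homogeneous _ c a := by simp
  exists_ne_zero a _ := ⟨(), one_ne_zero⟩

/-- Homogeneous coordinates on a projective manifold, with the embedding property expressed in local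
holomorphic homogeneous coordinates. -/
theorem IsProjective.exists_lift (hX : IsProjective d X) :
    ∃ (N : ℕ) (v : X → Fin (N + 1) → ℂ), IsHomogeneousLift d v ∧
      (∀ x x' (c : ℂ), v x' = c • v x → x' = x) ∧
      ∀ x, ∃ (U : Set X) (F : X → Fin (N + 1) → ℂ), IsOpen U ∧ x ∈ U ∧
        ContMDiffOn 𝓘(ℂ, Fin d → ℂ) 𝓘(ℂ, Fin (N + 1) → ℂ) ω F U ∧
        (∀ x' ∈ U, F x' ≠ 0 ∧ ∃ c : ℂ, c ≠ 0 ∧ v x' = c • F x') ∧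
        ∀ a : TangentSpace 𝓘(ℂ, Fin d → ℂ) x,
          (mfderiv 𝓘(ℂ, Fin d → ℂ) 𝓘(ℂ, Fin (N + 1) → ℂ) F x a : Fin (N + 1) → ℂ) ∈
            Submodule.span ℂ {F x} → a = 0 := by
  obtain ⟨-, N, f, hinj, hf⟩ := hX
  have hloc : ∀ x, ∃ (U : Set X) (F : X → Fin (N + 1) → ℂ), IsOpen U ∧ x ∈ U ∧
        ContMDiffOn 𝓘(ℂ, Fin d → ℂ) 𝓘(ℂ, Fin (N + 1) → ℂ) ω F U ∧
        (∀ x' ∈ U, F x' ≠ 0 ∧ ∃ c : ℂ, c ≠ 0 ∧ (f x').rep = c • F x') ∧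
        ∀ a : TangentSpace 𝓘(ℂ, Fin d → ℂ) x,
          (mfderiv 𝓘(ℂ, Fin d → ℂ) 𝓘(ℂ, Fin (N + 1) → ℂ) F x a : Fin (N + 1) → ℂ) ∈
            Submodule.span ℂ {F x} → a = 0 := by
    intro x
    obtain ⟨U, F, hU, hxU, hF, hFf, hd⟩ := hf x
    refine ⟨U, F, hU, hxU, hF, fun x' hx' => ?_, hd⟩
    obtain ⟨hne, e⟩ := hFf x' hx'
    obtain ⟨c, hc⟩ := Projectivization.exists_smul_eq_mk_rep ℂ (F x') hne
    exact ⟨hne, c, c.ne_zero, by rw [e]; exact hc.symm⟩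
  -- The representatives are arbitrary choices and need not vary continuously; only their local
  -- proportionality to the holomorphic `F` is used.
  refine ⟨N, fun x => (f x).rep, fun x => ?_, fun x x' c hc => ?_, hloc⟩
  · obtain ⟨U, F, hU, hxU, hF, h, -⟩ := hloc x
    exact ⟨U, F, hU, hxU, hF, h⟩
  · apply hinj
    rw [← Projectivization.mk_rep (f x'), ← Projectivization.mk_rep (f x),
      Projectivization.mk_eq_mk_iff']
    exact ⟨c, hc.symm⟩

end Projective


/-! ### Density of the set where the fibrewise sections do not vanish -/

section Density

variable {m n : ℕ} {X Y : Type*} [TopologicalSpace X] [ChartedSpace (Fin (m + n) → ℂ) X]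
  [TopologicalSpace Y] [ChartedSpace (Fin m → ℂ) Y] {p : X → Y}

theorem AdaptedChart.base_symm_eq (Φ : AdaptedChart m n p) {t : Fin m → ℂ} {z : Fin n → ℂ}
    (h : (t, z) ∈ Φ.chart.target) : Φ.base.symm t = p (Φ.chart.symm (t, z)) := by
  have h1 := Φ.base_fst h
  simp only at h1
  conv_lhs => rw [← h1]
  exact Φ.base.left_inv (Φ.p_mem_source h)

theorem AdaptedChart.base_right_inv (Φ : AdaptedChart m n p) {t : Fin m → ℂ} {z : Fin n → ℂ}
    (h : (t, z) ∈ Φ.chart.target) : Φ.base (Φ.base.symm t) = t := by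
  rw [Φ.base_symm_eq h, Φ.base_fst h]

theorem AdaptedChart.mem_slice_symm (Φ : AdaptedChart m n p) {t : Fin m → ℂ} {z : Fin n → ℂ}
    (h : (t, z) ∈ Φ.chart.target) {A : Set X} (hA : Φ.chart.symm (t, z) ∈ A) :
    z ∈ Φ.slice (Φ.base.symm t) A := by
  refine ⟨?_, ?_, ?_⟩ <;> rw [Φ.base_right_inv h]
  · exact h
  · exact (Φ.base_symm_eq h).symm
  · exact hA

variable {M : X → Type*} [∀ x, AddCommGroup (M x)] [∀ x, Module ℂ (M x)]
  [IsManifold 𝓘(ℂ, Fin (m + n) → ℂ) ω X] [IsManifold 𝓘(ℂ, Fin m → ℂ) ω Y]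

theorem Represents.apply_eq_zero_iff {Φ : AdaptedChart m n p} {U : Set X} {s : ∀ x, M x} {y : Y}
    {u : ∀ x : p ⁻¹' {y}, RelForm m n p M x} {v : (Fin n → ℂ) → ℂ} (h : Represents Φ U s y u v)
    {x : X} (hxy : p x = y) (hx : x ∈ Φ.chart.source) (hxU : x ∈ U) (hs : s x ≠ 0) :
    u ⟨x, hxy⟩ = 0 ↔ v (Φ.chart x).2 = 0 := by
  obtain ⟨ℓ, hℓ⟩ := Φ.exists_coefficient_functional hx hs
  rw [h ⟨x, hxy⟩ hx hxU]
  constructor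
  · intro h0
    have h1 := hℓ (v (Φ.chart x).2)
    rw [← h1]
    exact (congrArg ℓ h0).trans (map_zero ℓ)
  · intro h0
    simp only [h0, zero_smul]

theorem Represents.symm_apply_eq_zero_iff {Φ : AdaptedChart m n p} {U : Set X} {s : ∀ x, M x}
    {t : Fin m → ℂ} {z : Fin n → ℂ} {u : ∀ x : p ⁻¹' {Φ.base.symm t}, RelForm m n p M x}
    {v : (Fin n → ℂ) → ℂ} (h : Represents Φ U s (Φ.base.symm t) u v)
    (ht : (t, z) ∈ Φ.chart.target) (hxU : Φ.chart.symm (t, z) ∈ U)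
    (hs : s (Φ.chart.symm (t, z)) ≠ 0) :
    u ⟨Φ.chart.symm (t, z), (Φ.base_symm_eq ht).symm⟩ = 0 ↔ v z = 0 := by
  rw [h.apply_eq_zero_iff (Φ.base_symm_eq ht).symm (Φ.chart.map_target ht) hxU hs,
    Φ.chart.right_inv ht]

variable {L : X → Type*} [TopologicalSpace (TotalSpace ℂ L)] [∀ x, AddCommGroup (L x)]
  [∀ x, Module ℂ (L x)] [∀ x, TopologicalSpace (L x)] [FiberBundle ℂ L] [VectorBundle ℂ ℂ L]
  [ContMDiffVectorBundle ω ℂ L 𝓘(ℂ, Fin (m + n) → ℂ)] {hL : HermitianMetric (m + n) L}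

variable (p hL) in
/-- The points at which all sections of `K_{X_y} ⊗ L` on the fibre through the point vanish. -/
def fibreBaseLocus : Set X :=
  {x | ∀ y, ∀ u ∈ fibreSections (m := m) (n := n) p (lineFrames hL) y, ∀ hxy : p x = y,
    u ⟨x, hxy⟩ = 0}

variable {E : X → Type*} [TopologicalSpace (TotalSpace ℂ E)] [∀ x, AddCommGroup (E x)]
  [∀ x, Module ℂ (E x)] [∀ x, TopologicalSpace (E x)] [FiberBundle ℂ E] [VectorBundle ℂ ℂ E]
  [ContMDiffVectorBundle ω ℂ E 𝓘(ℂ, Fin (m + n) → ℂ)] {hE : HermitianMetric (m + n) E}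

/-- Apply positivity to evaluation along `t ↦ (t, z)`. Near `b` all sections vanish on an open part
of the fibre, hence at `z` by the identity theorem, so `log ‖ξ_t‖ = -∞` there and, by
plurisubharmonicity, at `c`. A section not vanishing at `(c, z)` would contradict this, because its
`L²` norm is finite. The nowhere zero section `σ` of `E` only serves to identify sections of `L ⊗ E`
with sections of `L`. -/
theorem fibreBaseLocus_of_ball [CompactSpace X] [T2Space Y]
    (hp : Manifold.IsSubmersion 𝓘(ℂ, Fin (m + n) → ℂ) 𝓘(ℂ, Fin m → ℂ) ω p)
    {σ : ∀ x, E x} (hσ : IsHolFrame (m + n) E Set.univ σ) (hσ1 : ∀ x, hE.normSq x (σ x) ≤ 1)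
    (hG : GriffithsSemiPositive m n p (tensorFrames hL hE)) (Φ : AdaptedChart m n p) {U : Set X}
    {s : ∀ x, L x} (hs : IsHolFrame (m + n) L U s) {t₀ : Fin m → ℂ} {z₀ : Fin n → ℂ} {r : ℝ}
    (hball : ∀ t ∈ Metric.ball t₀ (3 * r), ∀ z ∈ Metric.ball z₀ r,
      (t, z) ∈ Φ.chart.target ∧ Φ.chart.symm (t, z) ∈ U)
    {b : Fin m → ℂ} {z₁ : Fin n → ℂ} (hb : b ∈ Metric.ball t₀ r) (hz₁ : z₁ ∈ Metric.ball z₀ r)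
    (hint : ∀ᶠ q in 𝓝 (b, z₁), Φ.chart.symm q ∈ fibreBaseLocus p hL)
    {c : Fin m → ℂ} {z : Fin n → ℂ} (hc : c ∈ Metric.ball t₀ r) (hz : z ∈ Metric.ball z₀ r) :
    Φ.chart.symm (c, z) ∈ fibreBaseLocus p hL := by
  have hr : 0 < r := by
    by_contra h
    rw [Metric.ball_eq_empty.2 (not_lt.1 h)] at hc
    exact hc
  have hsub : Metric.ball t₀ r ⊆ Metric.ball t₀ (3 * r) := Metric.ball_subset_ball (by linarith)
  have hσL : IsHolSectionOn (m + n) σ Set.univ := hσ.2.2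
  have hfL : lineFrames hL U s (fun x => hL.normSq x (s x)) := hs.lineFrames
  have hfE : lineFrames hE U σ (fun x => hE.normSq x (σ x)) :=
    (hσ.mono hs.1 (Set.subset_univ _)).lineFrames
  have hf : tensorFrames hL hE U (fun x => s x ⊗ₜ[ℂ] σ x)
      (fun x => hL.normSq x (s x) * hE.normSq x (σ x)) :=
    ⟨s, _, σ, _, hfL, hfE, fun x _ => ⟨rfl, rfl⟩⟩
  obtain ⟨ξ, hpsh, hev⟩ := hG.exists_psh_evaluation Φ hf
    (fun x hx => tmul_ne_zero (hs.2.1 x hx) (hσ.2.1 x trivial)) (z₀ := z) Metric.isOpen_ball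
    (fun t ht => hball t ht z hz)
  have hrep : ∀ y (u : ∀ x : p ⁻¹' {y}, RelForm m n p L x) (v : (Fin n → ℂ) → ℂ),
      Represents Φ U s y u v →
      Represents Φ U (fun x => s x ⊗ₜ[ℂ] σ x) y (tensorSection u σ) v := by
    intro y u v hv
    have := hv.tensorSection (s₂ := σ) (σ := σ) (c := fun _ => 1)
      (s := fun x => s x ⊗ₜ[ℂ] σ x) (fun x _ => by simp) (fun x _ => rfl)
    simpa using this
  have hbot : ∀ᶠ t in 𝓝 b, ENNReal.log (dualNorm (ξ (Φ.base.symm t))) = ⊥ := by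
    filter_upwards [hint.curry_nhds, Metric.isOpen_ball.mem_nhds (hsub hb)] with t ht htb
    rw [dualNorm_eq_zero_of_forall, ENNReal.log_zero]
    intro u
    obtain ⟨u₀, hu₀, e⟩ := exists_eq_tensorSection u.2 hσL fun x => hσ.2.1 x trivial
    obtain ⟨v, hv, hr⟩ := hu₀ Φ U s _ hfL
    rw [hev t htb u v (e ▸ hrep _ _ _ hr)]
    have hzs : Metric.ball z₀ r ⊆ Φ.slice (Φ.base.symm t) U := fun z hz =>
      Φ.mem_slice_symm (hball t htb z hz).1 (hball t htb z hz).2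
    have hva : AnalyticOnNhd ℂ v (Metric.ball z₀ r) :=
      Metric.isOpen_ball.analyticOn_iff_analyticOnNhd.1 (hv.mono hzs).analyticOn
    refine hva.eqOn_zero_of_preconnected_of_eventuallyEq_zero
      (convex_ball _ _).isPreconnected hz₁ ?_ hz
    filter_upwards [ht, Metric.isOpen_ball.mem_nhds hz₁] with z' hz' hzb
    have h1 := hball t htb z' hzb
    exact (hr.symm_apply_eq_zero_iff h1.1 h1.2 (hs.2.1 _ h1.2)).1 (hz' _ u₀ hu₀ _)
  have hcbot := hpsh.eq_bot_of_eventually_eq_bot hb hc hbot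
  have hcz := hball c (hsub hc) z hz
  intro y u hu hy
  rw [← Φ.base_symm_eq hcz.1] at hy
  subst hy
  obtain ⟨v, hv, hr⟩ := hu Φ U s _ hfL
  refine (hr.symm_apply_eq_zero_iff hcz.1 hcz.2 (hs.2.1 _ hcz.2)).2 ?_
  by_contra hv0
  set u' : fibreSections (m := m) (n := n) p (tensorFrames hL hE) (Φ.base.symm c) :=
    ⟨tensorSection u σ, tensorSection_mem hu hσL⟩ with hu'
  have hξ : ξ _ u' = v z := hev c (hsub hc) u' v (hrep _ _ _ hr)
  -- With `B = ∅` the splitting of the norm reduces to the bound `|σ|² ≤ 1` on the whole fibre.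
  have hlt : l2NormSq (tensorFrames hL hE) (Φ.base.symm c) u'.1 < ⊤ := by
    refine (l2NormSq_tensorSection_le hu hσL Φ hfL hr (B := ∅) (@MeasurableSet.empty X (borel X))
      (Set.empty_subset _) ENNReal.one_ne_top fun x _ => ?_).trans_lt ?_
    · rw [← ENNReal.ofReal_one]; exact ENNReal.ofReal_le_ofReal (hσ1 x)
    · rw [one_mul]
      refine ENNReal.add_lt_top.2 ⟨?_, l2NormSq_lineFrames_lt_top hp hu⟩
      simp [AdaptedChart.weightedMass, AdaptedChart.slice]
  have h1 := le_log_dualNorm (ξ _) (u := u')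
    (K := (l2NormSq (tensorFrames hL hE) (Φ.base.symm c) u'.1).toReal + 1) (by positivity)
    ((ENNReal.ofReal_toReal hlt.ne).symm.le.trans (ENNReal.ofReal_le_ofReal (by linarith)))
    (by rw [hξ]; exact hv0)
  rw [hcbot, le_bot_iff] at h1
  exact EReal.coe_ne_bot _ h1

/-- The interior of the base locus is closed: around a limit point `x₀`, a product of balls meets
the interior and so, by `fibreBaseLocus_of_ball`, lies in the locus. By connectedness the interior
is empty or all of `X`, and a non-zero section on one fibre excludes the latter. -/
theorem dense_compl_fibreBaseLocus [CompactSpace X] [ConnectedSpace X] [T2Space Y]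
    (hp : Manifold.IsSubmersion 𝓘(ℂ, Fin (m + n) → ℂ) 𝓘(ℂ, Fin m → ℂ) ω p)
    {σ : ∀ x, E x} (hσ : IsHolFrame (m + n) E Set.univ σ) (hσ1 : ∀ x, hE.normSq x (σ x) ≤ 1)
    (hG : GriffithsSemiPositive m n p (tensorFrames hL hE))
    (hne : ∃ y : Y, fibreSections (m := m) (n := n) p (lineFrames hL) y ≠ ⊥) :
    Dense (fibreBaseLocus p hL)ᶜ := by
  rw [← interior_eq_empty_iff_dense_compl]
  have hclosed : IsClosed (interior (fibreBaseLocus p hL)) := by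
    refine isClosed_of_closure_subset fun x₀ hx₀ => ?_
    obtain ⟨Φ, hΦ⟩ := exists_adaptedChart hp x₀
    obtain ⟨U, s, hxU, hs⟩ := exists_isHolFrame (d := m + n) (L := L) x₀
    have hO : Φ.chart.target ∩ Φ.chart.symm ⁻¹' U ∈ 𝓝 (Φ.chart x₀) :=
      (Φ.chart.symm.isOpen_inter_preimage hs.1).mem_nhds
        ⟨Φ.chart.map_source hΦ, by rw [Set.mem_preimage, Φ.chart.left_inv hΦ]; exact hxU⟩
    obtain ⟨ε, hε, hball⟩ := Metric.mem_nhds_iff.1 hO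
    set t₀ := (Φ.chart x₀).1
    set z₀ := (Φ.chart x₀).2
    have hball' : ∀ t ∈ Metric.ball t₀ (3 * (ε / 3)), ∀ z ∈ Metric.ball z₀ (ε / 3),
        (t, z) ∈ Φ.chart.target ∧ Φ.chart.symm (t, z) ∈ U := by
      intro t ht z hz
      refine hball ?_
      rw [← Prod.mk.eta (p := Φ.chart x₀), ← ball_prod_same]
      exact ⟨by rwa [mul_div_cancel₀ _ (three_ne_zero)] at ht,
        Metric.ball_subset_ball (by linarith) hz⟩
    set W := Φ.chart.source ∩ Φ.chart ⁻¹' (Metric.ball t₀ (ε / 3) ×ˢ Metric.ball z₀ (ε / 3)) with hW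
    have hWo : IsOpen W :=
      Φ.chart.isOpen_inter_preimage (Metric.isOpen_ball.prod Metric.isOpen_ball)
    have hxW : x₀ ∈ W := ⟨hΦ, Metric.mem_ball_self (by positivity),
      Metric.mem_ball_self (by positivity)⟩
    obtain ⟨x₁, hx₁W, hx₁⟩ := mem_closure_iff.1 hx₀ W hWo hxW
    refine mem_interior.2 ⟨W, fun x hx => ?_, hWo, hxW⟩
    rw [← Φ.chart.left_inv hx.1]
    refine fibreBaseLocus_of_ball hp hσ hσ1 hG Φ hs hball' hx₁W.2.1 hx₁W.2.2 ?_ hx.2.1 hx.2.2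
    have h1 : ContinuousAt Φ.chart.symm (Φ.chart x₁) :=
      Φ.chart.continuousAt_symm (Φ.chart.map_source hx₁W.1)
    refine h1.eventually_mem ?_
    rw [Φ.chart.left_inv hx₁W.1]
    exact mem_interior_iff_mem_nhds.1 hx₁
  rcases isClopen_iff.1 ⟨hclosed, isOpen_interior⟩ with h | h
  · exact h
  · exfalso
    obtain ⟨y, hy⟩ := hne
    obtain ⟨u, hu, hu0⟩ := Submodule.exists_mem_ne_zero_of_ne_bot hy
    refine hu0 (funext fun x => ?_)
    have : (x : X) ∈ interior (fibreBaseLocus p hL) := h ▸ trivial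
    exact interior_subset this y u hu x.2

end Density


/-! ### Coordinates given by ratios of homogeneous coordinates -/

section Analytic

variable {E : Type*} [NormedAddCommGroup E] [NormedSpace ℂ E]

theorem exists_isLittleO_of_analyticAt {γ : ℂ → E} (h : AnalyticAt ℂ γ 0) :
    ∃ b : E, (fun ζ => γ ζ - (γ 0 + ζ • deriv γ 0 + ζ ^ 2 • b)) =o[𝓝 0] fun ζ => ‖ζ‖ ^ 2 := by
  obtain ⟨p, hp⟩ := h
  refine ⟨p.coeff 2, ?_⟩
  have h1 := hp.isBigO_sub_partialSum_pow 3
  have h2 : (fun y : ℂ => ‖y‖ ^ 3) =o[𝓝 0] fun ζ : ℂ => ‖ζ‖ ^ 2 :=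
    Asymptotics.isLittleO_norm_pow_norm_pow (by norm_num)
  refine (h1.trans_isLittleO h2).congr_left fun ζ => ?_
  have hd : deriv γ 0 = p.coeff 1 := hp.deriv
  have h0 : γ 0 = p.coeff 0 := (hp.coeff_zero _).symm
  rw [zero_add, hd, h0]
  simp [FormalMultilinearSeries.partialSum, Finset.sum_range_succ]

/-- Inverse function theorem, with the source shrunk to an open set on which both the map and its
local inverse are analytic. -/
theorem exists_openPartialHomeomorph_of_hasFDerivAt [CompleteSpace E] {f : E → E} {a : E}
    (hf : ContDiffAt ℂ ω f a) (f' : E ≃L[ℂ] E) (hf' : HasFDerivAt f (f' : E →L[ℂ] E) a) :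
    ∃ T : OpenPartialHomeomorph E E, a ∈ T.source ∧ (∀ x, T x = f x) ∧
      ContDiffOn ℂ ω T T.source ∧ ContDiffOn ℂ ω T.symm T.target := by
  have hω : (ω : WithTop ℕ∞) ≠ 0 := by simp
  set T₀ := hf.toOpenPartialHomeomorph f hf' hω with hT₀
  have ha : a ∈ T₀.source := hf.mem_toOpenPartialHomeomorph_source hf' hω
  have h1 : AnalyticAt ℂ T₀.symm (f a) := (hf.to_localInverse hf' hω).analyticAt
  have h2 : ∀ᶠ x in 𝓝 a, AnalyticAt ℂ f x ∧ AnalyticAt ℂ T₀.symm (f x) :=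
    hf.analyticAt.eventually_analyticAt.and
      (hf.continuousAt.eventually h1.eventually_analyticAt)
  obtain ⟨S, hS, hSo, haS⟩ := eventually_nhds_iff.1 h2
  refine ⟨T₀.restrOpen S hSo, ⟨ha, haS⟩, fun x => rfl, fun x hx => ?_, fun x hx => ?_⟩
  · exact (hS x hx.2).1.contDiffAt.contDiffWithinAt
  · have h3 := (hS _ hx.2).2
    have h4 : f (T₀.symm x) = x := T₀.right_inv hx.1
    rw [h4] at h3
    exact h3.contDiffAt.contDiffWithinAt

end Analytic

/-- The map `(α, β, ζ) ↦ α b + β w + ℓ ζ` is injective; `l` and `q` are components of a left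
inverse. -/
theorem exists_projection {V : Type*} [AddCommGroup V] [Module ℂ V] {n : ℕ} (b w : V)
    (ℓ : (Fin n → ℂ) →ₗ[ℂ] V)
    (hinj : ∀ (α β : ℂ) ζ, α • b + β • w + ℓ ζ = 0 → α = 0 ∧ β = 0 ∧ ζ = 0) :
    ∃ (l : V →ₗ[ℂ] ℂ) (q : V →ₗ[ℂ] (Fin n → ℂ)), l b = 1 ∧ q b = 0 ∧ q w = 0 ∧
      ∀ ζ, q (ℓ ζ) = ζ := by
  let J : ((ℂ × ℂ) × (Fin n → ℂ)) →ₗ[ℂ] V :=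
    ((LinearMap.toSpanSingleton ℂ V b).coprod (LinearMap.toSpanSingleton ℂ V w)).coprod ℓ
  have hJ : ∀ α β ζ, J ((α, β), ζ) = α • b + β • w + ℓ ζ := fun α β ζ => by simp [J]
  have hker : LinearMap.ker J = ⊥ := by
    rw [LinearMap.ker_eq_bot']
    rintro ⟨⟨α, β⟩, ζ⟩ h
    rw [hJ] at h
    obtain ⟨rfl, rfl, rfl⟩ := hinj α β ζ h
    rfl
  obtain ⟨R, hR⟩ := J.exists_leftInverse_of_injective hker
  have hR' : ∀ x, R (J x) = x := fun x => LinearMap.congr_fun hR x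
  have hb : R b = ((1, 0), 0) := by rw [← hR' ((1, 0), 0), hJ]; simp
  have hw : R w = ((0, 1), 0) := by rw [← hR' ((0, 1), 0), hJ]; simp
  refine ⟨LinearMap.fst ℂ ℂ ℂ ∘ₗ LinearMap.fst ℂ (ℂ × ℂ) (Fin n → ℂ) ∘ₗ R,
    LinearMap.snd ℂ (ℂ × ℂ) (Fin n → ℂ) ∘ₗ R, ?_, ?_, ?_, fun ζ => ?_⟩
  · simp [hb]
  · simp [hb]
  · simp [hw]
  · have : R (ℓ ζ) = ((0, 0), ζ) := by rw [← hR' ((0, 0), ζ), hJ]; simp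
    simp [this]

/-! ### Adapted coordinates from linear forms on projective space. -/

section Coordinates

variable {m n N : ℕ} {X Y : Type*} [TopologicalSpace X] [ChartedSpace (Fin (m + n) → ℂ) X]
  [TopologicalSpace Y] [ChartedSpace (Fin m → ℂ) Y] {p : X → Y}
  [IsManifold 𝓘(ℂ, Fin (m + n) → ℂ) ω X] [IsManifold 𝓘(ℂ, Fin m → ℂ) ω Y]

theorem AdaptedChart.fderiv_comp_symm_mem_span (Φ : AdaptedChart m n p) {x₀ : X}
    (hx : x₀ ∈ Φ.chart.source) {F : X → Fin (N + 1) → ℂ}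
    (hF : ContMDiffAt 𝓘(ℂ, Fin (m + n) → ℂ) 𝓘(ℂ, Fin (N + 1) → ℂ) ω F x₀)
    (himm : ∀ a : TangentSpace 𝓘(ℂ, Fin (m + n) → ℂ) x₀,
          (mfderiv 𝓘(ℂ, Fin (m + n) → ℂ) 𝓘(ℂ, Fin (N + 1) → ℂ) F x₀ a : Fin (N + 1) → ℂ) ∈
            Submodule.span ℂ {F x₀} → a = 0) (ξ : (Fin m → ℂ) × (Fin n → ℂ))
    (hξ : fderiv ℂ (F ∘ Φ.chart.symm) (Φ.chart x₀) ξ ∈ Submodule.span ℂ {F x₀}) : ξ = 0 := by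
  have e : Φ.chart.symm (Φ.chart x₀) = x₀ := Φ.chart.left_inv hx
  have hFd : MDifferentiableAt 𝓘(ℂ, Fin (m + n) → ℂ) 𝓘(ℂ, Fin (N + 1) → ℂ) F
      (Φ.chart.symm (Φ.chart x₀)) := by rw [e]; exact hF.mdifferentiableAt (by simp)
  have h1 := mfderiv_comp (Φ.chart x₀) hFd (Φ.mdifferentiableAt_symm (Φ.chart.map_source hx))
  rw [← mfderiv_eq_fderiv, h1] at hξ
  have h2 := himm (mfderiv 𝓘(ℂ, (Fin m → ℂ) × (Fin n → ℂ)) 𝓘(ℂ, Fin (m + n) → ℂ) Φ.chart.symm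
    (Φ.chart x₀) ξ) (by rw [e] at hξ; exact hξ)
  have h3 := Φ.mfderiv_chart_symm hx ξ
  rw [h2] at h3
  exact h3.symm.trans (map_zero _)

/-- Near `x₀`, there are adapted coordinates `(t, w)` such that `w` is a ratio of linear functions of
the homogeneous coordinates and such that `w = 0` is tangent to a given non-vertical vector. -/
theorem AdaptedChart.exists_projective_coordinates (Φ : AdaptedChart m n p) {x₀ : X}
    (hx : x₀ ∈ Φ.chart.source) {U : Set X} (hU : IsOpen U) (hxU : x₀ ∈ U)
    {v F : X → Fin (N + 1) → ℂ}
    (hF : ContMDiffOn 𝓘(ℂ, Fin (m + n) → ℂ) 𝓘(ℂ, Fin (N + 1) → ℂ) ω F U)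
    (hvF : ∀ x ∈ U, F x ≠ 0 ∧ ∃ c : ℂ, c ≠ 0 ∧ v x = c • F x)
    (himm : ∀ a : TangentSpace 𝓘(ℂ, Fin (m + n) → ℂ) x₀,
          (mfderiv 𝓘(ℂ, Fin (m + n) → ℂ) 𝓘(ℂ, Fin (N + 1) → ℂ) F x₀ a : Fin (N + 1) → ℂ) ∈
            Submodule.span ℂ {F x₀} → a = 0)
    {c : OpenPartialHomeomorph X (Fin (m + n) → ℂ)}
    (hc : c ∈ IsManifold.maximalAtlas 𝓘(ℂ, Fin (m + n) → ℂ) ω X) (hxc : x₀ ∈ c.source)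
    {a : Fin (m + n) → ℂ} (ha : (fderiv ℂ (Φ.chart ∘ c.symm) (c x₀) a).1 ≠ 0) :
    ∃ (Ψ : AdaptedChart m n p) (l : (Fin (N + 1) → ℂ) →ₗ[ℂ] ℂ)
      (q : (Fin (N + 1) → ℂ) →ₗ[ℂ] (Fin n → ℂ)) (aY : Fin m → ℂ),
      x₀ ∈ Ψ.chart.source ∧ (Ψ.chart x₀).2 = 0 ∧
      (∀ x ∈ Ψ.chart.source, l (v x) ≠ 0 ∧ (Ψ.chart x).2 = (l (v x))⁻¹ • q (v x)) ∧
      ContDiffAt ℂ ω (fun ζ : ℂ => c (Ψ.chart.symm ((Ψ.chart x₀).1 + ζ • aY, 0))) 0 ∧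
      deriv (fun ζ : ℂ => c (Ψ.chart.symm ((Ψ.chart x₀).1 + ζ • aY, 0))) 0 = a := by
  set q₀ := Φ.chart x₀ with hq₀
  have hq₀t : q₀ ∈ Φ.chart.target := Φ.chart.map_source hx
  have e₀ : Φ.chart.symm q₀ = x₀ := Φ.chart.left_inv hx
  set G : (Fin m → ℂ) × (Fin n → ℂ) → Fin (N + 1) → ℂ := F ∘ Φ.chart.symm with hG
  have hFx : ContMDiffAt 𝓘(ℂ, Fin (m + n) → ℂ) 𝓘(ℂ, Fin (N + 1) → ℂ) ω F x₀ :=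
    (hF x₀ hxU).contMDiffAt (hU.mem_nhds hxU)
  have hsymm : ∀ q ∈ Φ.chart.target, ContMDiffAt 𝓘(ℂ, (Fin m → ℂ) × (Fin n → ℂ))
      𝓘(ℂ, Fin (m + n) → ℂ) ω Φ.chart.symm q := fun q hq =>
    (Φ.holo_symm q hq).contMDiffAt (Φ.chart.open_target.mem_nhds hq)
  have hGc : ContDiffAt ℂ ω G q₀ :=
    (ContMDiffAt.comp q₀ (by rw [e₀]; exact hFx) (hsymm q₀ hq₀t)).contDiffAt
  set b := F x₀ with hb
  have hGq₀ : G q₀ = b := by rw [hG, Function.comp, e₀]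
  have hb0 : b ≠ 0 := (hvF x₀ hxU).1
  set DG := fderiv ℂ G q₀ with hDG
  have hDG' : HasFDerivAt G DG q₀ := (hGc.differentiableAt (by simp)).hasFDerivAt
  have hspan : ∀ ξ, DG ξ ∈ Submodule.span ℂ {b} → ξ = 0 :=
    Φ.fderiv_comp_symm_mem_span hx hFx himm
  set a₁ := fderiv ℂ (Φ.chart ∘ c.symm) (c x₀) a with ha₁
  -- Independence holds because the embedding is immersive modulo `b` and `a₁` is not vertical. Thus
  -- `q` can be made to vanish on `b` and on the image of `a₁`, and to invert the derivative along
  -- the fibre.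
  obtain ⟨l, q, hlb, hqb, hqa, hqv⟩ := exists_projection b (DG a₁)
    (DG.toLinearMap ∘ₗ LinearMap.inr ℂ (Fin m → ℂ) (Fin n → ℂ)) (by
      intro α β ζ h
      have h1 : DG (β • a₁ + (0, ζ)) = -(α • b) := by
        rw [map_add, map_smul]
        refine eq_neg_of_add_eq_zero_left ?_
        rw [← h, LinearMap.comp_apply, LinearMap.inr_apply]
        simp only [ContinuousLinearMap.coe_coe]
        abel
      have h2 := hspan _ (by
        rw [h1]; exact Submodule.neg_mem _ (Submodule.smul_mem _ _ (Submodule.mem_span_singleton_self b)))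
      have h3 : β • a₁.1 = 0 := by simpa using congrArg Prod.fst h2
      have hβ : β = 0 := (smul_eq_zero.1 h3).resolve_right ha
      have hζ : ζ = 0 := by simpa [hβ] using congrArg Prod.snd h2
      rw [hβ, hζ] at h1
      have h4 : α • b = 0 := by
        rw [← neg_eq_zero, ← h1, zero_smul, zero_add]
        exact map_zero DG
      exact ⟨(smul_eq_zero.1 h4).resolve_right hb0, hβ, hζ⟩)
  set lc := LinearMap.toContinuousLinearMap l with hlc
  set qc := LinearMap.toContinuousLinearMap q with hqc
  set f : (Fin m → ℂ) × (Fin n → ℂ) → (Fin m → ℂ) × (Fin n → ℂ) :=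
    fun x => (x.1, (lc (G x))⁻¹ • qc (G x)) with hf
  have hlG : lc (G q₀) = 1 := by rw [hGq₀]; exact hlb
  have hqG : qc (G q₀) = 0 := by rw [hGq₀]; exact hqb
  have hlGc : ContDiffAt ℂ ω (fun x => lc (G x)) q₀ := lc.contDiff.contDiffAt.comp q₀ hGc
  have hqGc : ContDiffAt ℂ ω (fun x => qc (G x)) q₀ := qc.contDiff.contDiffAt.comp q₀ hGc
  have hfc : ContDiffAt ℂ ω f q₀ := by
    refine contDiffAt_fst.prodMk ((hlGc.inv ?_).smul hqGc)
    rw [hlG]; exact one_ne_zero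
  set A : ((Fin m → ℂ) × (Fin n → ℂ)) →L[ℂ] (Fin n → ℂ) := qc ∘L DG with hA
  have hAv : ∀ ζ, A (0, ζ) = ζ := hqv
  have hAa : A a₁ = 0 := hqa
  have hAd : ∀ ξ, A ξ = A (ξ.1, 0) + ξ.2 := fun ξ => by
    conv_rhs => rw [← hAv ξ.2, ← map_add]
    simp
  -- Since `q(G q₀) = 0` and `l(G q₀) = 1`, the derivative of `1 / l` drops out and the fibre
  -- component has derivative `A = q ∘ DG`. As `A` is the identity on vertical vectors, the whole
  -- derivative is block triangular and invertible.
  have hfd : HasFDerivAt f ((ContinuousLinearMap.fst ℂ _ _).prod A) q₀ := by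
    refine hasFDerivAt_fst.prodMk ?_
    have h1 : HasFDerivAt (fun x => (lc (G x))⁻¹) (fderiv ℂ (fun x => (lc (G x))⁻¹) q₀) q₀ :=
      ((hlGc.inv (by rw [hlG]; exact one_ne_zero)).differentiableAt (by simp)).hasFDerivAt
    have h2 : HasFDerivAt (fun x => qc (G x)) (qc ∘L DG) q₀ := qc.hasFDerivAt.comp q₀ hDG'
    have h3 := h1.smul h2
    rw [hlG, hqG] at h3
    refine h3.congr_fderiv ?_
    refine ContinuousLinearMap.ext fun ξ => ?_
    change (1 : ℂ)⁻¹ • A ξ + (_ : ℂ) • (0 : Fin n → ℂ) = A ξ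
    rw [inv_one, one_smul, smul_zero, add_zero]
  let f' : ((Fin m → ℂ) × (Fin n → ℂ)) ≃L[ℂ] ((Fin m → ℂ) × (Fin n → ℂ)) :=
    ContinuousLinearEquiv.equivOfInverse ((ContinuousLinearMap.fst ℂ _ _).prod A)
      ((ContinuousLinearMap.fst ℂ _ _).prod (ContinuousLinearMap.snd ℂ _ _ -
        A ∘L (ContinuousLinearMap.inl ℂ _ _) ∘L (ContinuousLinearMap.fst ℂ _ _)))
      (fun ξ => by
        refine Prod.ext rfl ?_
        simp [hAd ξ])
      (fun ξ => by
        refine Prod.ext rfl ?_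
        simp only [ContinuousLinearMap.prod_apply]
        rw [hAd]
        simp)
  obtain ⟨T₀, hq₀T₀, hT₀f, hT₀, hT₀'⟩ := exists_openPartialHomeomorph_of_hasFDerivAt hfc f' hfd
  have hS : {x | lc (G x) ≠ 0 ∧ x ∈ Φ.chart.target ∧ Φ.chart.symm x ∈ U} ∈ 𝓝 q₀ := by
    have h1 : ∀ᶠ x in 𝓝 q₀, Φ.chart.symm x ∈ U := by
      refine (hsymm q₀ hq₀t).continuousAt.eventually_mem ?_
      rw [e₀]; exact hU.mem_nhds hxU
    filter_upwards [hlGc.continuousAt.eventually_ne (by rw [hlG]; exact one_ne_zero),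
      Φ.chart.open_target.mem_nhds hq₀t, h1] with x h2 h3 h4
    exact ⟨h2, h3, h4⟩
  obtain ⟨S, hSs, hSo, hq₀S⟩ := mem_nhds_iff.1 hS
  set T := T₀.restrOpen S hSo with hT
  have hTf : ∀ x, T x = f x := hT₀f
  have hq₀T : q₀ ∈ T.source := ⟨hq₀T₀, hq₀S⟩
  set Ψ := Φ.trans T (hT₀.mono Set.inter_subset_left) (hT₀'.mono Set.inter_subset_left)
    (fun x _ => by rw [hTf]) with hΨ
  have hΨs : ∀ x, x ∈ Ψ.chart.source ↔ x ∈ Φ.chart.source ∧ Φ.chart x ∈ T.source := fun x => by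
    change x ∈ (Φ.chart.trans T).source ↔ _
    simp
  have hΨx : ∀ x, Ψ.chart x = f (Φ.chart x) := fun x => hTf _
  have hx₀Ψ : x₀ ∈ Ψ.chart.source := (hΨs x₀).2 ⟨hx, hq₀T⟩
  have hΨ₀ : Ψ.chart x₀ = (q₀.1, 0) := by
    rw [hΨx]
    refine Prod.ext rfl ?_
    simp only [hf]
    rw [← hq₀, hqG, smul_zero]
  have hcs : ContMDiffAt 𝓘(ℂ, Fin (m + n) → ℂ) 𝓘(ℂ, Fin (m + n) → ℂ) ω c.symm (c x₀) :=
    (contMDiffOn_symm_of_mem_maximalAtlas hc).contMDiffAt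
      (c.open_target.mem_nhds (c.map_source hxc))
  have hcx : ContMDiffAt 𝓘(ℂ, Fin (m + n) → ℂ) 𝓘(ℂ, Fin (m + n) → ℂ) ω c x₀ :=
    (contMDiffOn_of_mem_maximalAtlas hc).contMDiffAt (c.open_source.mem_nhds hxc)
  have hΨt : ((Ψ.chart x₀).1, (0 : Fin n → ℂ)) ∈ Ψ.chart.target := by
    have := Ψ.chart.map_source hx₀Ψ
    rwa [hΨ₀] at this ⊢
  have eΨ : Ψ.chart.symm ((Ψ.chart x₀).1, (0 : Fin n → ℂ)) = x₀ := by
    conv_rhs => rw [← Ψ.chart.left_inv hx₀Ψ]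
    rw [hΨ₀]
  have hτ : ContDiffAt ℂ ω (c ∘ Ψ.chart.symm) ((Ψ.chart x₀).1, (0 : Fin n → ℂ)) := by
    refine (ContMDiffAt.comp _ (by rw [eΨ]; exact hcx) ?_).contDiffAt
    exact (Ψ.holo_symm _ hΨt).contMDiffAt (Ψ.chart.open_target.mem_nhds hΨt)
  have hτ0 : ContDiffAt ℂ ω (c ∘ Ψ.chart.symm)
      ((fun ζ : ℂ => ((Ψ.chart x₀).1 + ζ • a₁.1, (0 : Fin n → ℂ))) 0) := by simpa using hτ
  have hline : HasDerivAt (fun ζ : ℂ => ((Ψ.chart x₀).1 + ζ • a₁.1, (0 : Fin n → ℂ)))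
      (a₁.1, 0) 0 := by
    have h1 : HasDerivAt (fun ζ : ℂ => (Ψ.chart x₀).1 + ζ • a₁.1) a₁.1 0 := by
      simpa using ((hasDerivAt_id (0 : ℂ)).smul_const a₁.1).const_add (Ψ.chart x₀).1
    exact h1.prodMk (hasDerivAt_const _ _)
  refine ⟨Ψ, l, q, a₁.1, hx₀Ψ, by rw [hΨ₀], fun x hx' => ?_, ?_, ?_⟩
  · obtain ⟨hxs, hxT⟩ := (hΨs x).1 hx'
    have hxS := hSs hxT.2
    have eG : G (Φ.chart x) = F x := by rw [hG, Function.comp, Φ.chart.left_inv hxs]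
    have hxU' : x ∈ U := by
      have := hxS.2.2
      rwa [Φ.chart.left_inv hxs] at this
    obtain ⟨-, k, hk, e⟩ := hvF x hxU'
    have hl : l (F x) ≠ 0 := by rw [← eG]; exact hxS.1
    refine ⟨by rw [e, map_smul]; exact smul_ne_zero hk hl, ?_⟩
    rw [hΨx]
    simp only [hf]
    rw [eG, e, map_smul, map_smul, smul_eq_mul, smul_smul]
    change (l (F x))⁻¹ • q (F x) = _
    congr 1
    field_simp
  · exact ContDiffAt.comp (g := c ∘ Ψ.chart.symm) (0 : ℂ) hτ0 (by fun_prop)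
  · have h1 : HasFDerivAt (c ∘ Ψ.chart.symm) (fderiv ℂ (c ∘ Ψ.chart.symm) (Ψ.chart x₀))
        (Ψ.chart x₀) := by
      have := (hτ.differentiableAt (by simp)).hasFDerivAt
      rw [hΨ₀] at this ⊢
      exact this
    set τ' := fderiv ℂ (c ∘ Ψ.chart.symm) (Ψ.chart x₀) with hτ'
    have h2 : HasDerivAt (fun ζ : ℂ => c (Ψ.chart.symm ((Ψ.chart x₀).1 + ζ • a₁.1, 0)))
        (τ' (a₁.1, 0)) 0 := by
      refine HasFDerivAt.comp_hasDerivAt (f := fun ζ : ℂ => ((Ψ.chart x₀).1 + ζ • a₁.1, 0))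
        (0 : ℂ) (l := c ∘ Ψ.chart.symm) ?_ hline
      have : ((Ψ.chart x₀).1 + (0 : ℂ) • a₁.1, (0 : Fin n → ℂ)) = Ψ.chart x₀ := by
        rw [hΨ₀]; simp
      rw [this]; exact h1
    rw [h2.deriv]
    have hΦc : DifferentiableAt ℂ (Φ.chart ∘ c.symm) (c x₀) := by
      refine mdifferentiableAt_iff_differentiableAt.1 (MDifferentiableAt.comp (c x₀) ?_
        (hcs.mdifferentiableAt (by simp)))
      rw [c.left_inv hxc]; exact Φ.mdifferentiableAt_chart hx
    have h3 : HasFDerivAt (fun z => f ((Φ.chart ∘ c.symm) z))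
        (((ContinuousLinearMap.fst ℂ _ _).prod A) ∘L (fderiv ℂ (Φ.chart ∘ c.symm) (c x₀)))
        (c x₀) := by
      refine HasFDerivAt.comp (g := f) (c x₀) ?_ hΦc.hasFDerivAt
      rw [Function.comp, c.left_inv hxc]; exact hfd
    have e3 : f ((Φ.chart ∘ c.symm) (c x₀)) = Ψ.chart x₀ := by
      rw [Function.comp, c.left_inv hxc, hΨx]
    have h4 : HasFDerivAt (fun z => (c ∘ Ψ.chart.symm) (f ((Φ.chart ∘ c.symm) z)))
        (τ' ∘L (((ContinuousLinearMap.fst ℂ _ _).prod A) ∘L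
          (fderiv ℂ (Φ.chart ∘ c.symm) (c x₀)))) (c x₀) := by
      refine HasFDerivAt.comp (g := c ∘ Ψ.chart.symm) (c x₀) ?_ h3
      rw [e3]; exact h1
    -- Going from `c` to the new coordinates and back is the identity. Its derivative sends `a`
    -- first to `(a₁.1, A a₁) = (a₁.1, 0)`, so the line `w = 0` in direction `a₁.1` is tangent to
    -- `a` in the chart `c`.
    have h5 : (fun z => (c ∘ Ψ.chart.symm) (f ((Φ.chart ∘ c.symm) z))) =ᶠ[𝓝 (c x₀)] id := by
      have hnear : c.symm ⁻¹' Ψ.chart.source ∈ 𝓝 (c x₀) := by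
        refine hcs.continuousAt.preimage_mem_nhds ?_
        rw [c.left_inv hxc]; exact Ψ.chart.open_source.mem_nhds hx₀Ψ
      filter_upwards [hnear, c.open_target.mem_nhds (c.map_source hxc)] with z hz hzt
      simp only [Function.comp, id]
      rw [← hΨx, Ψ.chart.left_inv hz, c.right_inv hzt]
    have h6 := h4.unique ((hasFDerivAt_id (c x₀)).congr_of_eventuallyEq h5)
    have h7 := congrArg (fun M => M a) h6
    simp only [ContinuousLinearMap.comp_apply, ContinuousLinearMap.prod_apply,
      ContinuousLinearMap.coe_fst', ContinuousLinearMap.id_apply] at h7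
    rw [← ha₁, hAa] at h7
    exact h7

end Coordinates


/-! ### Mass estimates near a point -/

section Mass

variable {m n : ℕ} {X Y : Type*} [TopologicalSpace X] [ChartedSpace (Fin (m + n) → ℂ) X]
  [TopologicalSpace Y] [ChartedSpace (Fin m → ℂ) Y] {p : X → Y}

/-- The points with coordinates `(t, w)` such that `|t - t₀| < δ` and `|w| < ρ`. -/
def AdaptedChart.box (Φ : AdaptedChart m n p) (t₀ : Fin m → ℂ) (δ ρ : ℝ) : Set X :=
  Φ.chart.source ∩ Φ.chart ⁻¹' (Metric.ball t₀ δ ×ˢ Metric.ball 0 ρ)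

theorem AdaptedChart.isOpen_box (Φ : AdaptedChart m n p) (t₀ : Fin m → ℂ) (δ ρ : ℝ) :
    IsOpen (Φ.box t₀ δ ρ) :=
  Φ.chart.isOpen_inter_preimage (Metric.isOpen_ball.prod Metric.isOpen_ball)

theorem AdaptedChart.measurableSet_box (Φ : AdaptedChart m n p) (t₀ : Fin m → ℂ) (δ ρ : ℝ) :
    MeasurableSet[borel X] (Φ.box t₀ δ ρ) :=
  MeasurableSpace.measurableSet_generateFrom (Φ.isOpen_box t₀ δ ρ)

theorem AdaptedChart.slice_box (Φ : AdaptedChart m n p) {t₀ t : Fin m → ℂ} {δ ρ : ℝ} (hρ : ρ ≤ δ)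
    (hbox : ∀ t ∈ Metric.ball t₀ δ, ∀ w ∈ Metric.ball 0 δ, (t, w) ∈ Φ.chart.target)
    (ht : t ∈ Metric.ball t₀ δ) :
    Φ.slice (Φ.base.symm t) (Φ.box t₀ δ ρ) = Metric.ball 0 ρ := by
  have hδ : 0 < δ := dist_nonneg.trans_lt (Metric.mem_ball.1 ht)
  have h0 := Φ.base_right_inv (hbox t ht 0 (Metric.mem_ball_self hδ))
  ext w
  constructor
  · rintro ⟨h1, -, h3⟩
    rw [h0] at h1 h3
    have := h3.2.2
    rwa [Φ.chart.right_inv h1] at this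
  · intro hw
    have h1 := hbox t ht w (Metric.ball_subset_ball hρ hw)
    refine Φ.mem_slice_symm h1 ⟨Φ.chart.map_target h1, ?_⟩
    rw [Set.mem_preimage, Φ.chart.right_inv h1]
    exact ⟨ht, hw⟩

theorem AdaptedChart.box_subset (Φ : AdaptedChart m n p) {t₀ : Fin m → ℂ} {δ ρ : ℝ} (hρ : ρ ≤ δ)
    {U : Set X} (hU : ∀ t ∈ Metric.ball t₀ δ, ∀ w ∈ Metric.ball 0 δ, Φ.chart.symm (t, w) ∈ U) :
    Φ.box t₀ δ ρ ⊆ Φ.chart.source ∩ U := by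
  intro x hx
  refine ⟨hx.1, ?_⟩
  have := hU _ hx.2.1 _ (Metric.ball_subset_ball hρ hx.2.2)
  rwa [Prod.mk.eta, Φ.chart.left_inv hx.1] at this

variable {M : X → Type*} [∀ x, AddCommGroup (M x)] [∀ x, Module ℂ (M x)] {𝓕 : MetrizedFrames M}

theorem LocalPiece.mass_le_l2NormSq {y : Y} {u : ∀ x : p ⁻¹' {y}, RelForm m n p M x}
    (P : LocalPiece 𝓕 y u) : P.mass ≤ l2NormSq 𝓕 y u := by
  refine le_iSup_of_le 1 (le_iSup_of_le (fun _ => P) (le_iSup_of_le ?_ ?_))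
  · intro i j hij
    exact absurd (Subsingleton.elim i j) hij
  · simp

/-- A section of unit size at the centre of a box whose weight is at least that of a peak has at
least the mass of the peak. -/
theorem le_l2NormSq_of_peak (Φ : AdaptedChart m n p) {U : Set X} {s : ∀ x, M x} {w : X → ℝ}
    (hf : 𝓕 U s w) {t₀ t : Fin m → ℂ} {δ ρ ε : ℝ} (hρ : ρ ≤ δ)
    (hbox : ∀ t ∈ Metric.ball t₀ δ, ∀ w ∈ Metric.ball 0 δ,
      (t, w) ∈ Φ.chart.target ∧ Φ.chart.symm (t, w) ∈ U)
    (ht : t ∈ Metric.ball t₀ δ) {I : ℝ} (hI : 0 ≤ I)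
    (hw : ∀ z ∈ Metric.ball (0 : Fin n → ℂ) ρ,
      I * ((sumSq z + ε) ^ (n + 1))⁻¹ ≤ w (Φ.chart.symm (t, z)))
    {u : ∀ x : p ⁻¹' {Φ.base.symm t}, RelForm m n p M x} {v : (Fin n → ℂ) → ℂ}
    (hv : ContDiffOn ℂ ω v (Φ.slice (Φ.base.symm t) U))
    (hu : Represents Φ U s (Φ.base.symm t) u v) :
    ENNReal.ofReal (‖v 0‖ ^ 2 * I) * peakMass n ε ρ ≤ l2NormSq 𝓕 (Φ.base.symm t) u := by
  have hδ : 0 < δ := dist_nonneg.trans_lt (Metric.mem_ball.1 ht)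
  have hb := Φ.base_right_inv (hbox t ht 0 (Metric.mem_ball_self hδ)).1
  have hslice := Φ.slice_box hρ (fun t ht w hw => (hbox t ht w hw).1) ht
  have hsub : Metric.ball 0 ρ ⊆ Φ.slice (Φ.base.symm t) U := fun z hz => by
    have := hbox t ht z (Metric.ball_subset_ball hρ hz)
    exact Φ.mem_slice_symm this.1 this.2
  let P : LocalPiece 𝓕 (Φ.base.symm t) u :=
    { Φ := Φ, U := U, s := s, w := w, v := v, A := Φ.box t₀ δ ρ, frame := hf, represents := hu
      borel := Φ.measurableSet_box t₀ δ ρ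
      subset := Φ.box_subset hρ fun t ht w hw => (hbox t ht w hw).2 }
  refine le_trans ?_ P.mass_le_l2NormSq
  have hmass : P.mass = ∫⁻ z in Metric.ball 0 ρ,
      ENNReal.ofReal (‖v z‖ ^ 2 * w (Φ.chart.symm (t, z))) := by
    simp only [LocalPiece.mass, P, hslice, hb]
  have hκ : Measurable fun z : Fin n → ℂ => ENNReal.ofReal (((sumSq z + ε) ^ (n + 1))⁻¹) := by
    have := (continuous_sumSq (n := n)).measurable
    fun_prop
  have h1 := norm_sq_mul_lintegral_le
    ((hv.mono hsub).differentiableOn (by simp)) hκ (fun θ z => by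
      rw [sumSq_smul, Complex.norm_exp_ofReal_mul_I, one_pow, one_mul])
  rw [hmass, mul_comm (‖v 0‖ ^ 2), ENNReal.ofReal_mul hI, mul_assoc]
  refine (mul_le_mul_right h1 _).trans ?_
  rw [← lintegral_const_mul' _ _ ENNReal.ofReal_ne_top]
  refine setLIntegral_mono' measurableSet_ball fun z hz => ?_
  rw [← ENNReal.ofReal_mul (by positivity), ← ENNReal.ofReal_mul hI]
  refine ENNReal.ofReal_le_ofReal ?_
  calc I * (‖v z‖ ^ 2 * ((sumSq z + ε) ^ (n + 1))⁻¹)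
      = ‖v z‖ ^ 2 * (I * ((sumSq z + ε) ^ (n + 1))⁻¹) := by ring
    _ ≤ _ := by gcongr; exact hw z hz

variable [IsManifold 𝓘(ℂ, Fin (m + n) → ℂ) ω X] [IsManifold 𝓘(ℂ, Fin m → ℂ) ω Y]
  {L : X → Type*} [TopologicalSpace (TotalSpace ℂ L)] [∀ x, AddCommGroup (L x)]
  [∀ x, Module ℂ (L x)] [∀ x, TopologicalSpace (L x)] [FiberBundle ℂ L] [VectorBundle ℂ ℂ L]
  [ContMDiffVectorBundle ω ℂ L 𝓘(ℂ, Fin (m + n) → ℂ)] {hL : HermitianMetric (m + n) L}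
  {E : X → Type*} [TopologicalSpace (TotalSpace ℂ E)] [∀ x, AddCommGroup (E x)]
  [∀ x, Module ℂ (E x)] [∀ x, TopologicalSpace (E x)] [FiberBundle ℂ E] [VectorBundle ℂ ℂ E]
  [ContMDiffVectorBundle ω ℂ E 𝓘(ℂ, Fin (m + n) → ℂ)] {hE : HermitianMetric (m + n) E}

/-- Multiplication by a section with a peak at the centre of a box. -/
theorem l2NormSq_tensorSection_le_of_peak (Φ : AdaptedChart m n p) {U : Set X} {s : ∀ x, L x}
    (hs : IsHolFrame (m + n) L U s) {t₀ : Fin m → ℂ} {δ ρ ε : ℝ} (hδ : 0 < δ) (hρ : ρ ≤ δ)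
    (hbox : ∀ t ∈ Metric.ball t₀ δ, ∀ w ∈ Metric.ball 0 δ,
      (t, w) ∈ Φ.chart.target ∧ Φ.chart.symm (t, w) ∈ U)
    {σ : ∀ x, E x} (hσ : IsHolSectionOn (m + n) σ Set.univ)
    {u : ∀ x : p ⁻¹' {Φ.base.symm t₀}, RelForm m n p L x} {v : (Fin n → ℂ) → ℂ}
    (hu : u ∈ fibreSections (m := m) (n := n) p (lineFrames hL) (Φ.base.symm t₀))
    (hr : Represents Φ U s (Φ.base.symm t₀) u v) {A : ℝ}
    (hv : ∀ z ∈ Metric.ball (0 : Fin n → ℂ) ρ,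
      ‖v z‖ ^ 2 * hL.normSq _ (s (Φ.chart.symm (t₀, z))) ≤ A)
    (hσ1 : ∀ z ∈ Metric.ball (0 : Fin n → ℂ) ρ,
      hE.normSq _ (σ (Φ.chart.symm (t₀, z))) ≤ ((sumSq z + ε) ^ (n + 1))⁻¹)
    {C : ℝ} (hσ2 : ∀ x ∉ Φ.box t₀ δ ρ, hE.normSq x (σ x) ≤ C) :
    l2NormSq (tensorFrames hL hE) (Φ.base.symm t₀) (tensorSection u σ) ≤
      ENNReal.ofReal A * peakMass n ε ρ +
        ENNReal.ofReal C * l2NormSq (lineFrames hL) (Φ.base.symm t₀) u := by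
  have ht : t₀ ∈ Metric.ball t₀ δ := Metric.mem_ball_self hδ
  have hb := Φ.base_right_inv (hbox t₀ ht 0 (Metric.mem_ball_self hδ)).1
  have hslice := Φ.slice_box hρ (fun t ht w hw => (hbox t ht w hw).1) ht
  refine (l2NormSq_tensorSection_le hu hσ Φ hs.lineFrames hr (B := Φ.box t₀ δ ρ)
    (Φ.measurableSet_box t₀ δ ρ)
    (Φ.box_subset hρ fun t ht w hw => (hbox t ht w hw).2) (C := ENNReal.ofReal C)
    ENNReal.ofReal_ne_top fun x hx => ENNReal.ofReal_le_ofReal (hσ2 x hx)).trans ?_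
  gcongr
  rw [AdaptedChart.weightedMass, hslice, hb, peakMass,
    ← lintegral_const_mul' _ _ ENNReal.ofReal_ne_top]
  refine setLIntegral_mono' measurableSet_ball fun z hz => ?_
  exact mul_le_mul' (ENNReal.ofReal_le_ofReal (hv z hz)) (ENNReal.ofReal_le_ofReal (hσ1 z hz))

end Mass


/-! ### The sub-mean value inequality for the weight -/

section Submean

variable {m n : ℕ} {X Y : Type*} [TopologicalSpace X] [ChartedSpace (Fin (m + n) → ℂ) X]
  [TopologicalSpace Y] [ChartedSpace (Fin m → ℂ) Y] {p : X → Y}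
  {M : X → Type*} [∀ x, AddCommGroup (M x)] [∀ x, Module ℂ (M x)] {𝓕 : MetrizedFrames M}
  [IsManifold 𝓘(ℂ, Fin (m + n) → ℂ) ω X] [IsManifold 𝓘(ℂ, Fin m → ℂ) ω Y]

/-- Plurisubharmonicity of `log ‖ξ_t‖` is squeezed between two bounds. At the centre, the single
section `u` bounds it below; on the circle, every section has norm at least that of a peak of mass
`J` under the weight, which bounds it above by `g`. -/
theorem GriffithsSemiPositive.le_circleAverage (hG : GriffithsSemiPositive m n p 𝓕)
    (Φ : AdaptedChart m n p) {U : Set X} {s : ∀ x, M x} {w : X → ℝ}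
    (hf : 𝓕 U s w) (hs : ∀ x ∈ U, s x ≠ 0) {t₀ aY : Fin m → ℂ} {δ ρ ε r η J K : ℝ} (hρ : ρ ≤ δ)
    (hr : 0 ≤ r)
    (hbox : ∀ t ∈ Metric.ball t₀ δ, ∀ w ∈ Metric.ball 0 δ,
      (t, w) ∈ Φ.chart.target ∧ Φ.chart.symm (t, w) ∈ U)
    (hcirc : ∀ ζ : ℂ, ‖ζ‖ ≤ r → t₀ + ζ • aY ∈ Metric.ball t₀ δ) {ψ : (Fin m → ℂ) → ℝ}
    (hψ : CircleIntegrable (fun ζ => ψ (t₀ + ζ • aY)) 0 r)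
    (hw : ∀ ζ : ℂ, ‖ζ‖ = r → ∀ z ∈ Metric.ball (0 : Fin n → ℂ) ρ,
      Real.exp (-ψ (t₀ + ζ • aY) - η) * ((sumSq z + ε) ^ (n + 1))⁻¹ ≤
        w (Φ.chart.symm (t₀ + ζ • aY, z)))
    (hJ : 0 < J) (hpeak : peakMass n ε ρ = ENNReal.ofReal J)
    {u : ∀ x : p ⁻¹' {Φ.base.symm t₀}, RelForm m n p M x}
    (hu : u ∈ fibreSections (m := m) (n := n) p 𝓕 (Φ.base.symm t₀)) {v : (Fin n → ℂ) → ℂ}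
    (hv : Represents Φ U s (Φ.base.symm t₀) u v) (hv0 : v 0 ≠ 0) (hK : 0 < K)
    (huK : l2NormSq 𝓕 (Φ.base.symm t₀) u ≤ ENNReal.ofReal K) :
    2 * Real.log ‖v 0‖ - Real.log K ≤
      Real.circleAverage (fun ζ => ψ (t₀ + ζ • aY)) 0 r + η - Real.log J := by
  have ht₀ : t₀ ∈ Metric.ball t₀ δ := by simpa using hcirc 0 (by simpa using hr)
  have hδ : 0 < δ := dist_nonneg.trans_lt (Metric.mem_ball.1 ht₀)
  obtain ⟨ξ, hpsh, hev⟩ := hG.exists_psh_evaluation Φ hf hs (z₀ := 0) Metric.isOpen_ball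
    (fun t ht => hbox t ht 0 (Metric.mem_ball_self hδ))
  have h1 := le_log_dualNorm (ξ _) (u := ⟨u, hu⟩) hK huK (by rwa [hev t₀ ht₀ ⟨u, hu⟩ v hv])
  rw [hev t₀ ht₀ ⟨u, hu⟩ v hv] at h1
  have h2 := hpsh.2.2 t₀ ((r : ℂ) • aY) (fun ζ hζ => by
    rw [smul_smul]
    refine hcirc _ ?_
    rw [norm_mul, Complex.norm_real, Real.norm_of_nonneg hr]
    nlinarith)
  -- The factor `1/2` appears because `ψ` and `J` measure squared norms.
  set g : ℂ → ℝ := fun ζ => 2⁻¹ * ψ (t₀ + ζ • aY) + 2⁻¹ * (η - Real.log J) with hg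
  have hgi : CircleIntegrable g 0 r := by
    have := (hψ.const_fun_smul (a := (2⁻¹ : ℝ))).add
      (circleIntegrable_const (2⁻¹ * (η - Real.log J)) 0 r)
    exact this
  have h3 := circleMean_le_circleAverage (a := t₀) (b := (r : ℂ) • aY)
    (f := fun t => ENNReal.log (dualNorm (ξ (Φ.base.symm t)))) hgi (fun θ => by
      rw [smul_smul, mul_comm _ (r : ℂ)]
      set ζ : ℂ := r * Complex.exp (θ * Complex.I) with hζ
      have hζr : ‖ζ‖ = r := by
        rw [hζ, norm_mul, Complex.norm_exp_ofReal_mul_I, mul_one, Complex.norm_real,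
          Real.norm_of_nonneg hr]
      have ht := hcirc ζ hζr.le
      have hI : 0 < Real.exp (-ψ (t₀ + ζ • aY) - η) * J := by positivity
      have h4 := log_dualNorm_le (ξ (Φ.base.symm (t₀ + ζ • aY))) hI (fun u' => by
        obtain ⟨v', hv', hr'⟩ := u'.2 Φ U s w hf
        rw [hev _ ht u' v' hr', ← mul_assoc, ENNReal.ofReal_mul (by positivity), ← hpeak]
        exact le_l2NormSq_of_peak Φ hf hρ hbox ht (Real.exp_nonneg _) (hw ζ hζr) hv' hr')
      refine h4.trans (le_of_eq ?_)
      rw [Real.log_mul (Real.exp_ne_zero _) hJ.ne', Real.log_exp]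
      congr 1
      simp only [hg]
      ring)
  have h5 := EReal.coe_le_coe_iff.1 (h1.trans (h2.trans h3))
  have h6 : Real.circleAverage g 0 r = 2⁻¹ * Real.circleAverage (fun ζ => ψ (t₀ + ζ • aY)) 0 r +
      2⁻¹ * (η - Real.log J) := by
    have e : g = (fun ζ => (2⁻¹ : ℝ) • ψ (t₀ + ζ • aY)) + fun _ => 2⁻¹ * (η - Real.log J) := rfl
    rw [e, Real.circleAverage_add (hψ.const_fun_smul) (circleIntegrable_const _ _ _),
      Real.circleAverage_fun_smul, Real.circleAverage_const]
    rfl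
  rw [h6] at h5
  linarith

end Submean


/-! ### Sections of `𝒪(k)` with a peak -/

section PeakSystem

variable {d n N : ℕ} {X : Type*} [TopologicalSpace X] [ChartedSpace (Fin d → ℂ) X]
  (l : (Fin (N + 1) → ℂ) →ₗ[ℂ] ℂ) (q : (Fin (N + 1) → ℂ) →ₗ[ℂ] (Fin n → ℂ)) (b : Fin (N + 1) → ℂ)
  (k : ℕ) (ε : ℝ)

/-- For small `ε`, the metric on a power of `𝒪(k + 1)` defined by this system is concentrated near
the points where `q = 0` and `a` is a multiple of `b`. -/
def peakSystem : Fin n ⊕ (Fin (N + 1) ⊕ Unit) → (Fin (N + 1) → ℂ) → ℂ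
  | .inl j => fun a => q a j * l a ^ k
  | .inr (.inl i) => fun a => (a i - l a * b i) ^ (k + 1)
  | .inr (.inr _) => fun a => (√ε : ℝ) * l a ^ (k + 1)

/-- The part of the sum of squares that measures the distance from the line through `b`. -/
def peakRemainder (a : Fin (N + 1) → ℂ) : ℝ := ∑ i, (‖a i - l a * b i‖ ^ (k + 1)) ^ 2

theorem peakRemainder_nonneg (a : Fin (N + 1) → ℂ) : 0 ≤ peakRemainder l b k a :=
  Finset.sum_nonneg fun _ _ => by positivity

theorem peakRemainder_smul (c : ℂ) (a : Fin (N + 1) → ℂ) :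
    peakRemainder l b k (c • a) = (‖c‖ ^ (k + 1)) ^ 2 * peakRemainder l b k a := by
  rw [peakRemainder, peakRemainder, Finset.mul_sum]
  refine Finset.sum_congr rfl fun i _ => ?_
  rw [map_smul, Pi.smul_apply, smul_eq_mul, smul_eq_mul, mul_assoc, ← mul_sub, norm_mul]
  ring

theorem continuous_peakRemainder : Continuous (peakRemainder l b k) := by
  have := LinearMap.continuous_of_finiteDimensional l
  unfold peakRemainder
  fun_prop

variable {l b k} in
theorem eq_smul_of_peakRemainder_eq_zero {a : Fin (N + 1) → ℂ} (h : peakRemainder l b k a = 0) :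
    a = l a • b := by
  ext i
  have h1 := (Finset.sum_eq_zero_iff_of_nonneg fun _ _ => by positivity).1 h i (Finset.mem_univ i)
  have h2 : ‖a i - l a * b i‖ = 0 := by simpa using h1
  exact sub_eq_zero.1 (norm_eq_zero.1 h2)

variable {ε}

theorem sum_peakSystem (hε : 0 ≤ ε) (a : Fin (N + 1) → ℂ) :
    ∑ j, ‖peakSystem l q b k ε j a‖ ^ 2 = sumSq (q a) * (‖l a‖ ^ k) ^ 2 + peakRemainder l b k a +
      ε * (‖l a‖ ^ (k + 1)) ^ 2 := by
  simp only [Fintype.sum_sum_type, peakSystem, norm_mul, norm_pow, Complex.norm_real, mul_pow,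
    Real.norm_eq_abs, sq_abs, Real.sq_sqrt hε, sumSq, peakRemainder, Finset.sum_mul,
    Finset.univ_unique, Finset.sum_singleton]
  ring

/-- Where `l` vanishes, the second group of functions consists of powers of the coordinates;
elsewhere the last function is non-zero because `ε > 0`. -/
theorem basePointFree_peakSystem (hε : 0 < ε) :
    BasePointFree N (k + 1) (peakSystem l q b k ε) where
  contDiff j := by
    have hl : ContDiff ℂ ω l := (LinearMap.toContinuousLinearMap l).contDiff
    have hq : ContDiff ℂ ω q := (LinearMap.toContinuousLinearMap q).contDiff
    rcases j with j | i | _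
    · exact ((contDiff_apply ℂ ℂ j).comp hq).mul (hl.pow k)
    · exact ((contDiff_apply ℂ ℂ i).sub (hl.mul contDiff_const)).pow (k + 1)
    · exact contDiff_const.mul (hl.pow (k + 1))
  homogeneous j c a := by
    rcases j with j | i | _ <;> simp only [peakSystem, map_smul, Pi.smul_apply, smul_eq_mul]
    · ring
    · rw [mul_assoc, ← mul_sub, mul_pow]
    · ring
  exists_ne_zero a ha := by
    by_cases hl : l a = 0
    · obtain ⟨i, hi⟩ := Function.ne_iff.1 ha
      refine ⟨.inr (.inl i), ?_⟩
      simp only [peakSystem, hl, zero_mul, sub_zero]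
      exact pow_ne_zero _ hi
    · refine ⟨.inr (.inr ()), mul_ne_zero ?_ (pow_ne_zero _ hl)⟩
      exact_mod_cast (Real.sqrt_pos.2 hε).ne'

variable {v : X → Fin (N + 1) → ℂ} (hv : IsHomogeneousLift d v)

/-- The section `l ^ ((k + 1) (n + 1))` of `𝒪((k + 1) (n + 1))`. -/
def peakSection (n : ℕ) : ∀ x, PowerBundle hv ((k + 1) * (n + 1)) x :=
  powerSection hv ((k + 1) * (n + 1)) fun a => l a ^ ((k + 1) * (n + 1))

theorem isHolSectionOn_peakSection : IsHolSectionOn d (peakSection l k hv n) Set.univ :=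
  isHolSectionOn_powerSection hv ((LinearMap.toContinuousLinearMap l).contDiff.pow _)
    fun c a => by rw [map_smul, smul_eq_mul, mul_pow]

theorem peakSection_ne_zero {x : X} (hx : l (v x) ≠ 0) : peakSection l k hv n x ≠ 0 :=
  div_ne_zero (pow_ne_zero _ hx) (pow_ne_zero _ (coordinate_indexAt_ne_zero hv _ x))

variable [IsManifold 𝓘(ℂ, Fin d → ℂ) ω X]

/-- The metric on `𝒪((k + 1) (n + 1))` defined by `peakSystem`. -/
def peakMetric (hε : 0 < ε) : HermitianMetric d (PowerBundle hv ((k + 1) * (n + 1))) :=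
  powerMetric hv (basePointFree_peakSystem l q b k hε) (n + 1)

theorem peakMetric_normSq_eq_pow (hε : 0 < ε) (x : X) :
    (peakMetric l q b k hv hε).normSq x (peakSection l k hv n x) =
      ((‖l (v x)‖ ^ (k + 1)) ^ 2 / ∑ j, ‖peakSystem l q b k ε j (v x)‖ ^ 2) ^ (n + 1) := by
  refine (powerMetric_normSq_powerSection hv _ _ _ x).trans ?_
  rw [norm_pow, pow_mul, div_pow, pow_right_comm]

/-- Rescale `v` so that `l = 1`. In coordinates with `w = q(v) / l(v)` this exhibits the peak along
`w = 0`, of height `(R + ε)^{-(n+1)}` with `R` the remainder. -/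
theorem peakMetric_normSq (hε : 0 < ε) {x : X} (hx : l (v x) ≠ 0) :
    (peakMetric l q b k hv hε).normSq x (peakSection l k hv n x) =
      ((sumSq ((l (v x))⁻¹ • q (v x)) + peakRemainder l b k ((l (v x))⁻¹ • v x) + ε) ^ (n + 1))⁻¹ := by
  rw [peakMetric_normSq_eq_pow, ← inv_pow]
  congr 1
  have h1 := (basePointFree_peakSystem l q b k hε).sum_smul (l (v x)) ((l (v x))⁻¹ • v x)
  rw [smul_inv_smul₀ hx, sum_peakSystem l q b k hε.le ((l (v x))⁻¹ • v x)] at h1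
  have hx' : ‖l (v x)‖ ≠ 0 := norm_ne_zero_iff.2 hx
  rw [h1, map_smul, map_smul, smul_eq_mul, inv_mul_cancel₀ hx]
  simp only [norm_one, one_pow, mul_one]
  rw [div_mul_cancel_left₀ (by positivity)]

theorem peakMetric_normSq_le (hε : 0 < ε) {x : X} {C : ℝ}
    (h : (‖l (v x)‖ ^ (k + 1)) ^ 2 ≤ C * peakRemainder l b k (v x)) (hC : 0 ≤ C) :
    (peakMetric l q b k hv hε).normSq x (peakSection l k hv n x) ≤ C ^ (n + 1) := by
  rw [peakMetric_normSq_eq_pow]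
  have h1 := (basePointFree_peakSystem l q b k hε).sum_pos (hv.ne_zero x)
  refine pow_le_pow_left₀ (by positivity) ?_ _
  rw [div_le_iff₀ h1]
  refine h.trans (mul_le_mul_of_nonneg_left ?_ hC)
  rw [sum_peakSystem l q b k hε.le]
  have := sumSq_nonneg (q (v x))
  have : 0 ≤ sumSq (q (v x)) * (‖l (v x)‖ ^ k) ^ 2 := by positivity
  have : 0 ≤ ε * (‖l (v x)‖ ^ (k + 1)) ^ 2 := by positivity
  linarith

/-- The remainder vanishes only on the line through `v x₀`, hence only at `x₀` by injectivity of the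
embedding. The ratio of the two sides is homogeneous of degree `0`, so it is continuous off `x₀` and
bounded on the compact complement of `O`. With `peakMetric_normSq_le` this bounds the section there
uniformly in `ε`. -/
theorem exists_le_mul_peakRemainder [CompactSpace X] (hv : IsHomogeneousLift d v) {x₀ : X}
    (hinj : ∀ x (c : ℂ), v x = c • v x₀ → x = x₀) (hb : ∃ c : ℂ, b = c • v x₀) {O : Set X}
    (hO : IsOpen O) (hx₀ : x₀ ∈ O) :
    ∃ C, 1 ≤ C ∧ ∀ x ∉ O, (‖l (v x)‖ ^ (k + 1)) ^ 2 ≤ C * peakRemainder l b k (v x) := by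
  obtain ⟨c₀, hb⟩ := hb
  have hpos : ∀ x ∉ O, 0 < peakRemainder l b k (v x) := by
    intro x hx
    refine (peakRemainder_nonneg l b k _).lt_of_ne' fun h0 => hx ?_
    have h1 := eq_smul_of_peakRemainder_eq_zero h0
    rw [hb, smul_smul] at h1
    rw [hinj x _ h1]
    exact hx₀
  have hcont : ContinuousOn (fun x => (‖l (v x)‖ ^ (k + 1)) ^ 2 / peakRemainder l b k (v x)) Oᶜ := by
    intro x hx
    obtain ⟨U, F, hU, hxU, hF, h⟩ := hv x
    have hFc : ContinuousAt F x := hF.continuousOn.continuousAt (hU.mem_nhds hxU)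
    have hF0 : peakRemainder l b k (F x) ≠ 0 := by
      obtain ⟨-, c, hc, e⟩ := h x hxU
      have := (hpos x hx).ne'
      rw [e, peakRemainder_smul] at this
      exact right_ne_zero_of_mul this
    have hl := (LinearMap.continuous_of_finiteDimensional l).continuousAt (x := F x)
    have h1 : ContinuousAt (fun x => (‖l (F x)‖ ^ (k + 1)) ^ 2 / peakRemainder l b k (F x)) x :=
      (((hl.comp hFc).norm.pow _).pow _).div
        ((continuous_peakRemainder l b k).continuousAt.comp hFc) hF0
    refine (h1.congr ?_).continuousWithinAt
    filter_upwards [hU.mem_nhds hxU] with x' hx'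
    obtain ⟨-, c, hc, e⟩ := h x' hx'
    have hc' : ‖c‖ ≠ 0 := norm_ne_zero_iff.2 hc
    rw [e, peakRemainder_smul, map_smul, norm_smul, mul_pow, mul_pow,
      mul_div_mul_left _ _ (by positivity)]
  obtain ⟨C, hC⟩ := hO.isClosed_compl.isCompact.exists_bound_of_continuousOn hcont
  refine ⟨max C 1, le_max_right _ _, fun x hx => ?_⟩
  rw [← div_le_iff₀ (hpos x hx)]
  exact (le_abs_self _).trans ((hC x hx).trans (le_max_left _ _))

end PeakSystem


/-! ### The sub-mean value inequality along curves tangent to a given direction -/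

section Parameters

/-- The peak has mass at least of order `r^{-(6n+10)}`, the second summand is of order
`r^{-(6n+6)}`; relative to the first it is `O(r⁴)`. All correction factors are then absorbed by `1 +
x ≤ exp x`. -/
theorem log_le_of_peak {n : ℕ} {r A c c₅ c₄ M κ J : ℝ} (hr : 0 < r) (hA : 0 < A) (hc : 0 ≤ c)
    (hc₅ : 0 ≤ c₅)
    (hc₄ : 0 ≤ c₄) (hM : 0 ≤ M) (hκ : 0 < κ) (hJ : κ * ((r ^ (3 * n + 5)) ^ 2)⁻¹ ≤ J) :
    Real.log (A * Real.exp (c * r ^ 3) * (1 + c₅ * r ^ 4) ^ (n + 1) * J +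
        c₄ * (((r ^ 3) ^ 2) ^ (n + 1))⁻¹ * M) ≤
      Real.log A + Real.log J + c * r ^ 3 + ((n + 1) * c₅ + c₄ * M / (A * κ)) * r ^ 4 := by
  have hJ0 : 0 < J := lt_of_lt_of_le (by positivity) hJ
  set c₆ := c₄ * M / (A * κ) with hc₆
  have hc₆0 : 0 ≤ c₆ := by positivity
  have h1 : (1 + c₅ * r ^ 4) ^ (n + 1) ≤ Real.exp ((n + 1) * c₅ * r ^ 4) := by
    have h2 : 1 + c₅ * r ^ 4 ≤ Real.exp (c₅ * r ^ 4) := by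
      linarith [Real.add_one_le_exp (c₅ * r ^ 4)]
    refine (pow_le_pow_left₀ (by positivity) h2 _).trans (le_of_eq ?_)
    rw [← Real.exp_nat_mul]
    push_cast
    ring_nf
  have h3 : c₄ * (((r ^ 3) ^ 2) ^ (n + 1))⁻¹ * M ≤
      A * Real.exp (c * r ^ 3) * J * (c₆ * r ^ 4) := by
    have h4 : c₄ * M * (r ^ 4 * (J / κ)) ≤ A * Real.exp (c * r ^ 3) * J * (c₆ * r ^ 4) := by
      have h5 : A * 1 * J * (c₆ * r ^ 4) = c₄ * M * (r ^ 4 * (J / κ)) := by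
        rw [hc₆]
        field_simp
      rw [← h5]
      have h6 : 1 ≤ Real.exp (c * r ^ 3) := Real.one_le_exp (by positivity)
      gcongr
    have h5 : (((r ^ 3) ^ 2) ^ (n + 1))⁻¹ ≤ r ^ 4 * (J / κ) := by
      have h6 : ((r ^ (3 * n + 5)) ^ 2)⁻¹ ≤ J / κ := by
        rw [le_div_iff₀ hκ, mul_comm]; exact hJ
      refine le_trans (le_of_eq ?_) (mul_le_mul_of_nonneg_left h6 (by positivity))
      have h7 : (r ^ (3 * n + 5)) ^ 2 = r ^ 4 * ((r ^ 3) ^ 2) ^ (n + 1) := by ring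
      rw [h7]
      field_simp
    refine le_trans ?_ h4
    calc c₄ * (((r ^ 3) ^ 2) ^ (n + 1))⁻¹ * M = c₄ * M * (((r ^ 3) ^ 2) ^ (n + 1))⁻¹ := by ring
      _ ≤ _ := by gcongr
  have h8 : (1 : ℝ) ≤ Real.exp ((n + 1) * c₅ * r ^ 4) := Real.one_le_exp (by positivity)
  have h9 : 1 + c₆ * r ^ 4 ≤ Real.exp (c₆ * r ^ 4) := by
    linarith [Real.add_one_le_exp (c₆ * r ^ 4)]
  have h10 : A * Real.exp (c * r ^ 3) * (1 + c₅ * r ^ 4) ^ (n + 1) * J +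
        c₄ * (((r ^ 3) ^ 2) ^ (n + 1))⁻¹ * M ≤
      A * J * Real.exp (c * r ^ 3 + ((n + 1) * c₅ + c₆) * r ^ 4) := by
    have h11 : A * J * Real.exp (c * r ^ 3 + ((n + 1) * c₅ + c₆) * r ^ 4) =
        A * Real.exp (c * r ^ 3) * J *
          (Real.exp ((n + 1) * c₅ * r ^ 4) * Real.exp (c₆ * r ^ 4)) := by
      rw [add_mul, Real.exp_add, Real.exp_add]; ring
    have h12 : (1 + c₅ * r ^ 4) ^ (n + 1) + c₆ * r ^ 4 ≤
        Real.exp ((n + 1) * c₅ * r ^ 4) * Real.exp (c₆ * r ^ 4) := by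
      have h13 : 0 ≤ c₆ * r ^ 4 := by positivity
      nlinarith
    rw [h11]
    calc _ ≤ A * Real.exp (c * r ^ 3) * (1 + c₅ * r ^ 4) ^ (n + 1) * J +
          A * Real.exp (c * r ^ 3) * J * (c₆ * r ^ 4) := by gcongr
      _ = A * Real.exp (c * r ^ 3) * J * ((1 + c₅ * r ^ 4) ^ (n + 1) + c₆ * r ^ 4) := by ring
      _ ≤ _ := by gcongr
  have hpos : 0 < A * Real.exp (c * r ^ 3) * (1 + c₅ * r ^ 4) ^ (n + 1) * J +
        c₄ * (((r ^ 3) ^ 2) ^ (n + 1))⁻¹ * M := by positivity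
  refine (Real.log_le_log hpos h10).trans (le_of_eq ?_)
  rw [Real.log_mul (by positivity) (Real.exp_ne_zero _), Real.log_exp, Real.log_mul hA.ne' hJ0.ne']
  ring

end Parameters

/-! ### The main estimate at a point outside the base locus. -/

section Estimate

variable {m n N : ℕ} {X Y : Type*} [TopologicalSpace X] [ChartedSpace (Fin (m + n) → ℂ) X]
  [TopologicalSpace Y] [ChartedSpace (Fin m → ℂ) Y] {p : X → Y}
  [IsManifold 𝓘(ℂ, Fin (m + n) → ℂ) ω X] [IsManifold 𝓘(ℂ, Fin m → ℂ) ω Y]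
  {L : X → Type*} [TopologicalSpace (TotalSpace ℂ L)] [∀ x, AddCommGroup (L x)]
  [∀ x, Module ℂ (L x)] [∀ x, TopologicalSpace (L x)] [FiberBundle ℂ L] [VectorBundle ℂ ℂ L]
  [ContMDiffVectorBundle ω ℂ L 𝓘(ℂ, Fin (m + n) → ℂ)] {hL : HermitianMetric (m + n) L}

theorem HermitianMetric.contDiffAt_weight (hL : HermitianMetric (m + n) L) (Φ : AdaptedChart m n p)
    {U : Set X} {s : ∀ x, L x} (hs : IsHolFrame (m + n) L U s)
    {z : (Fin m → ℂ) × (Fin n → ℂ)} (hz : z ∈ Φ.chart.target) (hzU : Φ.chart.symm z ∈ U) :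
    ContDiffAt ℝ ∞ (fun z => -Real.log (hL.normSq (Φ.chart.symm z) (s (Φ.chart.symm z)))) z := by
  have h1 : ContMDiffAt 𝓘(ℝ, Fin (m + n) → ℂ) 𝓘(ℝ, ℝ) ∞ (fun x => hL.normSq x (s x))
      (Φ.chart.symm z) := (hL.smooth U s hs).contMDiffAt (hs.1.mem_nhds hzU)
  have h2 : ContMDiffAt 𝓘(ℝ, (Fin m → ℂ) × (Fin n → ℂ)) 𝓘(ℝ, Fin (m + n) → ℂ) ∞ Φ.chart.symm z :=
    contMDiffAt_real ((Φ.holo_symm z hz).contMDiffAt (Φ.chart.open_target.mem_nhds hz))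
  have h3 : ContDiffAt ℝ ∞ (fun z => hL.normSq (Φ.chart.symm z) (s (Φ.chart.symm z))) z :=
    (ContMDiffAt.comp z h1 h2).contDiffAt
  exact (h3.log (hL.normSq_pos (hs.2.1 _ hzU)).ne').neg

theorem IsHomogeneousLift.contDiffAt_normalized {v : X → Fin (N + 1) → ℂ}
    (hv : IsHomogeneousLift (m + n) v) (Φ : AdaptedChart m n p) (l : (Fin (N + 1) → ℂ) →ₗ[ℂ] ℂ)
    {z : (Fin m → ℂ) × (Fin n → ℂ)} (hz : z ∈ Φ.chart.target) (hl : l (v (Φ.chart.symm z)) ≠ 0) :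
    ContDiffAt ℂ ω (fun z => (l (v (Φ.chart.symm z)))⁻¹ • v (Φ.chart.symm z)) z := by
  have hlc : ContDiff ℂ ω l := (LinearMap.toContinuousLinearMap l).contDiff
  have h1 := hv.contMDiffAt (R := fun a => (l a)⁻¹ • a) (x := Φ.chart.symm z) (fun c a hc => by
      rw [map_smul, smul_smul, smul_eq_mul]
      congr 1
      field_simp) (fun c hc => by
      refine (hlc.contDiffAt.inv ?_).smul contDiffAt_id
      rw [map_smul]
      exact smul_ne_zero hc hl)
  exact (ContMDiffAt.comp z h1
    ((Φ.holo_symm z hz).contMDiffAt (Φ.chart.open_target.mem_nhds hz))).contDiffAt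

/-- The function `log |v|²` is Lipschitz near `0`, where `v` does not vanish. -/
theorem exists_norm_sq_le_exp {v : (Fin n → ℂ) → ℂ} (hv : ContDiffAt ℂ ω v 0) (hv0 : v 0 ≠ 0) :
    ∃ C : ℝ, 0 ≤ C ∧ ∀ᶠ z in 𝓝 0, ‖v z‖ ^ 2 ≤ ‖v 0‖ ^ 2 * Real.exp (C * ‖z‖) := by
  have hv' : ContDiffAt ℝ 1 v 0 := (hv.restrict_scalars ℝ).of_le (by simp)
  have hpos : 0 < ‖v 0‖ ^ 2 := pow_pos (norm_pos_iff.2 hv0) 2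
  obtain ⟨C, S, hS, hC⟩ := ((hv'.norm_sq ℝ).log hpos.ne').exists_lipschitzOnWith
  refine ⟨C, C.2, ?_⟩
  filter_upwards [hS, hv.continuousAt.eventually_ne hv0] with z hz hz0
  have h1 := hC.dist_le_mul z hz 0 (mem_of_mem_nhds hS)
  rw [Real.dist_eq, dist_zero_right] at h1
  have h2 := (abs_le.1 h1).2
  have hz' : 0 < ‖v z‖ ^ 2 := pow_pos (norm_pos_iff.2 hz0) 2
  rw [← Real.exp_log hz', ← Real.exp_log hpos, ← Real.exp_add]
  exact Real.exp_le_exp.2 (by linarith)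

set_option maxHeartbeats 1000000 in
-- For each small `r` a different twist is used: the metric of `E` depends on `r` through `ε`, while
-- the bundle and the section `u` stay fixed. All constants are chosen before `r`, so the error is
-- uniformly `O(r³)`.
theorem exists_le_circleAverage_add [CompactSpace X] [T2Space Y]
    (hp : Manifold.IsSubmersion 𝓘(ℂ, Fin (m + n) → ℂ) 𝓘(ℂ, Fin m → ℂ) ω p)
    {v : X → Fin (N + 1) → ℂ} (hv : IsHomogeneousLift (m + n) v) {x₀ : X}
    (hinj : ∀ x (c : ℂ), v x = c • v x₀ → x = x₀) (Φ : AdaptedChart m n p)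
    {l : (Fin (N + 1) → ℂ) →ₗ[ℂ] ℂ} {q : (Fin (N + 1) → ℂ) →ₗ[ℂ] (Fin n → ℂ)}
    (hx₀ : x₀ ∈ Φ.chart.source) (hΦ₀ : (Φ.chart x₀).2 = 0)
    (hΦ : ∀ x ∈ Φ.chart.source, l (v x) ≠ 0 ∧ (Φ.chart x).2 = (l (v x))⁻¹ • q (v x))
    (hG : ∀ b k (ε : ℝ) (hε : 0 < ε),
      GriffithsSemiPositive m n p (tensorFrames hL (peakMetric l q b k hv hε)))
    {U : Set X} {s : ∀ x, L x} (hs : IsHolFrame (m + n) L U s) (hx₀U : x₀ ∈ U)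
    (hbase : x₀ ∉ fibreBaseLocus p hL) (aY : Fin m → ℂ) {ψ : (Fin m → ℂ) → ℝ}
    (hψ : ψ = fun t => -Real.log (hL.normSq (Φ.chart.symm (t, 0)) (s (Φ.chart.symm (t, 0))))) :
    ∃ C : ℝ, ∀ᶠ r in 𝓝[>] (0 : ℝ),
      CircleIntegrable (fun ζ => ψ ((Φ.chart x₀).1 + ζ • aY)) 0 r ∧
      ψ (Φ.chart x₀).1 ≤
        Real.circleAverage (fun ζ => ψ ((Φ.chart x₀).1 + ζ • aY)) 0 r + C * r ^ 3 := by
  set t₀ := (Φ.chart x₀).1 with ht₀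
  have hz₀ : Φ.chart x₀ = (t₀, 0) := Prod.ext rfl hΦ₀
  have hz₀t : (t₀, (0 : Fin n → ℂ)) ∈ Φ.chart.target := hz₀ ▸ Φ.chart.map_source hx₀
  have e₀ : Φ.chart.symm (t₀, 0) = x₀ := by rw [← hz₀, Φ.chart.left_inv hx₀]
  -- the frame and the section on the central fibre
  set U' := U ∩ Φ.chart.source with hU'
  have hs' : IsHolFrame (m + n) L U' s :=
    hs.mono (hs.1.inter Φ.chart.open_source) Set.inter_subset_left
  have hx₀U' : Φ.chart.symm (t₀, 0) ∈ U' := by rw [e₀]; exact ⟨hx₀U, hx₀⟩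
  obtain ⟨y, u, hu, hxy, hux⟩ : ∃ y, ∃ u ∈ fibreSections (m := m) (n := n) p (lineFrames hL) y,
      ∃ hxy : p x₀ = y, u ⟨x₀, hxy⟩ ≠ 0 := by
    by_contra! h
    exact hbase fun y u hu hxy => h y u hu hxy
  have hy : y = Φ.base.symm t₀ := by rw [Φ.base_symm_eq hz₀t, e₀, hxy]
  subst hy
  obtain ⟨v₀, hv₀, hr₀⟩ := hu Φ U' s _ hs'.lineFrames
  have hv₀0 : v₀ 0 ≠ 0 := by
    intro h
    refine hux ((hr₀.apply_eq_zero_iff hxy hx₀ ⟨hx₀U, hx₀⟩ (hs.2.1 _ hx₀U)).2 ?_)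
    rw [hΦ₀]; exact h
  have hv₀c : ContDiffAt ℂ ω v₀ 0 :=
    hv₀.contDiffAt ((Φ.isOpen_slice _ hs'.1).mem_nhds (Φ.mem_slice_symm hz₀t hx₀U'))
  obtain ⟨C₃, hC₃, hv₀b⟩ := exists_norm_sq_le_exp hv₀c hv₀0
  -- Lipschitz bounds
  set W : (Fin m → ℂ) × (Fin n → ℂ) → ℝ :=
    fun z => -Real.log (hL.normSq (Φ.chart.symm z) (s (Φ.chart.symm z))) with hW
  obtain ⟨C₁, S₁, hS₁, hC₁⟩ := ((hL.contDiffAt_weight Φ hs hz₀t hx₀U'.1).of_le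
    (m := 1) (by norm_cast)).exists_lipschitzOnWith
  have hl₀ : l (v (Φ.chart.symm (t₀, 0))) ≠ 0 := (hΦ _ hx₀U'.2).1
  obtain ⟨C₂, S₂, hS₂, hC₂⟩ := (((hv.contDiffAt_normalized Φ l hz₀t hl₀).restrict_scalars
    ℝ).of_le (m := 1) (by simp)).exists_lipschitzOnWith
  set b := (l (v x₀))⁻¹ • v x₀ with hb
  -- the box
  have hnear : ∀ᶠ z in 𝓝 (t₀, (0 : Fin n → ℂ)), (z ∈ Φ.chart.target ∧ Φ.chart.symm z ∈ U') ∧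
      z ∈ S₁ ∧ z ∈ S₂ := by
    filter_upwards [(Φ.chart.symm.isOpen_inter_preimage hs'.1).mem_nhds ⟨hz₀t, hx₀U'⟩, hS₁, hS₂]
      with z h1 h2 h3
    exact ⟨h1, h2, h3⟩
  obtain ⟨δ₁, hδ₁, hball₁⟩ := Metric.eventually_nhds_iff_ball.1 hnear
  obtain ⟨δ₂, hδ₂, hball₂⟩ := Metric.eventually_nhds_iff_ball.1 hv₀b
  set δ := min δ₁ δ₂ with hδ
  have hδ0 : 0 < δ := lt_min hδ₁ hδ₂
  have hboxS : ∀ t ∈ Metric.ball t₀ δ, ∀ w ∈ Metric.ball (0 : Fin n → ℂ) δ,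
      ((t, w) ∈ Φ.chart.target ∧ Φ.chart.symm (t, w) ∈ U') ∧ (t, w) ∈ S₁ ∧ (t, w) ∈ S₂ := by
    intro t ht w hw
    refine hball₁ _ ?_
    rw [← ball_prod_same]
    exact ⟨Metric.ball_subset_ball (min_le_left _ _) ht,
      Metric.ball_subset_ball (min_le_left _ _) hw⟩
  have hbox := fun t ht w hw => (hboxS t ht w hw).1
  have h0δ : (0 : Fin n → ℂ) ∈ Metric.ball 0 δ := Metric.mem_ball_self hδ0
  have ht₀δ : t₀ ∈ Metric.ball t₀ δ := Metric.mem_ball_self hδ0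
  have hnormSq : ∀ t ∈ Metric.ball t₀ δ, ∀ w ∈ Metric.ball (0 : Fin n → ℂ) δ,
      hL.normSq _ (s (Φ.chart.symm (t, w))) = Real.exp (-W (t, w)) := by
    intro t ht w hw
    rw [hW, neg_neg, Real.exp_log (hL.normSq_pos (hs.2.1 _ (hbox t ht w hw).2.1))]
  have hWlip : ∀ t ∈ Metric.ball t₀ δ, ∀ w ∈ Metric.ball (0 : Fin n → ℂ) δ,
      |W (t, w) - ψ t| ≤ C₁ * ‖w‖ := by
    intro t ht w hw
    have := hC₁.dist_le_mul _ (hboxS t ht w hw).2.1 _ (hboxS t ht 0 h0δ).2.1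
    rw [Real.dist_eq, dist_prod_same_left, dist_zero_right] at this
    rw [hψ]; exact this
  have hψc : ContinuousOn ψ (Metric.ball t₀ δ) := by
    intro t ht
    have h1 := (hL.contDiffAt_weight Φ hs (hbox t ht 0 h0δ).1 (hbox t ht 0 h0δ).2.1).continuousAt
    rw [hψ]
    exact (ContinuousAt.comp (f := fun t : Fin m → ℂ => (t, (0 : Fin n → ℂ))) (x := t) h1
      (by fun_prop)).continuousWithinAt
  -- Chosen so that a remainder of size `(r^{k+1})²` equals `r⁴` times `ε = (r^{3n+5})²`.
  set k := 3 * n + 6 with hk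
  obtain ⟨C₄, hC₄, hfar⟩ := exists_le_mul_peakRemainder l b k hv hinj ⟨_, hb⟩
    (Φ.isOpen_box t₀ δ δ) ⟨hx₀, by rw [Set.mem_preimage, hz₀]; exact ⟨ht₀δ, h0δ⟩⟩
  -- With the summand `1`, `r D` bounds both `|ζ a_Y|` for `|ζ| = r` and the fibre radius `ρ ≤ r`.
  set D := ‖aY‖ + 1 with hD
  set c₅ : ℝ := (N + 1) * ((C₂ * D) ^ (k + 1)) ^ 2 with hc₅
  have hc₅0 : 0 ≤ c₅ := by positivity
  obtain ⟨κ, hκ, hpeak⟩ := exists_le_peakMass n (1 + c₅) (by positivity)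
  set M := (l2NormSq (lineFrames hL) (Φ.base.symm t₀) u).toReal with hM
  have hM' : l2NormSq (lineFrames hL) (Φ.base.symm t₀) u = ENNReal.ofReal M :=
    (ENNReal.ofReal_toReal (l2NormSq_lineFrames_lt_top hp hu).ne).symm
  set A := ‖v₀ 0‖ ^ 2 * Real.exp (-ψ t₀) with hA
  have hA0 : 0 < A := mul_pos (pow_pos (norm_pos_iff.2 hv₀0) 2) (Real.exp_pos _)
  refine ⟨2 * C₁ + C₃ + ((n + 1) * c₅ + C₄ ^ (n + 1) * M / (A * κ)), ?_⟩
  have hDpos : 0 < D := by positivity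
  filter_upwards [Ioo_mem_nhdsGT (lt_min one_pos (div_pos hδ0 hDpos))] with r hr
  obtain ⟨hr0, hr⟩ := hr
  have hr1 : r ≤ 1 := (hr.trans_le (min_le_left _ _)).le
  have hrD : r * D < δ := by
    rw [← lt_div_iff₀ hDpos]; exact hr.trans_le (min_le_right _ _)
  set ρ := r ^ 3 with hρ
  have hρ0 : 0 < ρ := by positivity
  have hρr : ρ ≤ r := by
    calc r ^ 3 ≤ r ^ 1 := pow_le_pow_of_le_one hr0.le hr1 (by norm_num)
      _ = r := pow_one r
  have hrrD : r ≤ r * D := le_mul_of_one_le_right hr0.le (by rw [hD]; linarith [norm_nonneg aY])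
  have hρδ : ρ ≤ δ := by linarith
  have hsubρ : Metric.ball (0 : Fin n → ℂ) ρ ⊆ Metric.ball 0 δ := Metric.ball_subset_ball hρδ
  have hcirc : ∀ ζ : ℂ, ‖ζ‖ ≤ r → t₀ + ζ • aY ∈ Metric.ball t₀ δ := by
    intro ζ hζ
    rw [mem_ball_iff_norm, add_sub_cancel_left, norm_smul]
    calc ‖ζ‖ * ‖aY‖ ≤ r * D := by
          rw [hD]; gcongr; linarith
      _ < δ := hrD
  have hci : CircleIntegrable (fun ζ => ψ (t₀ + ζ • aY)) 0 r := by
    refine ContinuousOn.circleIntegrable hr0.le (hψc.comp (by fun_prop) fun ζ hζ => ?_)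
    exact hcirc ζ (by simpa using (mem_sphere_zero_iff_norm.1 hζ).le)
  refine ⟨hci, ?_⟩
  -- The peak has mass at least of order `ε⁻¹ = r^{-(6n+10)}`, larger by `r^{-4}` than the bound
  -- `ρ^{-2(n+1)} = r^{-(6n+6)}` outside it.
  set e := 3 * n + 5 with he
  set ε : ℝ := (r ^ e) ^ 2 with hε
  have hε0 : 0 < ε := by positivity
  -- Widened parameter that absorbs the remainder over the whole circle.
  set ε' : ℝ := ε * (1 + c₅ * r ^ 4) with hε'
  have hε'0 : 0 < ε' := by positivity
  have hεε' : ε ≤ ε' := by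
    rw [hε', mul_add, mul_one]
    exact le_add_of_nonneg_right (by positivity)
  set g : X → ℝ := fun x => (peakMetric l q b k hv hε0).normSq x (peakSection l k hv n x) with hg
  have hcoord : ∀ t ∈ Metric.ball t₀ δ, ∀ z ∈ Metric.ball (0 : Fin n → ℂ) δ,
      g (Φ.chart.symm (t, z)) = ((sumSq z + peakRemainder l b k
        ((l (v (Φ.chart.symm (t, z))))⁻¹ • v (Φ.chart.symm (t, z))) + ε) ^ (n + 1))⁻¹ := by
    intro t ht z hz
    obtain ⟨h1, h2⟩ := hΦ _ (hbox t ht z hz).2.2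
    rw [Φ.chart.right_inv (hbox t ht z hz).1] at h2
    refine (peakMetric_normSq l q b k hv hε0 h1).trans ?_
    rw [← h2]
  -- The lift normalised by `l = 1` is Lipschitz and equals `b` at `x₀`. Each of the `N + 1`
  -- summands of the remainder is therefore at most `(C₂ r D)^{2(k+1)}`.
  have hrem : ∀ ζ : ℂ, ‖ζ‖ = r → ∀ z ∈ Metric.ball (0 : Fin n → ℂ) ρ,
      peakRemainder l b k ((l (v (Φ.chart.symm (t₀ + ζ • aY, z))))⁻¹ •
        v (Φ.chart.symm (t₀ + ζ • aY, z))) ≤ ε * (c₅ * r ^ 4) := by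
    intro ζ hζ z hz
    have ht := hcirc ζ hζ.le
    have hlx := (hΦ _ (hbox _ ht z (hsubρ hz)).2.2).1
    have h1 := hC₂.dist_le_mul _ (hboxS _ ht z (hsubρ hz)).2.2 _ (hboxS _ ht₀δ 0 h0δ).2.2
    rw [e₀, ← hb, dist_eq_norm] at h1
    have h2 : dist (t₀ + ζ • aY, z) (t₀, (0 : Fin n → ℂ)) ≤ r * D := by
      rw [Prod.dist_eq, dist_zero_right, dist_eq_norm, add_sub_cancel_left, norm_smul, hζ]
      refine max_le ?_ ?_
      · rw [hD]; gcongr; linarith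
      · linarith [mem_ball_zero_iff.1 hz]
    set a := (l (v (Φ.chart.symm (t₀ + ζ • aY, z))))⁻¹ • v (Φ.chart.symm (t₀ + ζ • aY, z)) with ha
    have hla : l a = 1 := by rw [ha, map_smul, smul_eq_mul, inv_mul_cancel₀ hlx]
    have h3 : ∀ i, (‖a i - l a * b i‖ ^ (k + 1)) ^ 2 ≤ ((C₂ * (r * D)) ^ (k + 1)) ^ 2 := by
      intro i
      have h4 : ‖a i - l a * b i‖ ≤ C₂ * (r * D) := by
        rw [hla, one_mul, ← Pi.sub_apply]
        refine (norm_le_pi_norm _ i).trans (h1.trans ?_)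
        gcongr
      gcongr
    refine (Finset.sum_le_sum fun i _ => h3 i).trans (le_of_eq ?_)
    rw [Finset.sum_const, Finset.card_univ, Fintype.card_fin, nsmul_eq_mul, hc₅, hε, hk, he]
    push_cast
    ring_nf
  have hw : ∀ ζ : ℂ, ‖ζ‖ = r → ∀ z ∈ Metric.ball (0 : Fin n → ℂ) ρ,
      Real.exp (-ψ (t₀ + ζ • aY) - C₁ * ρ) * ((sumSq z + ε') ^ (n + 1))⁻¹ ≤
        hL.normSq _ (s (Φ.chart.symm (t₀ + ζ • aY, z))) * g (Φ.chart.symm (t₀ + ζ • aY, z)) := by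
    intro ζ hζ z hz
    have ht := hcirc ζ hζ.le
    rw [hnormSq _ ht z (hsubρ hz), hcoord _ ht z (hsubρ hz)]
    have h1 := (abs_le.1 (hWlip _ ht z (hsubρ hz))).2
    have h2 : C₁ * ‖z‖ ≤ C₁ * ρ := by gcongr; exact (mem_ball_zero_iff.1 hz).le
    have h3 := sumSq_nonneg z
    have h4 := peakRemainder_nonneg l b k ((l (v (Φ.chart.symm (t₀ + ζ • aY, z))))⁻¹ •
        v (Φ.chart.symm (t₀ + ζ • aY, z)))
    have h5 := hrem ζ hζ z hz
    refine mul_le_mul (Real.exp_le_exp.2 (by linarith)) ?_ (by positivity) (Real.exp_nonneg _)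
    refine inv_anti₀ (by positivity) (pow_le_pow_left₀ (by positivity) ?_ _)
    rw [hε', mul_add, mul_one]
    linarith
  have hσ := isHolSectionOn_peakSection l k hv (n := n)
  set u' := tensorSection u (peakSection l k hv n) with hu'
  have hGf : tensorFrames hL (peakMetric l q b k hv hε0) U'
      (fun x => s x ⊗ₜ[ℂ] peakSection l k hv n x) (fun x => hL.normSq x (s x) * g x) :=
    ⟨s, _, peakSection l k hv n, _, hs'.lineFrames,
      IsHolFrame.lineFrames ⟨hs'.1, fun x hx => peakSection_ne_zero l k hv (hΦ x hx.2).1,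
        hσ.mono (Set.subset_univ _)⟩, fun x _ => ⟨rfl, rfl⟩⟩
  have hr' : Represents Φ U' (fun x => s x ⊗ₜ[ℂ] peakSection l k hv n x) (Φ.base.symm t₀) u' v₀ := by
    have := hr₀.tensorSection (s₂ := peakSection l k hv n) (σ := peakSection l k hv n)
      (c := fun _ => 1) (s := fun x => s x ⊗ₜ[ℂ] peakSection l k hv n x) (fun x _ => by simp)
      (fun x _ => rfl)
    simpa using this
  set J := (peakMass n ε' ρ).toReal with hJ
  have hJ' : peakMass n ε' ρ = ENNReal.ofReal J :=
    (ENNReal.ofReal_toReal (peakMass_lt_top hε'0 ρ).ne).symm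
  -- Apply the lower bound for peaks with `s = r^e = √ε`, using `ε' ≤ (1 + c₅) s²`.
  have hJκ : κ * ((r ^ e) ^ 2)⁻¹ ≤ J := by
    have h1 := hpeak (r ^ e) ρ ε' (by positivity)
      (pow_le_pow_of_le_one hr0.le hr1 (by omega)) hε'0 (by
        rw [hε', mul_comm]
        gcongr
        exact mul_le_of_le_one_right hc₅0 (pow_le_one₀ hr0.le hr1))
    rw [hJ'] at h1
    exact (ENNReal.ofReal_le_ofReal_iff ENNReal.toReal_nonneg).1 h1
  have hJ0 : 0 < J := lt_of_lt_of_le (by positivity) hJκ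
  set K := A * Real.exp ((C₁ + C₃) * r ^ 3) * (1 + c₅ * r ^ 4) ^ (n + 1) * J +
        C₄ ^ (n + 1) * (((r ^ 3) ^ 2) ^ (n + 1))⁻¹ * M with hK
  have hM0 : 0 ≤ M := ENNReal.toReal_nonneg
  have hC₄0 : 0 ≤ C₄ := by linarith
  have hK0 : 0 < K := by positivity
  have hnorm : l2NormSq (tensorFrames hL (peakMetric l q b k hv hε0)) (Φ.base.symm t₀) u' ≤
      ENNReal.ofReal K := by
    have h1 := l2NormSq_tensorSection_le_of_peak (hE := peakMetric l q b k hv hε0) Φ hs' hδ0 hρδ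
      hbox hσ hu hr₀
      (A := A * Real.exp ((C₁ + C₃) * r ^ 3)) (ε := ε) (C := C₄ ^ (n + 1) * ((ρ ^ 2) ^ (n + 1))⁻¹)
      (fun z hz => by
        rw [hnormSq _ ht₀δ z (hsubρ hz)]
        have h1 := hball₂ z (Metric.ball_subset_ball (hρδ.trans (min_le_right _ _)) hz)
        have h2 := (abs_le.1 (hWlip _ ht₀δ z (hsubρ hz))).1
        have hz' := (mem_ball_zero_iff.1 hz).le
        have h3 : C₁ * ‖z‖ ≤ C₁ * ρ := by gcongr
        have h4 : C₃ * ‖z‖ ≤ C₃ * ρ := by gcongr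
        calc ‖v₀ z‖ ^ 2 * Real.exp (-W (t₀, z))
            ≤ (‖v₀ 0‖ ^ 2 * Real.exp (C₃ * ρ)) * Real.exp (-ψ t₀ + C₁ * ρ) := by
              refine mul_le_mul (h1.trans ?_) (Real.exp_le_exp.2 (by linarith))
                (Real.exp_nonneg _) (by positivity)
              gcongr
          _ = A * Real.exp ((C₁ + C₃) * r ^ 3) := by
              rw [hA, mul_assoc, mul_assoc, ← Real.exp_add, ← Real.exp_add]
              congr 2
              ring)
      (fun z hz => by
        refine (hcoord _ ht₀δ z (hsubρ hz)).le.trans ?_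
        have h3 := sumSq_nonneg z
        have h4 := peakRemainder_nonneg l b k ((l (v (Φ.chart.symm (t₀, z))))⁻¹ •
          v (Φ.chart.symm (t₀, z)))
        refine inv_anti₀ (by positivity) (pow_le_pow_left₀ (by positivity) ?_ _)
        exact add_le_add_left (le_add_of_nonneg_right h4) _)
      (fun x hx => by
        have hρ1 : ρ ≤ 1 := hρr.trans hr1
        -- Inside the large box, being off the peak means `|w| ≥ ρ`, which bounds the explicit
        -- formula. Outside it, the compactness bound applies and `ρ ≤ 1` lets both cases share one
        -- constant.
        by_cases hxδ : x ∈ Φ.box t₀ δ δ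
        · have h1 := hcoord _ hxδ.2.1 _ hxδ.2.2
          rw [Prod.mk.eta, Φ.chart.left_inv hxδ.1] at h1
          have h2 : ρ ≤ ‖(Φ.chart x).2‖ := by
            by_contra! h
            exact hx ⟨hxδ.1, hxδ.2.1, mem_ball_zero_iff.2 h⟩
          have h3 := norm_sq_le_sumSq (Φ.chart x).2
          have h4 := peakRemainder_nonneg l b k ((l (v x))⁻¹ • v x)
          have h5 : ρ ^ 2 ≤ ‖(Φ.chart x).2‖ ^ 2 := by gcongr
          refine h1.le.trans (le_trans ?_ (le_mul_of_one_le_left (by positivity)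
            (one_le_pow₀ hC₄)))
          exact inv_anti₀ (by positivity) (pow_le_pow_left₀ (by positivity) (by linarith) _)
        · refine (peakMetric_normSq_le l q b k hv hε0 (hfar x hxδ) hC₄0).trans ?_
          refine le_mul_of_one_le_right (by positivity) ((one_le_inv₀ (by positivity)).2 ?_)
          exact pow_le_one₀ (by positivity) (pow_le_one₀ hρ0.le hρ1))
    refine h1.trans ?_
    rw [hM', ← ENNReal.ofReal_mul (by positivity)]
    refine (add_le_add_left (mul_le_mul_right (peakMass_le_ratio hε0 hεε' ρ) _) _).trans
      (le_of_eq ?_)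
    rw [hJ', ← ENNReal.ofReal_mul (by positivity), ← ENNReal.ofReal_mul (by positivity),
      ← ENNReal.ofReal_add (by positivity) (by positivity), hε', mul_div_cancel_left₀ _ hε0.ne']
    congr 1
    rw [hK]
    ring
  -- The two estimates combine so that `log J` and `log |v₀(0)|` cancel, leaving only `ψ` and error
  -- terms.
  have hmain := (hG b k ε hε0).le_circleAverage Φ hGf
    (fun x hx => tmul_ne_zero (hs'.2.1 x hx) (peakSection_ne_zero l k hv (hΦ x hx.2).1))
    (ρ := ρ) (ε := ε') (η := C₁ * ρ) hρδ hr0.le hbox hcirc hci hw hJ0 hJ'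
    (tensorSection_mem hu hσ) hr' hv₀0 hK0 hnorm
  have hlog := log_le_of_peak (n := n) (c := C₁ + C₃) (c₄ := C₄ ^ (n + 1)) (M := M) hr0 hA0
    (by positivity) hc₅0 (by positivity) hM0 hκ hJκ
  have hlogA : Real.log A = 2 * Real.log ‖v₀ 0‖ - ψ t₀ := by
    rw [hA, Real.log_mul (pow_pos (norm_pos_iff.2 hv₀0) 2).ne' (Real.exp_ne_zero _), Real.log_exp,
      Real.log_pow]
    push_cast; ring
  have h43 : ((n + 1) * c₅ + C₄ ^ (n + 1) * M / (A * κ)) * r ^ 4 ≤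
      ((n + 1) * c₅ + C₄ ^ (n + 1) * M / (A * κ)) * r ^ 3 :=
    mul_le_mul_of_nonneg_left (pow_le_pow_of_le_one hr0.le hr1 (by norm_num)) (by positivity)
  have hρ' : C₁ * ρ = C₁ * r ^ 3 := by rw [hρ]
  rw [hlogA] at hlog
  rw [hρ'] at hmain
  rw [← hK] at hlog
  have hexp : (2 * C₁ + C₃ + ((n + 1) * c₅ + C₄ ^ (n + 1) * M / (A * κ))) * r ^ 3 =
      C₁ * r ^ 3 + (C₁ + C₃) * r ^ 3 + ((n + 1) * c₅ + C₄ ^ (n + 1) * M / (A * κ)) * r ^ 3 := by ring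
  rw [hexp]
  clear_value K J M A c₅ ρ ε ε' W
  linarith only [hmain, hlog, h43]

end Estimate


/-! ### Semi-positivity of the curvature -/

section Conclusion

theorem hessTrace_continuousAt {E : Type*} [NormedAddCommGroup E] [NormedSpace ℂ E] {φ : E → ℝ}
    {z : E} (h : ContDiffAt ℝ ∞ φ z) (a : E) :
    ContinuousAt (fun q : E × E => hessTrace φ q.1 q.2) (z, a) := by
  have h1 : ContDiffAt ℝ 1 (fderiv ℝ φ) z := h.fderiv_right (by norm_cast)
  have h2 : ContinuousAt (fderiv ℝ (fderiv ℝ φ)) z :=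
    (h1.fderiv_right (m := 0) (by norm_num)).continuousAt
  have h3 : ContinuousAt (fun q : E × E => fderiv ℝ (fderiv ℝ φ) q.1) (z, a) :=
    ContinuousAt.comp (f := Prod.fst) h2 continuousAt_fst
  have h4 : ContinuousAt (fun q : E × E => q.2) (z, a) := continuousAt_snd
  have h5 : ContinuousAt (fun q : E × E => Complex.I • q.2) (z, a) := h4.const_smul _
  exact ((h3.clm_apply h4).clm_apply h4).add ((h3.clm_apply h5).clm_apply h5)

theorem exists_lift_frame_one {d N : ℕ} {X : Type*} [TopologicalSpace X]
    [ChartedSpace (Fin d → ℂ) X] [IsManifold 𝓘(ℂ, Fin d → ℂ) ω X] {v : X → Fin (N + 1) → ℂ}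
    (hv : IsHomogeneousLift d v) :
    ∃ σ : ∀ x, PowerBundle hv (0 * 0) x, IsHolFrame d (PowerBundle hv (0 * 0)) Set.univ σ ∧
      ∀ x, (powerMetric hv (basePointFree_one N) 0).normSq x (σ x) ≤ 1 := by
  refine ⟨powerSection hv (0 * 0) fun _ => 1, ⟨isOpen_univ, fun x _ => ?_,
    isHolSectionOn_powerSection hv contDiff_const (by simp)⟩, fun x => ?_⟩
  · exact div_ne_zero one_ne_zero (pow_ne_zero _ (coordinate_indexAt_ne_zero hv _ x))
  · rw [powerMetric_normSq_powerSection]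
    simp

variable {m n N : ℕ} {X Y : Type*} [TopologicalSpace X] [ChartedSpace (Fin (m + n) → ℂ) X]
  [TopologicalSpace Y] [ChartedSpace (Fin m → ℂ) Y] {p : X → Y}
  [IsManifold 𝓘(ℂ, Fin (m + n) → ℂ) ω X] [IsManifold 𝓘(ℂ, Fin m → ℂ) ω Y]

/-- The coordinate change has invertible derivative, and for `m > 0` there are vectors with non-zero
base component to pull back. -/
theorem AdaptedChart.exists_fderiv_fst_ne_zero (hm : 0 < m) (Φ : AdaptedChart m n p) {x₀ : X}
    (hx : x₀ ∈ Φ.chart.source) {c : OpenPartialHomeomorph X (Fin (m + n) → ℂ)}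
    (hc : c ∈ IsManifold.maximalAtlas 𝓘(ℂ, Fin (m + n) → ℂ) ω X) (hxc : x₀ ∈ c.source) :
    ∃ a, (fderiv ℂ (Φ.chart ∘ c.symm) (c x₀) a).1 ≠ 0 := by
  have hcs : MDifferentiableAt 𝓘(ℂ, Fin (m + n) → ℂ) 𝓘(ℂ, Fin (m + n) → ℂ) c.symm (c x₀) :=
    ((contMDiffOn_symm_of_mem_maximalAtlas hc).contMDiffAt
      (c.open_target.mem_nhds (c.map_source hxc))).mdifferentiableAt (by simp)
  have hcx : MDifferentiableAt 𝓘(ℂ, Fin (m + n) → ℂ) 𝓘(ℂ, Fin (m + n) → ℂ) c x₀ :=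
    ((contMDiffOn_of_mem_maximalAtlas hc).contMDiffAt
      (c.open_source.mem_nhds hxc)).mdifferentiableAt (by simp)
  have e1 : Φ.chart.symm (Φ.chart x₀) = x₀ := Φ.chart.left_inv hx
  have e2 : c.symm (c x₀) = x₀ := c.left_inv hxc
  have h1 : DifferentiableAt ℂ (Φ.chart ∘ c.symm) (c x₀) := by
    refine mdifferentiableAt_iff_differentiableAt.1 (MDifferentiableAt.comp (c x₀) ?_ hcs)
    rw [e2]; exact Φ.mdifferentiableAt_chart hx
  have h2 : DifferentiableAt ℂ (c ∘ Φ.chart.symm) (Φ.chart x₀) := by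
    refine mdifferentiableAt_iff_differentiableAt.1 (MDifferentiableAt.comp (Φ.chart x₀) ?_
      (Φ.mdifferentiableAt_symm (Φ.chart.map_source hx)))
    rw [e1]; exact hcx
  have h3 : HasFDerivAt ((Φ.chart ∘ c.symm) ∘ (c ∘ Φ.chart.symm))
      ((fderiv ℂ (Φ.chart ∘ c.symm) (c x₀)) ∘L (fderiv ℂ (c ∘ Φ.chart.symm) (Φ.chart x₀)))
      (Φ.chart x₀) := by
    refine HasFDerivAt.comp (Φ.chart x₀) ?_ h2.hasFDerivAt
    rw [Function.comp_apply, e1]; exact h1.hasFDerivAt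
  have h4 : (Φ.chart ∘ c.symm) ∘ (c ∘ Φ.chart.symm) =ᶠ[𝓝 (Φ.chart x₀)] id := by
    have hnear : ∀ᶠ q in 𝓝 (Φ.chart x₀), Φ.chart.symm q ∈ c.source := by
      refine (Φ.chart.continuousAt_symm (Φ.chart.map_source hx)).eventually_mem ?_
      rw [e1]; exact c.open_source.mem_nhds hxc
    filter_upwards [hnear, Φ.chart.open_target.mem_nhds (Φ.chart.map_source hx)] with q hq hqt
    simp only [Function.comp, id]
    rw [c.left_inv hq, Φ.chart.right_inv hqt]
  have h5 := h3.unique ((hasFDerivAt_id (Φ.chart x₀)).congr_of_eventuallyEq h4)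
  refine ⟨fderiv ℂ (c ∘ Φ.chart.symm) (Φ.chart x₀) (fun _ => 1, 0), fun h0 => ?_⟩
  have h6 := congrArg (fun M => (M ((fun _ => 1 : Fin m → ℂ), (0 : Fin n → ℂ))).1) h5
  have h7 : (0 : Fin m → ℂ) = fun _ => 1 := h0.symm.trans h6
  exact zero_ne_one (congrFun h7 ⟨0, hm⟩)

variable {L : X → Type*} [TopologicalSpace (TotalSpace ℂ L)] [∀ x, AddCommGroup (L x)]
  [∀ x, Module ℂ (L x)] [∀ x, TopologicalSpace (L x)] [FiberBundle ℂ L] [VectorBundle ℂ ℂ L]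
  [ContMDiffVectorBundle ω ℂ L 𝓘(ℂ, Fin (m + n) → ℂ)] {hL : HermitianMetric (m + n) L}

theorem HermitianMetric.contDiffAt_weight_chart (hL : HermitianMetric (m + n) L) {U : Set X}
    {s : ∀ x, L x} (hs : IsHolFrame (m + n) L U s) {c : OpenPartialHomeomorph X (Fin (m + n) → ℂ)}
    (hc : c ∈ IsManifold.maximalAtlas 𝓘(ℂ, Fin (m + n) → ℂ) ω X) {z : Fin (m + n) → ℂ}
    (hz : z ∈ c.target) (hzU : c.symm z ∈ U) :
    ContDiffAt ℝ ∞ (fun z => -Real.log (hL.normSq (c.symm z) (s (c.symm z)))) z := by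
  have h1 : ContMDiffAt 𝓘(ℝ, Fin (m + n) → ℂ) 𝓘(ℝ, ℝ) ∞ (fun x => hL.normSq x (s x)) (c.symm z) :=
    (hL.smooth U s hs).contMDiffAt (hs.1.mem_nhds hzU)
  have h2 : ContMDiffAt 𝓘(ℝ, Fin (m + n) → ℂ) 𝓘(ℝ, Fin (m + n) → ℂ) ∞ c.symm z :=
    contMDiffAt_real ((contMDiffOn_symm_of_mem_maximalAtlas hc).contMDiffAt
      (c.open_target.mem_nhds hz))
  have h3 : ContDiffAt ℝ ∞ (fun z => hL.normSq (c.symm z) (s (c.symm z))) z :=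
    (ContMDiffAt.comp z h1 h2).contDiffAt
  exact (h3.log (hL.normSq_pos (hs.2.1 _ hzU)).ne').neg

/-- In suitable coordinates the curve `ζ ↦ (t₀ + ζ a_Y, 0)` has velocity `a` in the chart `c`, and
the weight satisfies the approximate sub-mean value inequality along it. Its second-order term in
`c` is not controlled, but does not affect the Hessian trace. -/
theorem hessTrace_weight_nonneg [CompactSpace X] [T2Space Y]
    (hp : Manifold.IsSubmersion 𝓘(ℂ, Fin (m + n) → ℂ) 𝓘(ℂ, Fin m → ℂ) ω p)
    {v : X → Fin (N + 1) → ℂ} (hv : IsHomogeneousLift (m + n) v) {x₀ : X}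
    (hinj : ∀ x (c : ℂ), v x = c • v x₀ → x = x₀)
    (himm : ∃ (U : Set X) (F : X → Fin (N + 1) → ℂ), IsOpen U ∧ x₀ ∈ U ∧
        ContMDiffOn 𝓘(ℂ, Fin (m + n) → ℂ) 𝓘(ℂ, Fin (N + 1) → ℂ) ω F U ∧
        (∀ x' ∈ U, F x' ≠ 0 ∧ ∃ c : ℂ, c ≠ 0 ∧ v x' = c • F x') ∧
        ∀ a : TangentSpace 𝓘(ℂ, Fin (m + n) → ℂ) x₀,
          (mfderiv 𝓘(ℂ, Fin (m + n) → ℂ) 𝓘(ℂ, Fin (N + 1) → ℂ) F x₀ a : Fin (N + 1) → ℂ) ∈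
            Submodule.span ℂ {F x₀} → a = 0)
    (hG : ∀ (l : (Fin (N + 1) → ℂ) →ₗ[ℂ] ℂ) (q : (Fin (N + 1) → ℂ) →ₗ[ℂ] (Fin n → ℂ)) b k (ε : ℝ)
      (hε : 0 < ε), GriffithsSemiPositive m n p (tensorFrames hL (peakMetric l q b k hv hε)))
    {U : Set X} {s : ∀ x, L x} (hs : IsHolFrame (m + n) L U s) (hx₀U : x₀ ∈ U)
    (hbase : x₀ ∉ fibreBaseLocus p hL) (Φ : AdaptedChart m n p) (hx₀ : x₀ ∈ Φ.chart.source)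
    {c : OpenPartialHomeomorph X (Fin (m + n) → ℂ)}
    (hc : c ∈ IsManifold.maximalAtlas 𝓘(ℂ, Fin (m + n) → ℂ) ω X) (hxc : x₀ ∈ c.source)
    {a : Fin (m + n) → ℂ} (ha : (fderiv ℂ (Φ.chart ∘ c.symm) (c x₀) a).1 ≠ 0) :
    0 ≤ hessTrace (fun z => -Real.log (hL.normSq (c.symm z) (s (c.symm z)))) (c x₀) a := by
  obtain ⟨V, F, hV, hxV, hF, hvF, himm⟩ := himm
  obtain ⟨Ψ, l, q, aY, hxΨ, hΨ₀, hΨ, hγ, hγ'⟩ :=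
    Φ.exists_projective_coordinates hx₀ hV hxV hF hvF himm hc hxc ha
  obtain ⟨C, hC⟩ := exists_le_circleAverage_add hp hv hinj Ψ hxΨ hΨ₀ hΨ (hG l q) hs hx₀U hbase aY rfl
  set t₀ := (Ψ.chart x₀).1 with ht₀
  have e₀ : Ψ.chart.symm (t₀, 0) = x₀ := by
    rw [← hΨ₀, Prod.mk.eta, Ψ.chart.left_inv hxΨ]
  have e₁ : c.symm (c x₀) = x₀ := c.left_inv hxc
  set γ : ℂ → Fin (m + n) → ℂ := fun ζ => c (Ψ.chart.symm (t₀ + ζ • aY, 0)) with hγd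
  have hγ0 : γ 0 = c x₀ := by simp only [hγd]; rw [zero_smul, add_zero, e₀]
  obtain ⟨b, hb⟩ := exists_isLittleO_of_analyticAt hγ.analyticAt
  rw [hγ0, hγ'] at hb
  have hcont : ContinuousAt (fun ζ : ℂ => Ψ.chart.symm (t₀ + ζ • aY, 0)) 0 := by
    have h1 : ContinuousAt Ψ.chart.symm ((fun ζ : ℂ => (t₀ + ζ • aY, (0 : Fin n → ℂ))) 0) := by
      refine Ψ.chart.continuousAt_symm ?_
      have := Ψ.chart.map_source hxΨ
      simpa [← hΨ₀] using this
    exact ContinuousAt.comp (f := fun ζ : ℂ => (t₀ + ζ • aY, (0 : Fin n → ℂ))) h1 (by fun_prop)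
  have hnear : ∀ᶠ ζ in 𝓝 (0 : ℂ), Ψ.chart.symm (t₀ + ζ • aY, 0) ∈ c.source := by
    refine hcont.eventually_mem ?_
    simp only [zero_smul, add_zero, e₀]
    exact c.open_source.mem_nhds hxc
  obtain ⟨δ, hδ, hball⟩ := Metric.eventually_nhds_iff_ball.1 hnear
  refine hessTrace_nonneg_of_submean (γ := γ) (C := C) ?_ hb ?_
  · exact (hL.contDiffAt_weight_chart hs hc (c.map_source hxc) (by rwa [e₁])).of_le (by norm_cast)
  · filter_upwards [hC, Ioo_mem_nhdsGT hδ] with r hr hrδ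
    have hcongr : Set.EqOn (fun ζ => -Real.log (hL.normSq (Ψ.chart.symm (t₀ + ζ • aY, 0))
        (s (Ψ.chart.symm (t₀ + ζ • aY, 0)))))
        (fun ζ => -Real.log (hL.normSq (c.symm (γ ζ)) (s (c.symm (γ ζ)))))
        (Metric.sphere 0 |r|) := by
      intro ζ hζ
      have hζ' : ζ ∈ Metric.ball (0 : ℂ) δ := by
        rw [mem_ball_zero_iff, mem_sphere_zero_iff_norm.1 hζ, abs_of_pos hrδ.1]
        exact hrδ.2
      simp only
      rw [c.left_inv (hball ζ hζ')]
    rw [Real.circleAverage_congr_sphere hcongr] at hr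
    refine ⟨(circleIntegrable_congr hcongr).1 hr.1, ?_⟩
    rw [e₁]
    have h := hr.2
    beta_reduce at h
    rwa [e₀] at h

/-- If `p_*(K_{X/Y} ⊗ L ⊗ E)` is Griffiths semi-positive for all semi-positive `E`, then `L` is
semi-positive. -/
theorem semiPositive_of_griffithsSemiPositive (hm : 0 < m) [ConnectedSpace X] [T2Space Y]
    (hX : IsProjective (m + n) X)
    (hp : Manifold.IsSubmersion 𝓘(ℂ, Fin (m + n) → ℂ) 𝓘(ℂ, Fin m → ℂ) ω p)
    (hne : ∃ y : Y, fibreSections (m := m) (n := n) p (lineFrames hL) y ≠ ⊥)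
    (hpos : ∀ (E : X → Type) [TopologicalSpace (TotalSpace ℂ E)] [∀ x, AddCommGroup (E x)]
      [∀ x, Module ℂ (E x)] [∀ x, TopologicalSpace (E x)] [FiberBundle ℂ E] [VectorBundle ℂ ℂ E]
      [ContMDiffVectorBundle ω ℂ E 𝓘(ℂ, Fin (m + n) → ℂ)] (hE : HermitianMetric (m + n) E),
      hE.SemiPositive → GriffithsSemiPositive m n p (tensorFrames hL hE)) :
    hL.SemiPositive := by
  have : CompactSpace X := hX.1
  obtain ⟨N, v, hv, hinj, himm⟩ := hX.exists_lift
  obtain ⟨σ, hσ, hσ1⟩ := exists_lift_frame_one hv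
  have hdense := dense_compl_fibreBaseLocus hp hσ hσ1
    (hpos _ _ (powerMetric_semiPositive hv _ _)) hne
  have hG : ∀ (l : (Fin (N + 1) → ℂ) →ₗ[ℂ] ℂ) (q : (Fin (N + 1) → ℂ) →ₗ[ℂ] (Fin n → ℂ)) b k (ε : ℝ)
      (hε : 0 < ε), GriffithsSemiPositive m n p (tensorFrames hL (peakMetric l q b k hv hε)) :=
    fun l q b k ε hε => hpos _ _ (powerMetric_semiPositive hv _ _)
  intro U s hs c hc z hz hzU a
  set φ : (Fin (m + n) → ℂ) → ℝ := fun z => -Real.log (hL.normSq (c.symm z) (s (c.symm z))) with hφ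
  have hφc : ∀ z ∈ c.target ∩ c.symm ⁻¹' U, ContDiffAt ℝ ∞ φ z := fun z hz =>
    hL.contDiffAt_weight_chart hs hc hz.1 hz.2
  rw [leviForm_eq_hessTrace a ((hφc z ⟨hz, hzU⟩).of_le (by norm_cast))]
  refine mul_nonneg (by norm_num) ?_
  -- A negative value persists for nearby points and directions, among which there are a point
  -- outside the base locus and a non-vertical direction.
  by_contra! hneg
  have hev := (hessTrace_continuousAt (hφc z ⟨hz, hzU⟩) a).eventually (eventually_lt_nhds hneg)
  have hev1 := hev.curry_nhds.and ((c.symm.isOpen_inter_preimage hs.1).mem_nhds ⟨hz, hzU⟩)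
  obtain ⟨O, hO, hOo, hzO⟩ := eventually_nhds_iff.1 hev1
  obtain ⟨x, ⟨hxc, hxO⟩, hxN⟩ := hdense.inter_open_nonempty _ (c.isOpen_inter_preimage hOo)
    ⟨c.symm z, c.map_target hz, by rw [Set.mem_preimage, c.right_inv hz]; exact hzO⟩
  obtain ⟨hx1, -, hxU⟩ := hO _ hxO
  rw [Set.mem_preimage, c.left_inv hxc] at hxU
  obtain ⟨Φ, hxΦ⟩ := exists_adaptedChart hp x
  obtain ⟨a', ha'⟩ := Φ.exists_fderiv_fst_ne_zero hm hxΦ hc hxc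
  -- If `a` itself is vertical at `x`, every perturbation `a + ε a'` with `ε ≠ 0` is not.
  have hnonvert : ∃ᶠ a₁ in 𝓝 a, (fderiv ℂ (Φ.chart ∘ c.symm) (c x) a₁).1 ≠ 0 := by
    rw [Filter.frequently_iff_forall_eventually_exists_and]
    intro Q hQ
    have hline : Filter.Tendsto (fun ε : ℂ => a + ε • a') (𝓝 0) (𝓝 a) := by
      have : Continuous fun ε : ℂ => a + ε • a' := by fun_prop
      simpa using this.tendsto 0
    by_cases h0 : (fderiv ℂ (Φ.chart ∘ c.symm) (c x) a).1 = 0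
    · obtain ⟨ε, hε, hε0⟩ := (((hline.eventually hQ).filter_mono nhdsWithin_le_nhds).and
        (self_mem_nhdsWithin (s := {(0 : ℂ)}ᶜ))).exists
      refine ⟨_, ?_, hε⟩
      rw [map_add, map_smul, Prod.fst_add, h0, zero_add, Prod.smul_fst]
      exact smul_ne_zero hε0 ha'
    · exact ⟨a, h0, hQ.self_of_nhds⟩
  obtain ⟨a₁, ha₁, hlt⟩ := (hnonvert.and_eventually hx1).exists
  exact hlt.not_ge (hessTrace_weight_nonneg hp hv (fun x' k => hinj x x' k) (himm x) hG hs hxU hxN Φ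
    hxΦ hc hxc ha₁)

end Conclusion

end DirectImage

end

theorem theorem1p4 (m n : ℕ) (hm : 0 < m)
    {X : Type*} [TopologicalSpace X] [T2Space X] [ConnectedSpace X]
    [ChartedSpace (Fin (m + n) → ℂ) X] [IsManifold 𝓘(ℂ, Fin (m + n) → ℂ) ω X]
    {Y : Type*} [TopologicalSpace Y] [T2Space Y] [SecondCountableTopology Y] [ConnectedSpace Y]
    [ChartedSpace (Fin m → ℂ) Y] [IsManifold 𝓘(ℂ, Fin m → ℂ) ω Y]
    (hX : DirectImage.IsProjective (m + n) X)
    (p : X → Y)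
    (hp : Manifold.IsSubmersion 𝓘(ℂ, Fin (m + n) → ℂ) 𝓘(ℂ, Fin m → ℂ) ω p)
    (L : X → Type*) [TopologicalSpace (TotalSpace ℂ L)] [∀ x, AddCommGroup (L x)]
    [∀ x, Module ℂ (L x)] [∀ x, TopologicalSpace (L x)] [FiberBundle ℂ L] [VectorBundle ℂ ℂ L]
    [ContMDiffVectorBundle ω ℂ L 𝓘(ℂ, Fin (m + n) → ℂ)]
    (hL : DirectImage.HermitianMetric (m + n) L)
    (hne : ∃ y : Y, DirectImage.fibreSections (m := m) (n := n) p (DirectImage.lineFrames hL) y ≠ ⊥)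
    (hpos : ∀ (E : X → Type) [TopologicalSpace (TotalSpace ℂ E)] [∀ x, AddCommGroup (E x)]
      [∀ x, Module ℂ (E x)] [∀ x, TopologicalSpace (E x)] [FiberBundle ℂ E] [VectorBundle ℂ ℂ E]
      [ContMDiffVectorBundle ω ℂ E 𝓘(ℂ, Fin (m + n) → ℂ)]
      (hE : DirectImage.HermitianMetric (m + n) E), hE.SemiPositive →
      DirectImage.GriffithsSemiPositive m n p (DirectImage.tensorFrames hL hE)) :
    hL.SemiPositive :=
  DirectImage.semiPositive_of_griffithsSemiPositive hm hX hp hne hpos
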